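/- **Theorem.** Let $n\ge 4$ and $2\le \ell\le n-2$. All manifolds and maps are smooth, and immersed submanifolds carry the induced metric. For an immersion $g\colon L^{n-\ell}\to\mathbb S^{n+1}\subset\mathbb R^{n+2}$ let $\Lambda=\{(x,w): w\in N_gL(x),\ \|w\|=1\}$ be its unit normal bundle (normal in $\mathbb S^{n+1}$), an $n$-dimensional embedded submanifold of $L\times\mathbb R^{n+2}$. For $\tau\in C^\infty(L)$ with $0<\tau<\pi/2$ and $\|\nabla\tau\|<1$, let $\Psi\colon\Lambda\to\mathbb S^{n+1}$ be $$\Psi(x,w)=\exp_{g(x)}\Big(-\tau(x)\big(g_*\nabla\tau(x)+\sqrt{1-\|\nabla\tau(x)\|^2}\,w\big)\Big),$$ where $\exp$ is the exponential map of $\mathbb S^{n+1}$. *Direct part.* Let $f\colon M^n\to\mathbb S^{n+1}$ be an immersed hypersurface oriented by a Gauss map $\eta$, with shape operator $A$ given by $\eta_*=-f_*\circ A$. Let $\lambda\colon M\to(0,\infty)$ be a continuous function such that $\dim\ker(A-\lambda I)=\ell$ at every point, write $\lambda=\cot\sigma$ with $0<\sigma<\pi/2$, let $T_\lambda=\ker(A-\lambda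 I)$, and let $h=\cos\sigma\, f+\sin\sigma\,\eta$ be the focal map. Let $V\subset M$ be an open saturated set (a union of maximal leaves of $T_\lambda$) whose space of leaves $L$ is a smooth Hausdorff $(n-\ell)$-manifold for which the projection $\pi\colon V\to L$ is a submersion. Then $h|_V=g\circ\pi$ for an immersion $g\colon L\to\mathbb S^{n+1}$ (the focal submanifold), and $\sigma|_V=\tau\circ\pi$ with $\tau\in C^\infty(L)$, $0<\tau<\pi/2$ and $\|\nabla\tau\|<1$ everywhere on $L$. Moreover, there is a local diffeomorphism $j\colon V\to\Lambda$ into the unit normal bundle of $g$ such that $f|_V=\Psi\circ j$. If $M$ is compact, then the space of leaves $L$ of all of $M$ is a compact Hausdorff $(n-\ell)$-manifold with $M\to L$ a submersion; and, taking $V=M$, the map $j\colon M\to\Lambda$ above is a surjective covering map and $\Psi$ is a global parametrization, that is, $\Psi$ is an immersion on all of $\Lambda$ and $\Psi(\Lambda)=f(M)$. *Converse part.* Let $g\colon L^{n-\ell}\to\mathbb S^{n+1}$ be an immersion of a connected manifold, and let $\tau\in C^\infty(L)$ satisfy $0<\tau<\pi/2$ and $\|\nabla\tau\|<1$ everywhere.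 Then the set $M\subset\Lambda$ of points at which $\Psi$ is regular is open, and the hypersurface $\Psi|_M\colon M\to\mathbb S^{n+1}$ has, for a suitable Gauss map, the principal curvature $(x,w)\mapsto\cot\tau(x)$ with constant multiplicity $\ell$. -/

import Mathlib

open Set Topology Manifold
open scoped ContDiff

noncomputable section

namespace SphereHyp

/-- Euclidean space of dimension `d`. The unit sphere `S^{n+1}` is the set of unit vectors of
`Euc (n + 2)`, and maps into the sphere are treated as `Euc (n + 2)`-valued maps of norm one. -/
abbrev Euc (d : ℕ) : Type := EuclideanSpace ℝ (Fin d)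

section Immersions

variable (d : ℕ) {k : ℕ} {N : Type*} [TopologicalSpace N] [ChartedSpace (Euc d) N]

/-- The differential `f_*` at `x` of a map of a `d`-manifold into Euclidean space. -/
def differential (f : N → Euc k) (x : N) : TangentSpace (𝓡 d) x →L[ℝ] Euc k :=
  mfderiv (𝓡 d) 𝓘(ℝ, Euc k) f x

/-- `f` is, on the set `U`, a smooth immersion into the unit sphere of `Euc k`. The manifold is
understood to carry the metric induced by `f`. -/
structure IsSphereImmersionOn (f : N → Euc k) (U : Set N) : Prop where
  contMDiffOn : ContMDiffOn (𝓡 d) 𝓘(ℝ, Euc k) ∞ f U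
  norm_eq_one : ∀ x ∈ U, ‖f x‖ = 1
  injective_differential : ∀ x ∈ U, Function.Injective (differential d f x)

/-- `η` is, on `U`, a Gauss map of `f`: a smooth field of unit vectors which are tangent to the
sphere and normal to `f`. -/
structure IsGaussMapOn (f η : N → Euc k) (U : Set N) : Prop where
  contMDiffOn : ContMDiffOn (𝓡 d) 𝓘(ℝ, Euc k) ∞ η U
  norm_eq_one : ∀ x ∈ U, ‖η x‖ = 1
  inner_position : ∀ x ∈ U, inner ℝ (η x) (f x) = 0
  inner_tangent : ∀ x ∈ U, ∀ X : TangentSpace (𝓡 d) x, inner ℝ (η x) (differential d f x X) = 0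

open Classical in
/-- The shape operator `A` at `x` of a hypersurface `f` of the sphere with Gauss map `η`: the
endomorphism of the tangent space with `f_* (A X) = - η_* X` (Weingarten formula; it is unique
because `f_*` is injective). -/
def shapeOperator (f η : N → Euc k) (x : N) : Module.End ℝ (TangentSpace (𝓡 d) x) :=
  if h : ∃ A : Module.End ℝ (TangentSpace (𝓡 d) x),
      ∀ X, differential d f x (A X) = - differential d η x X
  then h.choose else 0

/-- The principal space `ker (A - lam I)` at `x`. -/
def principalSpace (f η : N → Euc k) (lam : N → ℝ) (x : N) :
    Submodule ℝ (TangentSpace (𝓡 d) x) :=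
  Module.End.eigenspace (shapeOperator d f η x) (lam x)

/-- On `U`, the continuous function `lam` is a principal curvature of constant multiplicity `l`
of the hypersurface `f` with Gauss map `η`. -/
structure IsPrincipalCurvatureOn (f η : N → Euc k) (lam : N → ℝ) (l : ℕ) (U : Set N) :
    Prop where
  continuousOn : ContinuousOn lam U
  finrank_eq : ∀ x ∈ U, Module.finrank ℝ (principalSpace d f η lam x) = l

/-- `x` and `y` are joined by a smooth curve which is everywhere tangent to the principal
distribution `ker (A - lam I)`. -/
def LeafCurve (f η : N → Euc k) (lam : N → ℝ) (x y : N) : Prop :=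
  ∃ γ : ℝ → N, ContMDiff 𝓘(ℝ, ℝ) (𝓡 d) ∞ γ ∧
    (∀ t : ℝ, mfderiv 𝓘(ℝ, ℝ) (𝓡 d) γ t (1 : ℝ) ∈ principalSpace d f η lam (γ t)) ∧
    γ 0 = x ∧ γ 1 = y

/-- Two points are equivalent when they lie on the same maximal leaf of the (integrable)
principal distribution, that is, when they are joined by a chain of smooth curves tangent to
the distribution. -/
def leafSetoid (f η : N → Euc k) (lam : N → ℝ) : Setoid N :=
  Relation.EqvGen.setoid (LeafCurve d f η lam)

/-- `V` is saturated: it is a union of maximal leaves of the principal distribution. -/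
def IsSaturated (f η : N → Euc k) (lam : N → ℝ) (V : Set N) : Prop :=
  ∀ x y, (leafSetoid d f η lam) x y → x ∈ V → y ∈ V

/-- The space of leaves of the principal distribution in the open (saturated) set `V`. -/
def LeafSpace (f η : N → Euc k) (lam : N → ℝ) (V : TopologicalSpace.Opens N) : Type _ :=
  Quotient ((leafSetoid d f η lam).comap (Subtype.val : V → N))

/-- The leaf space carries the quotient topology. -/
instance (f η : N → Euc k) (lam : N → ℝ) (V : TopologicalSpace.Opens N) :
    TopologicalSpace (LeafSpace d f η lam V) :=
  inferInstanceAs (TopologicalSpace (Quotient _))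

/-- The projection of `V` onto its space of leaves. -/
def leafProj (f η : N → Euc k) (lam : N → ℝ) (V : TopologicalSpace.Opens N) (x : V) :
    LeafSpace d f η lam V :=
  Quotient.mk ((leafSetoid d f η lam).comap (Subtype.val : V → N)) x

/-- With the given charts, the leaf space of `V` is a smooth Hausdorff `m`-manifold onto which
`V` projects by a smooth submersion. -/
structure IsLeafManifold (f η : N → Euc k) (lam : N → ℝ) (V : TopologicalSpace.Opens N)
    (m : ℕ) [ChartedSpace (Euc m) (LeafSpace d f η lam V)] : Prop where
  t2Space : T2Space (LeafSpace d f η lam V)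
  isManifold : IsManifold (𝓡 m) ∞ (LeafSpace d f η lam V)
  contMDiff_proj : ContMDiff (𝓡 d) (𝓡 m) ∞ (leafProj d f η lam V)
  surjective_mfderiv : ∀ x : V,
    Function.Surjective (mfderiv (𝓡 d) (𝓡 m) (leafProj d f η lam V) x)

/-- The focal map `h = cos σ f + sin σ η`. -/
def focalMap (f η : N → Euc k) (σ : N → ℝ) (x : N) : Euc k :=
  Real.cos (σ x) • f x + Real.sin (σ x) • η x

end Immersions

section NormalBundle

variable (m : ℕ) {k : ℕ} {L : Type*} [TopologicalSpace L] [ChartedSpace (Euc m) L]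

open Classical in
/-- The gradient of `τ` at `p` with respect to the metric induced by the immersion `g`: the
tangent vector `G` with `⟨g_* G, g_* Y⟩ = dτ(Y)` for all tangent vectors `Y` (unique because
`g_*` is injective). -/
def inducedGradient (g : L → Euc k) (τ : L → ℝ) (p : L) : TangentSpace (𝓡 m) p :=
  if h : ∃ G : TangentSpace (𝓡 m) p, ∀ Y : TangentSpace (𝓡 m) p,
      inner ℝ (differential m g p G) (differential m g p Y) = mfderiv (𝓡 m) 𝓘(ℝ, ℝ) τ p Y
  then h.choose else 0

/-- The vector `g_* ∇τ` at `p`; its norm is the norm of `∇τ` in the metric induced by `g`. -/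
def pushGradient (g : L → Euc k) (τ : L → ℝ) (p : L) : Euc k :=
  differential m g p (inducedGradient m g τ p)

/-- The unit normal bundle `Λ` of the immersion `g` into the sphere: pairs `(p, w)` with `w` a
unit vector tangent to the sphere at `g p` and normal to `g`. -/
def UnitNormalBundle (g : L → Euc k) : Type _ :=
  {q : L × Euc k // ‖q.2‖ = 1 ∧ inner ℝ q.2 (g q.1) = 0 ∧
    ∀ Y : TangentSpace (𝓡 m) q.1, inner ℝ q.2 (differential m g q.1 Y) = 0}

/-- `Λ` has the topology of a subspace of the product of `L` and Euclidean space. -/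
instance (g : L → Euc k) : TopologicalSpace (UnitNormalBundle m g) :=
  inferInstanceAs (TopologicalSpace (Subtype _))

/-- The base point `x` of the element `(x, w)` of `Λ`. -/
def UnitNormalBundle.base {m : ℕ} {k : ℕ} {L : Type*} [TopologicalSpace L]
    [ChartedSpace (Euc m) L] {g : L → Euc k} (q : UnitNormalBundle m g) : L := q.1.1

/-- The unit normal vector `w` of the element `(x, w)` of `Λ`. -/
def UnitNormalBundle.vec {m : ℕ} {k : ℕ} {L : Type*} [TopologicalSpace L]
    [ChartedSpace (Euc m) L] {g : L → Euc k} (q : UnitNormalBundle m g) : Euc k := q.1.2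

/-- With the given charts, `Λ` is an embedded smooth `n`-dimensional submanifold of the product
of `L` and Euclidean space. (An embedded subspace has at most one such smooth structure.) -/
structure IsNormalBundleManifold (g : L → Euc k) (n : ℕ)
    [ChartedSpace (Euc n) (UnitNormalBundle m g)] : Prop where
  isManifold : IsManifold (𝓡 n) ∞ (UnitNormalBundle m g)
  contMDiff_incl : ContMDiff (𝓡 n) ((𝓡 m).prod 𝓘(ℝ, Euc k)) ∞
    (fun q : UnitNormalBundle m g => (q.base, q.vec))
  injective_mfderiv : ∀ q : UnitNormalBundle m g, Function.Injective
    (mfderiv (𝓡 n) ((𝓡 m).prod 𝓘(ℝ, Euc k))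
      (fun q : UnitNormalBundle m g => (q.base, q.vec)) q)

/-- The exponential map of the unit sphere at `p`, applied to a tangent vector `v` at `p`. -/
def sphereExp (p v : Euc k) : Euc k :=
  Real.cos ‖v‖ • p + (Real.sin ‖v‖ / ‖v‖) • v

/-- The map `Ψ(x, w) = exp_{g(x)} (-τ (g_* ∇τ + √(1 - ‖∇τ‖²) w))`. -/
def tubeMap (g : L → Euc k) (τ : L → ℝ) (q : UnitNormalBundle m g) : Euc k :=
  sphereExp (g q.base)
    (-(τ q.base) • (pushGradient m g τ q.base
      + Real.sqrt (1 - ‖pushGradient m g τ q.base‖ ^ 2) • q.vec))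

/-- The set of points at which `Ψ` is regular. -/
def regularSet (g : L → Euc k) (τ : L → ℝ) (n : ℕ)
    [ChartedSpace (Euc n) (UnitNormalBundle m g)] : Set (UnitNormalBundle m g) :=
  {q | Function.Injective (differential n (tubeMap m g τ) q)}

end NormalBundle

end SphereHyp

end

set_option linter.unusedSectionVars false

/-! Write h = cos σ f + sin σ η for the focal map and ξ = cos σ η − sin σ f. Then h_* = (cos σ f_* +
sin σ η_*) + dσ ξ, where ξ is a unit field orthogonal to the bracket, and the bracket vanishes
exactly on the principal space. The function λ is smooth by the implicit function theorem
(`contDiffOn_principalCurvature`), and for ℓ ≥ 2 the Codazzi equation makes it constant along its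
principal distribution (`fderiv_principalCurvature_eq_zero`). So ker h_* is the principal
distribution, h has constant rank n − ℓ, and both h and σ are constant on leaves. They descend to g
and τ.

Pairing the formula with ξ gives ⟨ξ, h_*X⟩ = dσ(X) (`GaussPair.focalPair`): the part of ξ tangent to
g is ∇τ. Hence ξ = g_*∇τ + √(1 − ‖∇τ‖²) w with w a unit normal of g, and f = cos σ h − sin σ ξ is Ψ
at w. This defines j (`FocalFactorization.exists_lift`). The strict bound on a = ‖∇τ‖ comes from
Pythagoras: for X with h_*X = ∇τ one has a² = |bracket|² + a⁴, so a ≥ 1 would make the bracket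
vanish, X principal and h_*X = 0 (`GaussPair.norm_vd_focal_lt_one`).

The converse runs the rotation backwards. `FocalPair.gaussPair` gives the normal field N of Ψ, and
cos τ Ψ_* + sin τ N_* = g_* − dτ ξ along the base. Since ‖∇τ‖ < 1, this vanishes exactly on vectors
tangent to the fibres of Λ, which have dimension ℓ (`TubeData.cos_smul_add_sin_smul_eq_zero_iff`).

In place of Frobenius, constant rank gives boxes whose plaques lie in fibres of h
(`LeafMap.exists_flowBox`). For compact M the leaf space is Hausdorff because a leaf is open and
closed in its level set of h (`LeafMap.t2Space_leafSpace`). The image of j is then clopen and meets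
every fibre of Λ; fibres are connected spheres, so j is onto (`eq_univ_of_isClopen_bundle`), and a
local homeomorphism of compact Hausdorff source and Hausdorff target is a covering. -/

noncomputable section

namespace SphereHyp

/-! ### Smooth families of linear maps and their kernels. -/

section Calculus

variable {X E F G : Type*} [NormedAddCommGroup X] [NormedSpace ℝ X]
  [NormedAddCommGroup E] [NormedSpace ℝ E] [FiniteDimensional ℝ E]
  [NormedAddCommGroup F] [NormedSpace ℝ F] [FiniteDimensional ℝ F]
  [NormedAddCommGroup G] [NormedSpace ℝ G] [FiniteDimensional ℝ G]

/-- An injective linear map between spaces of the same finite dimension is invertible. -/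
theorem exists_equiv_of_injective (T : E →L[ℝ] F) (hT : Function.Injective T)
    (hd : Module.finrank ℝ E = Module.finrank ℝ F) : ∃ e : E ≃L[ℝ] F, (e : E →L[ℝ] F) = T := by
  refine ⟨(LinearEquiv.ofInjectiveOfFinrankEq (T : E →ₗ[ℝ] F) hT hd).toContinuousLinearEquiv, ?_⟩
  ext v
  rfl

/-- The set where a continuous family of linear maps is invertible is open. -/
theorem isOpen_inter_invertible {Y : Type*} [TopologicalSpace Y] {S : Y → E →L[ℝ] F} {U : Set Y}
    (hU : IsOpen U) (hS : ContinuousOn S U) :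
    IsOpen {x ∈ U | ∃ e : E ≃L[ℝ] F, (e : E →L[ℝ] F) = S x} :=
  hS.isOpen_inter_preimage hU ContinuousLinearEquiv.isOpen

/-- The set where a continuous family of linear maps is injective is open. -/
theorem isOpen_inter_injective {Y : Type*} [TopologicalSpace Y] {S : Y → E →L[ℝ] F} {U : Set Y}
    (hU : IsOpen U) (hS : ContinuousOn S U) : IsOpen {x ∈ U | Function.Injective (S x)} := by
  rw [isOpen_iff_mem_nhds]
  rintro x ⟨hxU, hx⟩
  -- Composing with a fixed left inverse of `S x` replaces injectivity by invertibility of an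
  -- endomorphism, which is an open condition.
  obtain ⟨p, hp⟩ := LinearMap.exists_leftInverse_of_injective (S x : E →ₗ[ℝ] F)
    (LinearMap.ker_eq_bot.2 hx)
  have hc : ContinuousOn (fun y => (LinearMap.toContinuousLinearMap p) ∘L S y) U :=
    continuousOn_const.clm_comp hS
  have hmem : x ∈ {y ∈ U | ∃ e : E ≃L[ℝ] E,
      (e : E →L[ℝ] E) = (LinearMap.toContinuousLinearMap p) ∘L S y} := by
    refine ⟨hxU, ContinuousLinearEquiv.refl ℝ E, ?_⟩
    ext v
    exact (LinearMap.congr_fun hp v).symm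
  filter_upwards [(isOpen_inter_invertible hU hc).mem_nhds hmem] with y hy
  obtain ⟨hyU, e, he⟩ := hy
  refine ⟨hyU, fun a b hab => e.injective ?_⟩
  have h1 : ∀ v, e v = p (S y v) := fun v => DFunLike.congr_fun he v
  rw [h1, h1, hab]

theorem contDiffOn_inverse {S : X → E →L[ℝ] F} {U : Set X} (hS : ContDiffOn ℝ ∞ S U)
    (hinv : ∀ x ∈ U, ∃ e : E ≃L[ℝ] F, (e : E →L[ℝ] F) = S x) :
    ContDiffOn ℝ ∞ (fun x => (S x).inverse) U := by
  intro x hx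
  obtain ⟨e, he⟩ := hinv x hx
  have h1 : ContDiffAt ℝ ∞ ContinuousLinearMap.inverse (S x) := by
    rw [← he]; exact contDiffAt_map_inverse e
  exact h1.comp_contDiffWithinAt x (hS x hx)

theorem apply_inverse_apply {S : E →L[ℝ] F} (h : ∃ e : E ≃L[ℝ] F, (e : E →L[ℝ] F) = S) (v : F) :
    S (S.inverse v) = v := by
  obtain ⟨e, rfl⟩ := h
  simp

theorem inverse_apply_apply {S : E →L[ℝ] F} (h : ∃ e : E ≃L[ℝ] F, (e : E →L[ℝ] F) = S) (v : E) :
    S.inverse (S v) = v := by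
  obtain ⟨e, rfl⟩ := h
  simp

/-- A vector in the kernel of a member of a smooth family of linear maps extends to a smooth
field, which lies in the kernel as long as the dimension of the kernel stays the same. -/
theorem exists_kernel_extension {T : X → E →L[ℝ] F} {U : Set X} (hU : IsOpen U)
    (hT : ContDiffOn ℝ ∞ T U) {x₀ : X} (hx₀ : x₀ ∈ U) {u : E} (hu : T x₀ u = 0) :
    ∃ (W : Set X) (Y : X → E), IsOpen W ∧ x₀ ∈ W ∧ W ⊆ U ∧ ContDiffOn ℝ ∞ Y W ∧ Y x₀ = u ∧
      ∀ x ∈ W, Module.finrank ℝ (T x).ker = Module.finrank ℝ (T x₀).ker →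
        T x (Y x) = 0 := by
  set K := (T x₀).ker with hK
  set R := (T x₀).range with hR
  obtain ⟨q, hq⟩ := LinearMap.exists_leftInverse_of_injective R.subtype R.ker_subtype
  obtain ⟨p, hp⟩ := LinearMap.exists_leftInverse_of_injective K.subtype K.ker_subtype
  have hq' : ∀ r : R, q r = r := fun r => LinearMap.congr_fun hq r
  have hp' : ∀ r : K, p r = r := fun r => LinearMap.congr_fun hp r
  let Q := LinearMap.toContinuousLinearMap q
  let P := LinearMap.toContinuousLinearMap p
  -- Bordered system: project `T x` to the range at `x₀` and adjoin a projection to the kernel at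
  -- `x₀`. It is invertible at `x₀`, hence nearby, and the extension of `u` is the solution of `S x
  -- Y = (0, u)`.
  let S : X → E →L[ℝ] R × K := fun x => (Q ∘L T x).prod P
  have hS : ContDiffOn ℝ ∞ S U := by
    rw [contDiffOn_clm_apply]
    intro y
    exact (Q.contDiff.comp_contDiffOn (hT.clm_apply contDiffOn_const)).prodMk contDiffOn_const
  have hdim : Module.finrank ℝ E = Module.finrank ℝ (R × K) := by
    rw [Module.finrank_prod]
    exact ((T x₀ : E →ₗ[ℝ] F).finrank_range_add_finrank_ker).symm
  have hS0 : ∃ e : E ≃L[ℝ] R × K, (e : E →L[ℝ] R × K) = S x₀ := by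
    refine exists_equiv_of_injective _ ?_ hdim
    rw [injective_iff_map_eq_zero]
    intro v hv
    have h1 : q (T x₀ v) = 0 := congrArg Prod.fst hv
    have h2 : p v = 0 := congrArg Prod.snd hv
    have h3 : T x₀ v = 0 := by
      have := hq' ⟨T x₀ v, LinearMap.mem_range_self _ v⟩
      rw [h1] at this
      exact (congrArg Subtype.val this).symm
    have := hp' ⟨v, h3⟩
    rw [h2] at this
    exact (congrArg Subtype.val this).symm
  refine ⟨{x ∈ U | ∃ e : E ≃L[ℝ] R × K, (e : E →L[ℝ] R × K) = S x},
    fun x => (S x).inverse (0, ⟨u, hu⟩),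
    isOpen_inter_invertible hU hS.continuousOn, ⟨hx₀, hS0⟩, fun x hx => hx.1, ?_, ?_, ?_⟩
  · exact (contDiffOn_inverse (hS.mono fun x hx => hx.1) fun x hx => hx.2).clm_apply
      contDiffOn_const
  · have : S x₀ u = (0, ⟨u, hu⟩) := by
      refine Prod.ext ?_ (hp' ⟨u, hu⟩)
      show q (T x₀ u) = 0
      rw [hu, map_zero]
    rw [← this]
    exact inverse_apply_apply hS0 u
  · rintro x ⟨hxU, hxS⟩ hfin
    have hle : (T x).ker ≤ (Q ∘L T x).ker := by
      intro v hv
      have hv' : T x v = 0 := hv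
      show Q (T x v) = 0
      rw [hv', map_zero]
    -- The solution is killed only by `Q ∘ T x`. As `S x` is injective, `p` embeds `ker (Q ∘ T x)`
    -- in `K`; when `ker (T x)` also has the dimension of `K`, the two kernels coincide.
    have hker : Module.finrank ℝ (Q ∘L T x).ker ≤ Module.finrank ℝ K := by
      refine LinearMap.finrank_le_finrank_of_injective
        (f := p ∘ₗ (Q ∘L T x).ker.subtype) ?_
      rw [injective_iff_map_eq_zero]
      rintro ⟨v, hv⟩ hpv
      obtain ⟨e, he⟩ := hxS
      have : e v = 0 := by
        have h1 : e v = S x v := DFunLike.congr_fun he v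
        rw [h1]
        exact Prod.ext hv hpv
      have hv0 : v = 0 := by simpa using this
      exact Subtype.ext hv0
    have heq := Submodule.eq_of_le_of_finrank_le hle (hfin ▸ hker)
    have hY : (S x).inverse (0, ⟨u, hu⟩) ∈ (Q ∘L T x).ker :=
      congrArg Prod.fst (apply_inverse_apply hxS ((0, ⟨u, hu⟩) : R × K))
    rw [← heq] at hY
    exact hY

end Calculus

/-! ### Symmetry, smoothness and the Codazzi equation for a principal curvature in a chart. -/

section Codazzi

variable {E F : Type*} [NormedAddCommGroup E] [NormedSpace ℝ E] [FiniteDimensional ℝ E]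
  [NormedAddCommGroup F] [InnerProductSpace ℝ F] [FiniteDimensional ℝ F]
  {f η : E → F} {lam : E → ℝ} {U : Set E}

theorem fderiv_fderiv_symm (hU : IsOpen U) (hf : ContDiffOn ℝ ∞ f U) {x : E} (hx : x ∈ U)
    (X Y : E) : fderiv ℝ (fderiv ℝ f) x X Y = fderiv ℝ (fderiv ℝ f) x Y X := by
  have h : ContDiffAt ℝ ∞ f x := hf.contDiffAt (hU.mem_nhds hx)
  exact (h.isSymmSndFDerivAt (by
    rw [minSmoothness_of_isRCLikeNormedField]
    exact WithTop.coe_le_coe.2 (le_top (a := (2 : ℕ∞))))).eq X Y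

theorem differentiableAt_fderiv (hU : IsOpen U) (hf : ContDiffOn ℝ ∞ f U) {x : E} (hx : x ∈ U) :
    DifferentiableAt ℝ (fderiv ℝ f) x := by
  have h : ContDiffOn ℝ ∞ (fderiv ℝ f) U := hf.fderiv_of_isOpen hU (by simp)
  exact (h.differentiableOn (by simp)).differentiableAt (hU.mem_nhds hx)

theorem differentiableAt_of_contDiffOn {G : Type*} [NormedAddCommGroup G] [NormedSpace ℝ G]
    {f : E → G} (hU : IsOpen U) (hf : ContDiffOn ℝ ∞ f U) {x : E} (hx : x ∈ U) :
    DifferentiableAt ℝ f x :=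
  (hf.differentiableOn (by simp)).differentiableAt (hU.mem_nhds hx)

/-- The second fundamental form is symmetric. -/
theorem inner_fderiv_symm (hU : IsOpen U) (hf : ContDiffOn ℝ ∞ f U) (hη : ContDiffOn ℝ ∞ η U)
    (horth : ∀ x ∈ U, ∀ X, inner ℝ (η x) (fderiv ℝ f x X) = 0) {x : E} (hx : x ∈ U) (X Y : E) :
    inner ℝ (fderiv ℝ η x X) (fderiv ℝ f x Y) = inner ℝ (fderiv ℝ η x Y) (fderiv ℝ f x X) := by
  -- Differentiate ⟨η, f_* Y⟩ = 0 in the direction `X`; the Hessian of `f` is symmetric.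
  have key : ∀ X Y : E, inner ℝ (fderiv ℝ η x X) (fderiv ℝ f x Y) =
      - inner ℝ (η x) (fderiv ℝ (fderiv ℝ f) x X Y) := by
    intro X Y
    have h1 : HasFDerivAt (fun z => fderiv ℝ f z Y) ((fderiv ℝ (fderiv ℝ f) x).flip Y) x := by
      simpa using (differentiableAt_fderiv hU hf hx).hasFDerivAt.clm_apply (hasFDerivAt_const Y x)
    have h2 := ((differentiableAt_of_contDiffOn hU hη hx).hasFDerivAt.inner ℝ h1)
    have h3 : (fun z => inner ℝ (η z) (fderiv ℝ f z Y)) =ᶠ[𝓝 x] fun _ => (0 : ℝ) := by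
      filter_upwards [hU.mem_nhds hx] with z hz using horth z hz Y
    have h4 := (h2.congr_of_eventuallyEq h3.symm).unique (hasFDerivAt_const (0 : ℝ) x)
    have h5 := DFunLike.congr_fun h4 X
    simp [fderivInnerCLM_apply] at h5
    linarith
  rw [key, key, fderiv_fderiv_symm hU hf hx]

variable (hU : IsOpen U) (hf : ContDiffOn ℝ ∞ f U) (hη : ContDiffOn ℝ ∞ η U)
  (hinj : ∀ x ∈ U, Function.Injective (fderiv ℝ f x))
  (horth : ∀ x ∈ U, ∀ X, inner ℝ (η x) (fderiv ℝ f x X) = 0) {l : ℕ}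
  (hfin : ∀ x ∈ U, Module.finrank ℝ (fderiv ℝ η x + lam x • fderiv ℝ f x).ker = l)

-- The form ⟨(η_* + λ f_*) v, f_* Z⟩ is symmetric in `v` and `Z`, so it vanishes once `Z` lies in
-- the kernel. This is what removes the unknown derivatives of extended kernel fields below.
include hU hf hη horth in
theorem inner_principal_eq_zero {x : E} (hx : x ∈ U) {Z : E}
    (hZ : fderiv ℝ η x Z + lam x • fderiv ℝ f x Z = 0) (v : E) :
    inner ℝ (fderiv ℝ η x v + lam x • fderiv ℝ f x v) (fderiv ℝ f x Z) = 0 := by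
  rw [inner_add_left, inner_smul_left, inner_fderiv_symm hU hf hη horth hx v Z,
    eq_neg_of_add_eq_zero_left hZ, inner_neg_left, inner_smul_left, real_inner_comm]
  simp

include hU hf hη hinj horth hfin in
/-- A continuous principal curvature of constant multiplicity is smooth. -/
theorem contDiffOn_principalCurvature (hlam : ContinuousOn lam U) (hl : 1 ≤ l) :
    ContDiffOn ℝ ∞ lam U := by
  intro x₀ hx₀
  refine ContDiffAt.contDiffWithinAt ?_
  obtain ⟨⟨u, hu⟩, hu0⟩ : ∃ u : (fderiv ℝ η x₀ + lam x₀ • fderiv ℝ f x₀).ker, u ≠ 0 := by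
    have : Nontrivial (fderiv ℝ η x₀ + lam x₀ • fderiv ℝ f x₀).ker :=
      Module.finrank_pos_iff (R := ℝ).1 (by rw [hfin x₀ hx₀]; omega)
    exact exists_ne 0
  have hu1 : u ≠ 0 := fun h => hu0 (Subtype.ext h)
  have hu2 : fderiv ℝ η x₀ u + lam x₀ • fderiv ℝ f x₀ u = 0 := hu
  -- The eigenvalue becomes an independent variable, so that a smooth family is available before
  -- `lam` is known to be smooth.
  let T : E × ℝ → E →L[ℝ] F := fun p => fderiv ℝ η p.1 + p.2 • fderiv ℝ f p.1
  have hO : IsOpen (U ×ˢ (univ : Set ℝ)) := hU.prod isOpen_univ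
  have hT : ContDiffOn ℝ ∞ T (U ×ˢ univ) := by
    have h1 : ContDiffOn ℝ ∞ (fun p : E × ℝ => fderiv ℝ η p.1) (U ×ˢ univ) :=
      (hη.fderiv_of_isOpen hU (by simp)).comp contDiffOn_fst fun p hp => hp.1
    have h2 : ContDiffOn ℝ ∞ (fun p : E × ℝ => fderiv ℝ f p.1) (U ×ˢ univ) :=
      (hf.fderiv_of_isOpen hU (by simp)).comp contDiffOn_fst fun p hp => hp.1
    exact h1.add (contDiffOn_snd.smul h2)
  obtain ⟨W, Y, hW, hxW, hWU, hY, hY0, hTY⟩ := exists_kernel_extension hO hT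
    (x₀ := (x₀, lam x₀)) ⟨hx₀, mem_univ _⟩ hu2
  let Φ : E × ℝ → ℝ := fun p => inner ℝ (T p (Y p)) (fderiv ℝ f x₀ u)
  have hΦ : ContDiffOn ℝ ∞ Φ W := ((hT.mono hWU).clm_apply hY).inner ℝ contDiffOn_const
  have hΦa : ContDiffAt ℝ ∞ Φ (x₀, lam x₀) := hΦ.contDiffAt (hW.mem_nhds hxW)
  -- In the eigenvalue direction the product rule gives ⟨f_* Y + T Y', f_* u⟩. The term with Y'
  -- vanishes by `inner_principal_eq_zero`, leaving |f_* u|² ≠ 0.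
  have hd : fderiv ℝ Φ (x₀, lam x₀) (0, 1) = inner ℝ (fderiv ℝ f x₀ u) (fderiv ℝ f x₀ u) := by
    have hYd : DifferentiableAt ℝ (fun t : ℝ => Y (x₀, t)) (lam x₀) := by
      have h1 : DifferentiableAt ℝ Y (x₀, lam x₀) := differentiableAt_of_contDiffOn hW hY hxW
      exact h1.comp (lam x₀) ((differentiableAt_const x₀).prodMk differentiableAt_id)
    have h2 : HasDerivAt (fun t : ℝ => T (x₀, t)) (fderiv ℝ f x₀) (lam x₀) := by
      have h := ((hasDerivAt_id (lam x₀)).smul_const (fderiv ℝ f x₀)).const_add (fderiv ℝ η x₀)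
      rw [one_smul] at h
      exact h
    have h3 := (h2.clm_apply hYd.hasDerivAt).inner ℝ
      (hasDerivAt_const (lam x₀) (fderiv ℝ f x₀ u))
    have h4 : HasDerivAt (fun t : ℝ => Φ (x₀, t)) (fderiv ℝ Φ (x₀, lam x₀) (0, 1)) (lam x₀) :=
      (hΦa.differentiableAt (by simp)).hasFDerivAt.comp_hasDerivAt (lam x₀)
        ((hasDerivAt_const (lam x₀) x₀).prodMk (hasDerivAt_id (lam x₀)))
    rw [h4.unique h3, hY0, inner_add_left]
    have h5 := inner_principal_eq_zero hU hf hη horth hx₀ hu2 (deriv (fun t : ℝ => Y (x₀, t)) (lam x₀))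
    have h6 : inner ℝ (T (x₀, lam x₀) (deriv (fun t : ℝ => Y (x₀, t)) (lam x₀)))
      (fderiv ℝ f x₀ u) = 0 := h5
    rw [h6]
    simp
  have hd0 : fderiv ℝ Φ (x₀, lam x₀) (0, 1) ≠ 0 := by
    rw [hd, Ne, inner_self_eq_zero]
    intro h
    exact hu1 (hinj x₀ hx₀ (h.trans (map_zero _).symm))
  have hinv : (fderiv ℝ Φ (x₀, lam x₀) ∘L ContinuousLinearMap.inr ℝ E ℝ).IsInvertible := by
    obtain ⟨e, he⟩ := exists_equiv_of_injective
      (fderiv ℝ Φ (x₀, lam x₀) ∘L ContinuousLinearMap.inr ℝ E ℝ) (by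
        rw [injective_iff_map_eq_zero]
        intro t ht
        have h1 : (fderiv ℝ Φ (x₀, lam x₀) ∘L ContinuousLinearMap.inr ℝ E ℝ) t =
            t * fderiv ℝ Φ (x₀, lam x₀) (0, 1) := by
          have : ((0 : E), t) = t • ((0 : E), (1 : ℝ)) := by simp
          simp only [ContinuousLinearMap.comp_apply, ContinuousLinearMap.inr_apply]
          rw [this, map_smul, smul_eq_mul]
        rw [h1] at ht
        exact (mul_eq_zero.1 ht).resolve_right hd0) rfl
    exact ⟨e, he⟩
  -- On the graph of `lam` the kernel dimension is constant, so the extension stays in the kernel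
  -- and the graph lies in the zero set of `Φ`.
  have hzero : ∀ x ∈ U, (x, lam x) ∈ W → Φ (x, lam x) = 0 := by
    intro x hx hxW'
    have h1 : T (x, lam x) (Y (x, lam x)) = 0 :=
      hTY _ hxW' ((hfin x hx).trans (hfin x₀ hx₀).symm)
    show inner ℝ (T (x, lam x) (Y (x, lam x))) (fderiv ℝ f x₀ u) = 0
    rw [h1, inner_zero_left]
  have hcont : ContinuousAt (fun x => (x, lam x)) x₀ :=
    continuousAt_id.prodMk (hlam.continuousAt (hU.mem_nhds hx₀))
  -- Continuity keeps the graph in the region where solutions of `Φ = 0` are unique; there `lam` is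
  -- the implicit function.
  have hev : ∀ᶠ x in 𝓝 x₀, hΦa.implicitFunction (by simp) hinv x = lam x := by
    filter_upwards [hcont.eventually
        (hΦa.eventually_apply_eq_iff_implicitFunction (by simp) hinv),
      hcont.eventually (hW.mem_nhds hxW), hU.mem_nhds hx₀] with x h1 h2 h3
    exact h1.1 ((hzero x h3 h2).trans (hzero x₀ hx₀ hxW).symm)
  have hs : ContDiffAt ℝ ∞ (hΦa.implicitFunction (by simp) hinv) x₀ :=
    hΦa.contDiffAt_implicitFunction (by simp) hinv
  exact hs.congr_of_eventuallyEq (hev.mono fun x hx => hx.symm)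

include hU hf hη hinj horth hfin in
/-- A smooth principal curvature of constant multiplicity at least two is constant along its
principal distribution. -/
theorem fderiv_principalCurvature_eq_zero (hlam : ContDiffOn ℝ ∞ lam U) (hl : 2 ≤ l) {x : E}
    (hx : x ∈ U) {X : E} (hX : fderiv ℝ η x X + lam x • fderiv ℝ f x X = 0) :
    fderiv ℝ lam x X = 0 := by
  by_cases hX0 : X = 0
  · rw [hX0, map_zero]
  -- Differentiate (η_* + λ f_*) V = 0 along `X`, where `V` extends `Y` inside the kernel, and pair
  -- with `f_* Z`; the term with the derivative of `V` drops out.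
  have key : ∀ X Y Z : E, fderiv ℝ η x Y + lam x • fderiv ℝ f x Y = 0 →
      fderiv ℝ η x Z + lam x • fderiv ℝ f x Z = 0 →
      inner ℝ (fderiv ℝ (fderiv ℝ η) x X Y + lam x • fderiv ℝ (fderiv ℝ f) x X Y)
        (fderiv ℝ f x Z) + fderiv ℝ lam x X * inner ℝ (fderiv ℝ f x Y) (fderiv ℝ f x Z) = 0 := by
    intro X Y Z hY hZ
    have hT : ContDiffOn ℝ ∞ (fun x => fderiv ℝ η x + lam x • fderiv ℝ f x) U :=
      (hη.fderiv_of_isOpen hU (by simp)).add (hlam.smul (hf.fderiv_of_isOpen hU (by simp)))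
    obtain ⟨W, V, hW, hxW, hWU, hV, hV0, hTV⟩ := exists_kernel_extension hU hT hx hY
    have h1 : HasFDerivAt V (fderiv ℝ V x) x :=
      (differentiableAt_of_contDiffOn hW hV hxW).hasFDerivAt
    have h2 := ((differentiableAt_fderiv hU hη hx).hasFDerivAt.add
      ((differentiableAt_of_contDiffOn hU hlam hx).hasFDerivAt.smul
        (differentiableAt_fderiv hU hf hx).hasFDerivAt)).clm_apply h1
    have h3 : (fun z => (fderiv ℝ η z + lam z • fderiv ℝ f z) (V z)) =ᶠ[𝓝 x] fun _ => 0 := by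
      filter_upwards [hW.mem_nhds hxW] with z hz
      exact hTV z hz ((hfin z (hWU hz)).trans (hfin x hx).symm)
    have h4 := DFunLike.congr_fun
      ((h2.congr_of_eventuallyEq h3.symm).unique (hasFDerivAt_const (0 : F) x)) X
    have h5 := inner_principal_eq_zero hU hf hη horth hx hZ (fderiv ℝ V x X)
    simp [hV0] at h4
    have h6 := congrArg (fun v => inner ℝ v (fderiv ℝ f x Z)) h4
    simp only [inner_zero_left, inner_add_left, inner_smul_left] at h6 h5 ⊢
    simp at h6 h5 ⊢
    linarith
  -- Antisymmetrizing in `X` and `Y` cancels all second derivatives.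
  have key2 : ∀ Y Z : E, fderiv ℝ η x Y + lam x • fderiv ℝ f x Y = 0 →
      fderiv ℝ η x Z + lam x • fderiv ℝ f x Z = 0 →
      inner ℝ (fderiv ℝ f x (fderiv ℝ lam x X • Y - fderiv ℝ lam x Y • X)) (fderiv ℝ f x Z) = 0 := by
    intro Y Z hY hZ
    have h1 := key X Y Z hY hZ
    have h2 := key Y X Z hX hZ
    rw [fderiv_fderiv_symm hU hf hx Y X, fderiv_fderiv_symm hU hη hx Y X] at h2
    simp only [map_sub, map_smul, inner_sub_left, inner_smul_left]
    simp
    linarith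
  -- Multiplicity at least two supplies a kernel vector independent of `X`. The combination dλ(X) Y
  -- − dλ(Y) X is itself in the kernel, so it may be taken as `Z`; it is then zero, and independence
  -- gives dλ(X) = 0.
  obtain ⟨Y, hY, hYX⟩ : ∃ Y : E, fderiv ℝ η x Y + lam x • fderiv ℝ f x Y = 0 ∧
      Y ∉ Submodule.span ℝ {X} := by
    by_contra! hcon
    have hle : (fderiv ℝ η x + lam x • fderiv ℝ f x).ker ≤ Submodule.span ℝ {X} :=
      fun Y hY => hcon Y hY
    have := Submodule.finrank_mono hle
    rw [hfin x hx, finrank_span_singleton hX0] at this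
    omega
  have hZ : fderiv ℝ η x (fderiv ℝ lam x X • Y - fderiv ℝ lam x Y • X) +
      lam x • fderiv ℝ f x (fderiv ℝ lam x X • Y - fderiv ℝ lam x Y • X) = 0 := by
    have : fderiv ℝ η x (fderiv ℝ lam x X • Y - fderiv ℝ lam x Y • X) +
      lam x • fderiv ℝ f x (fderiv ℝ lam x X • Y - fderiv ℝ lam x Y • X) =
      fderiv ℝ lam x X • (fderiv ℝ η x Y + lam x • fderiv ℝ f x Y) -
      fderiv ℝ lam x Y • (fderiv ℝ η x X + lam x • fderiv ℝ f x X) := by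
      simp only [map_sub, map_smul]
      module
    rw [this, hX, hY]
    simp
  have h0 : fderiv ℝ lam x X • Y - fderiv ℝ lam x Y • X = 0 :=
    hinj x hx ((inner_self_eq_zero.1 (key2 Y _ hY hZ)).trans (map_zero _).symm)
  by_contra hne
  refine hYX (Submodule.mem_span_singleton.2 ⟨(fderiv ℝ lam x X)⁻¹ * fderiv ℝ lam x Y, ?_⟩)
  rw [mul_smul, ← sub_eq_zero.1 h0, smul_smul, inv_mul_cancel₀ hne, one_smul]

end Codazzi

/-! ### Differentials of vector-valued maps on manifolds, and submersion boxes. -/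

section VectorValued

variable (E : Type*) [NormedAddCommGroup E] [NormedSpace ℝ E]
  {N : Type*} [TopologicalSpace N] [ChartedSpace E N]
  {F : Type*} [NormedAddCommGroup F] [NormedSpace ℝ F]

/-- The differential of a vector-valued map, as a linear map on the model space. -/
def vd (f : N → F) (x : N) : E →L[ℝ] F := mfderiv 𝓘(ℝ, E) 𝓘(ℝ, F) f x

variable {E}

/-- The manifold derivative at `x` is read in the preferred chart at `x`, so with a vector space as
target it is an ordinary derivative there. All the calculus rules below are transported through this
fact. -/
theorem hasFDerivAt_vd {f : N → F} {x : N} (hf : MDifferentiableAt 𝓘(ℝ, E) 𝓘(ℝ, F) f x) :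
    HasFDerivAt (f ∘ (chartAt E x).symm) (vd E f x) (chartAt E x x) := by
  have h : HasFDerivWithinAt (f ∘ (chartAt E x).symm) (vd E f x) (range id) (chartAt E x x) :=
    hf.hasMFDerivAt.2
  rwa [range_id, hasFDerivWithinAt_univ] at h

theorem vd_eq_of_hasFDerivAt {f : N → F} {x : N} {f' : E →L[ℝ] F} (hf : ContinuousAt f x)
    (h : HasFDerivAt (f ∘ (chartAt E x).symm) f' (chartAt E x x)) : vd E f x = f' := by
  have : HasMFDerivAt 𝓘(ℝ, E) 𝓘(ℝ, F) f x f' := by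
    exact ⟨hf, h.hasFDerivWithinAt⟩
  exact this.mfderiv

theorem mdifferentiableAt_of_contMDiffAt {N' : Type*} {E' : Type*} [NormedAddCommGroup E']
    [NormedSpace ℝ E'] [TopologicalSpace N'] [ChartedSpace E' N'] {f : N → N'} {x : N}
    (hf : ContMDiffAt 𝓘(ℝ, E) 𝓘(ℝ, E') ∞ f x) : MDifferentiableAt 𝓘(ℝ, E) 𝓘(ℝ, E') f x :=
  hf.mdifferentiableAt (by simp)

theorem vd_const (c : F) (x : N) : vd E (fun _ : N => c) x = 0 := by
  exact mfderiv_const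

theorem vd_eq_fderiv (f : E → F) (x : E) : vd E f x = fderiv ℝ f x := mfderiv_eq_fderiv

theorem vd_add {f g : N → F} {x : N} (hf : MDifferentiableAt 𝓘(ℝ, E) 𝓘(ℝ, F) f x)
    (hg : MDifferentiableAt 𝓘(ℝ, E) 𝓘(ℝ, F) g x) (X : E) :
    vd E (fun y => f y + g y) x X = vd E f x X + vd E g x X := by
  rw [vd_eq_of_hasFDerivAt (f := fun y => f y + g y) (hf.continuousAt.add hg.continuousAt)
    ((hasFDerivAt_vd hf).add (hasFDerivAt_vd hg))]
  rfl

theorem vd_sub {f g : N → F} {x : N} (hf : MDifferentiableAt 𝓘(ℝ, E) 𝓘(ℝ, F) f x)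
    (hg : MDifferentiableAt 𝓘(ℝ, E) 𝓘(ℝ, F) g x) (X : E) :
    vd E (fun y => f y - g y) x X = vd E f x X - vd E g x X := by
  rw [vd_eq_of_hasFDerivAt (f := fun y => f y - g y) (hf.continuousAt.sub hg.continuousAt)
    ((hasFDerivAt_vd hf).sub (hasFDerivAt_vd hg))]
  rfl

theorem vd_smul {c : N → ℝ} {f : N → F} {x : N} (hc : MDifferentiableAt 𝓘(ℝ, E) 𝓘(ℝ, ℝ) c x)
    (hf : MDifferentiableAt 𝓘(ℝ, E) 𝓘(ℝ, F) f x) (X : E) :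
    vd E (fun y => c y • f y) x X = c x • vd E f x X + vd E c x X • f x := by
  rw [vd_eq_of_hasFDerivAt (f := fun y => c y • f y) (hc.continuousAt.smul hf.continuousAt)
    ((hasFDerivAt_vd hc).smul (hasFDerivAt_vd hf))]
  simp

theorem vd_inner {F : Type*} [NormedAddCommGroup F] [InnerProductSpace ℝ F] {f g : N → F} {x : N}
    (hf : MDifferentiableAt 𝓘(ℝ, E) 𝓘(ℝ, F) f x)
    (hg : MDifferentiableAt 𝓘(ℝ, E) 𝓘(ℝ, F) g x) (X : E) :
    vd E (fun y => inner ℝ (f y) (g y)) x X =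
      inner ℝ (f x) (vd E g x X) + inner ℝ (vd E f x X) (g x) := by
  rw [vd_eq_of_hasFDerivAt (hf.continuousAt.inner hg.continuousAt)
    ((hasFDerivAt_vd hf).inner ℝ (hasFDerivAt_vd hg))]
  simp [fderivInnerCLM_apply]

theorem vd_comp_real {c : ℝ → ℝ} {c' : ℝ} {s : N → ℝ} {x : N} (hc : HasDerivAt c c' (s x))
    (hs : MDifferentiableAt 𝓘(ℝ, E) 𝓘(ℝ, ℝ) s x) (X : E) :
    vd E (fun y => c (s y)) x X = c' * vd E s x X := by
  have hc' : HasDerivAt c c' ((s ∘ (chartAt E x).symm) (chartAt E x x)) := by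
    simpa using hc
  rw [vd_eq_of_hasFDerivAt (f := fun y => c (s y)) (hc.continuousAt.comp hs.continuousAt)
    (hc'.comp_hasFDerivAt _ (hasFDerivAt_vd hs))]
  simp

theorem vd_clm {G : Type*} [NormedAddCommGroup G] [NormedSpace ℝ G] (P : F →L[ℝ] G) {f : N → F}
    {x : N} (hf : MDifferentiableAt 𝓘(ℝ, E) 𝓘(ℝ, F) f x) :
    vd E (fun y => P (f y)) x = P ∘L vd E f x :=
  vd_eq_of_hasFDerivAt (P.continuous.continuousAt.comp hf.continuousAt)
    (P.hasFDerivAt.comp _ (hasFDerivAt_vd hf))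

variable {N' E' : Type*} [NormedAddCommGroup E']
    [NormedSpace ℝ E'] [TopologicalSpace N'] [ChartedSpace E' N']

theorem vd_comp {f : N' → F} {π : N → N'} {x : N}
    (hf : MDifferentiableAt 𝓘(ℝ, E') 𝓘(ℝ, F) f (π x))
    (hπ : MDifferentiableAt 𝓘(ℝ, E) 𝓘(ℝ, E') π x) (X : E) :
    vd E (fun y => f (π y)) x X = vd E' f (π x) (mfderiv 𝓘(ℝ, E) 𝓘(ℝ, E') π x X) :=
  mfderiv_comp_apply x hf hπ X

/-- The derivative of the inverse of the chart at `x₀`. -/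
def chartSymmDeriv (x₀ : N) (z : E) : E →L[ℝ] E :=
  mfderiv 𝓘(ℝ, E) 𝓘(ℝ, E) (chartAt E x₀).symm z

variable [IsManifold 𝓘(ℝ, E) ∞ N]

theorem isManifold_one : IsManifold 𝓘(ℝ, E) 1 N :=
  IsManifold.of_le (n := ∞) (by exact_mod_cast le_top)

theorem mdifferentiableAt_chart_symm {x₀ : N} {z : E} (hz : z ∈ (chartAt E x₀).target) :
    MDifferentiableAt 𝓘(ℝ, E) 𝓘(ℝ, E) (chartAt E x₀).symm z :=
  have := isManifold_one (E := E) (N := N)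
  (mdifferentiable_chart x₀).mdifferentiableAt_symm hz

theorem chartSymmDeriv_bijective {x₀ : N} {z : E} (hz : z ∈ (chartAt E x₀).target) :
    Function.Bijective (chartSymmDeriv x₀ z) :=
  have := isManifold_one (E := E) (N := N)
  (mdifferentiable_chart (I := 𝓘(ℝ, E)) x₀).symm.mfderiv_bijective hz

/-- Away from the centre of the chart at `x₀` the preferred chart is a different one;
`chartSymmDeriv` is the change of frame between the two. -/
theorem fderiv_chart {f : N → F} {x₀ : N} {z : E} (hz : z ∈ (chartAt E x₀).target)
    (hf : MDifferentiableAt 𝓘(ℝ, E) 𝓘(ℝ, F) f ((chartAt E x₀).symm z)) (X : E) :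
    fderiv ℝ (f ∘ (chartAt E x₀).symm) z X =
      vd E f ((chartAt E x₀).symm z) (chartSymmDeriv x₀ z X) := by
  rw [← vd_eq_fderiv]
  exact vd_comp (f := f) (π := (chartAt E x₀).symm) hf (mdifferentiableAt_chart_symm hz) X

theorem contDiffOn_comp_chart_symm {f : N → F} {U : Set N} (hf : ContMDiffOn 𝓘(ℝ, E) 𝓘(ℝ, F) ∞ f U)
    (x₀ : N) : ContDiffOn ℝ ∞ (f ∘ (chartAt E x₀).symm)
      ((chartAt E x₀).target ∩ (chartAt E x₀).symm ⁻¹' U) := by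
  rw [← contMDiffOn_iff_contDiffOn]
  exact hf.comp (contMDiffOn_chart_symm.mono inter_subset_left) inter_subset_right

theorem contMDiffAt_of_comp_chart_symm {f : N → F} {x : N}
    (h : ContDiffAt ℝ ∞ (f ∘ (chartAt E x).symm) (chartAt E x x)) :
    ContMDiffAt 𝓘(ℝ, E) 𝓘(ℝ, F) ∞ f x := by
  have h1 : ContMDiffAt 𝓘(ℝ, E) 𝓘(ℝ, E) ∞ (chartAt E x) x :=
    contMDiffOn_chart.contMDiffAt (chart_source_mem_nhds E x)
  refine (h.contMDiffAt.comp x h1).congr_of_eventuallyEq ?_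
  filter_upwards [chart_source_mem_nhds E x] with y hy
  simp [(chartAt E x).left_inv hy]

/-- A submersion is, near any point, the first projection of a product of two balls. -/
theorem exists_submersion_box [FiniteDimensional ℝ E] {G : Type*} [NormedAddCommGroup G]
    [NormedSpace ℝ G] [FiniteDimensional ℝ G] (Z : Type*) [NormedAddCommGroup Z] [NormedSpace ℝ Z]
    [FiniteDimensional ℝ Z] (hZ : Module.finrank ℝ E = Module.finrank ℝ G + Module.finrank ℝ Z)
    {u : N → G} {U : Set N} (hU : IsOpen U) (hu : ContMDiffOn 𝓘(ℝ, E) 𝓘(ℝ, G) ∞ u U) {x₀ : N}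
    (hx₀ : x₀ ∈ U) (hs : Function.Surjective (vd E u x₀)) :
    ∃ (e : OpenPartialHomeomorph N (G × Z)) (r : ℝ), x₀ ∈ e.source ∧ e.source ⊆ U ∧
      (∀ x ∈ e.source, (e x).1 = u x) ∧ ContMDiffOn 𝓘(ℝ, E) 𝓘(ℝ, G × Z) ∞ e e.source ∧
      ContMDiffOn 𝓘(ℝ, G × Z) 𝓘(ℝ, E) ∞ e.symm e.target ∧ 0 < r ∧
      e.target = Metric.ball (u x₀) r ×ˢ Metric.ball (e x₀).2 r := by
  set φ := chartAt E x₀ with hφ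
  set V := φ.target ∩ φ.symm ⁻¹' U with hVdef
  have hV : IsOpen V := φ.isOpen_inter_preimage_symm hU
  have hxs : x₀ ∈ φ.source := mem_chart_source E x₀
  have hxφ : φ.symm (φ x₀) = x₀ := φ.left_inv hxs
  have hxV : φ x₀ ∈ V := ⟨φ.map_source hxs, by rw [mem_preimage, hxφ]; exact hx₀⟩
  have hcu : ContDiffOn ℝ ∞ (u ∘ φ.symm) V := contDiffOn_comp_chart_symm hu x₀
  have hD : fderiv ℝ (u ∘ φ.symm) (φ x₀) = vd E u x₀ :=
    (hasFDerivAt_vd (mdifferentiableAt_of_contMDiffAt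
      (hu.contMDiffAt (hU.mem_nhds hx₀)))).fderiv
  set D := vd E u x₀ with hDdef
  obtain ⟨p, hp⟩ := LinearMap.exists_leftInverse_of_injective D.ker.subtype D.ker.ker_subtype
  have hkz : Module.finrank ℝ D.ker = Module.finrank ℝ Z := by
    have h1 := (D : E →ₗ[ℝ] G).finrank_range_add_finrank_ker
    rw [LinearMap.range_eq_top.2 hs, finrank_top] at h1
    exact Nat.add_left_cancel (h1.trans hZ)
  let κ : D.ker ≃ₗ[ℝ] Z := LinearEquiv.ofFinrankEq _ _ hkz
  -- Coordinates on `ker D`, extended to `E` by a projection: they complete `u` to a local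
  -- diffeomorphism.
  let A : E →L[ℝ] Z := LinearMap.toContinuousLinearMap (κ.toLinearMap ∘ₗ p)
  let Φ : E → G × Z := fun z => (u (φ.symm z), A z)
  have hΦ : ContDiffOn ℝ ∞ Φ V := hcu.prodMk A.contDiff.contDiffOn
  have hΦd : fderiv ℝ Φ (φ x₀) = D.prod A := by
    rw [← hD]
    exact ((differentiableAt_of_contDiffOn hV hcu hxV).hasFDerivAt.prodMk A.hasFDerivAt).fderiv
  have hinv : ∃ e : E ≃L[ℝ] G × Z, (e : E →L[ℝ] G × Z) = fderiv ℝ Φ (φ x₀) := by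
    rw [hΦd]
    refine exists_equiv_of_injective _ ?_ (by rw [Module.finrank_prod]; exact hZ)
    rw [injective_iff_map_eq_zero]
    intro v hv
    have h1 : D v = 0 := congrArg Prod.fst hv
    have h2 : κ (p v) = 0 := congrArg Prod.snd hv
    have h3 : p v = 0 := by simpa using h2
    have h4 : p v = ⟨v, h1⟩ := LinearMap.congr_fun hp ⟨v, h1⟩
    rw [h3] at h4
    exact (congrArg Subtype.val h4).symm
  set W := {x ∈ V | ∃ e : E ≃L[ℝ] G × Z, (e : E →L[ℝ] G × Z) = fderiv ℝ Φ x} with hWdef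
  have hW : IsOpen W := isOpen_inter_invertible hV
    (hΦ.continuousOn_fderiv_of_isOpen hV (by exact_mod_cast le_top))
  obtain ⟨f', hf'⟩ := hinv
  have hstrict : HasStrictFDerivAt Φ (f' : E →L[ℝ] G × Z) (φ x₀) := by
    rw [hf']
    exact (hΦ.contDiffAt (hV.mem_nhds hxV)).hasStrictFDerivAt (by simp)
  -- Restricting to `W`, where the derivative is invertible, makes the inverse smooth on the whole
  -- target and not only at one point.
  let e₁ := (hstrict.toOpenPartialHomeomorph Φ).restrOpen W hW
  have he₁ : ∀ z, e₁ z = Φ z := fun z => rfl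
  have he₁W : e₁.source ⊆ W := inter_subset_right
  have he₁s : ContDiffOn ℝ ∞ e₁.symm e₁.target := by
    intro y hy
    have hyW : e₁.symm y ∈ W := he₁W (e₁.map_target hy)
    obtain ⟨hyV, e', he'⟩ := hyW
    refine (e₁.contDiffAt_symm (f₀' := e') hy ?_ ?_).contDiffWithinAt
    · rw [he']
      exact (differentiableAt_of_contDiffOn hV hΦ hyV).hasFDerivAt
    · exact hΦ.contDiffAt (hV.mem_nhds hyV)
  let e₂ := φ.trans e₁
  have hx₂ : x₀ ∈ e₂.source := by
    refine ⟨hxs, ?_⟩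
    exact ⟨hstrict.mem_toOpenPartialHomeomorph_source, hxV, f', hf'⟩
  have hsrc : ∀ x ∈ e₂.source, x ∈ φ.source ∧ x ∈ U := by
    intro x hx
    refine ⟨hx.1, ?_⟩
    have h1 : φ.symm (φ x) ∈ U := (he₁W hx.2).1.2
    rwa [φ.left_inv hx.1] at h1
  obtain ⟨r, hr, hball⟩ := Metric.isOpen_iff.1 e₂.open_target _ (e₂.map_source hx₂)
  -- A ball for the sup metric of the product is a product of balls.
  let b : Set (G × Z) := Metric.ball (e₂ x₀) r
  let e := (e₂.symm.restrOpen b Metric.isOpen_ball).symm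
  have heu : ∀ x ∈ e₂.source, (e₂ x).1 = u x := by
    intro x hx
    show u (φ.symm (φ x)) = u x
    rw [φ.left_inv hx.1]
  have hes : e.source ⊆ e₂.source := by
    intro x hx
    exact hx.1
  have het : e.target = b := by
    have : e.target = e₂.target ∩ b := rfl
    rw [this]
    exact inter_eq_right.2 hball
  refine ⟨e, r, ?_, fun x hx => (hsrc x (hes hx)).2, fun x hx => heu x (hes hx), ?_, ?_, hr, ?_⟩
  · have h1 : e₂ x₀ ∈ e.target := by rw [het]; exact Metric.mem_ball_self hr
    have h2 : e.symm (e₂ x₀) ∈ e.source := e.map_target h1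
    have h3 : e.symm (e₂ x₀) = x₀ := e₂.left_inv hx₂
    rwa [h3] at h2
  · have h1 : ContMDiffOn 𝓘(ℝ, E) 𝓘(ℝ, G × Z) ∞ (Φ ∘ φ) e.source :=
      (contMDiffOn_iff_contDiffOn.2 hΦ).comp
        ((contMDiffOn_chart (x := x₀)).mono fun x hx => (hes hx).1)
        fun x hx => (he₁W (hes hx).2).1
    exact h1
  · have h1 : ContMDiffOn 𝓘(ℝ, G × Z) 𝓘(ℝ, E) ∞ (φ.symm ∘ e₁.symm) e.target :=
      (contMDiffOn_chart_symm (x := x₀)).comp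
        ((contMDiffOn_iff_contDiffOn.2 he₁s).mono fun y hy => hy.1.1)
        fun y hy => hy.1.2
    exact h1
  · rw [het, ball_prod_same, ← heu x₀ hx₂]
    rfl

end VectorValued

/-! ### Manifold structures on subspaces of manifolds. -/

section EmbeddedCharts

variable {E : Type*} [NormedAddCommGroup E] [NormedSpace ℝ E] {X : Type*} [TopologicalSpace X]
  {EY HY : Type*} [NormedAddCommGroup EY] [NormedSpace ℝ EY] [TopologicalSpace HY]
  {I : ModelWithCorners ℝ EY HY} {Y : Type*} [TopologicalSpace Y] [ChartedSpace HY Y]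

/-- The charted space given by a choice of a chart around each point. -/
abbrev chartedSpaceOfCharts (c : X → OpenPartialHomeomorph X E) (hc : ∀ x, x ∈ (c x).source) :
    ChartedSpace E X where
  atlas := range c
  chartAt := c
  mem_chart_source := hc
  chart_mem_atlas := mem_range_self

/-- Charts of `X` which make a map `ι` of `X` into a manifold `Y` an immersion: they are
restrictions of smooth functions on `Y`, and their inverses are smooth as maps into `Y`. -/
structure SmoothChartsAlong (I : ModelWithCorners ℝ EY HY) (ι : X → Y)
    (c : X → OpenPartialHomeomorph X E) : Prop where
  mem_source : ∀ x, x ∈ (c x).source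
  contMDiffOn_symm : ∀ x, ContMDiffOn 𝓘(ℝ, E) I ∞ (ι ∘ (c x).symm) (c x).target
  exists_extension : ∀ x, ∃ F : Y → E, ∀ z ∈ (c x).source,
    ContMDiffAt I 𝓘(ℝ, E) ∞ F (ι z) ∧ c x z = F (ι z)

namespace SmoothChartsAlong

variable {ι : X → Y} {c : X → OpenPartialHomeomorph X E} (h : SmoothChartsAlong I ι c)
include h

/-- A transition map is the smooth extension of one chart composed with the smooth parametrization
`ι ∘ c⁻¹` of another. -/
theorem isManifold : letI := chartedSpaceOfCharts c h.mem_source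
    IsManifold 𝓘(ℝ, E) ∞ X := by
  let := chartedSpaceOfCharts c h.mem_source
  refine isManifold_of_contDiffOn _ _ _ ?_
  rintro _ _ ⟨x, rfl⟩ ⟨x', rfl⟩
  obtain ⟨F, hF⟩ := h.exists_extension x'
  rw [← contMDiffOn_iff_contDiffOn]
  intro y hy
  have hy' : y ∈ (c x).target ∧ (c x).symm y ∈ (c x').source := by simpa using hy
  have hopen : IsOpen ((c x).target ∩ (c x).symm ⁻¹' (c x').source) :=
    (c x).isOpen_inter_preimage_symm (c x').open_source
  have h1 : ContMDiffAt 𝓘(ℝ, E) 𝓘(ℝ, E) ∞ (F ∘ (ι ∘ (c x).symm)) y :=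
    (hF _ hy'.2).1.comp y ((h.contMDiffOn_symm x).contMDiffAt ((c x).open_target.mem_nhds hy'.1))
  refine (h1.congr_of_eventuallyEq ?_).contMDiffWithinAt
  filter_upwards [hopen.mem_nhds hy'] with z hz
  exact (hF _ hz.2).2

theorem contMDiff : letI := chartedSpaceOfCharts c h.mem_source
    ContMDiff 𝓘(ℝ, E) I ∞ ι := by
  let := chartedSpaceOfCharts c h.mem_source
  have := h.isManifold
  intro x
  have h1 : ContMDiffAt 𝓘(ℝ, E) 𝓘(ℝ, E) ∞ (c x) x :=
    contMDiffOn_chart.contMDiffAt (chart_source_mem_nhds E x)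
  have h2 : ContMDiffAt 𝓘(ℝ, E) I ∞ ((ι ∘ (c x).symm) ∘ c x) x :=
    ((h.contMDiffOn_symm x).contMDiffAt ((c x).open_target.mem_nhds
      ((c x).map_source (h.mem_source x)))).comp x h1
  refine h2.congr_of_eventuallyEq ?_
  filter_upwards [(c x).open_source.mem_nhds (h.mem_source x)] with y hy
  simp [(c x).left_inv hy]

/-- Near `x` the chart equals `F ∘ ι`, and the differential of a chart is injective. -/
theorem injective_mfderiv (x : X) : letI := chartedSpaceOfCharts c h.mem_source
    Function.Injective (mfderiv 𝓘(ℝ, E) I ι x) := by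
  let := chartedSpaceOfCharts c h.mem_source
  have := h.isManifold
  have := isManifold_one (E := E) (N := X)
  obtain ⟨F, hF⟩ := h.exists_extension x
  have h1 : mfderiv 𝓘(ℝ, E) 𝓘(ℝ, E) (F ∘ ι) x =
      mfderiv I 𝓘(ℝ, E) F (ι x) ∘L mfderiv 𝓘(ℝ, E) I ι x :=
    mfderiv_comp x ((hF x (h.mem_source x)).1.mdifferentiableAt (by simp))
      ((h.contMDiff x).mdifferentiableAt (by simp))
  have h2 : F ∘ ι =ᶠ[𝓝 x] chartAt E x := by
    filter_upwards [(c x).open_source.mem_nhds (h.mem_source x)] with y hy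
    exact (hF y hy).2.symm
  rw [h2.mfderiv_eq] at h1
  have h3 : Function.Injective (mfderiv 𝓘(ℝ, E) 𝓘(ℝ, E) (chartAt E x) x) :=
    (mdifferentiable_chart (I := 𝓘(ℝ, E)) x).mfderiv_injective (mem_chart_source E x)
  rw [h1] at h3
  exact Function.Injective.of_comp h3

/-- Smoothness into `X` can be tested in `Y` once continuity is known: near `p` the chart expression
of `u` is `F ∘ ι ∘ u`. Both the lift to the normal bundle and the projection to the leaf space
become smooth in this way. -/
theorem contMDiffAt_lift {E' H' N : Type*} [NormedAddCommGroup E'] [NormedSpace ℝ E']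
    [TopologicalSpace H'] {J : ModelWithCorners ℝ E' H'} [TopologicalSpace N] [ChartedSpace H' N]
    {u : N → X} {p : N} (hu : ContinuousAt u p) (hιu : ContMDiffAt J I ∞ (fun q => ι (u q)) p) :
    letI := chartedSpaceOfCharts c h.mem_source
    ContMDiffAt J 𝓘(ℝ, E) ∞ u p := by
  let := chartedSpaceOfCharts c h.mem_source
  have := h.isManifold
  obtain ⟨F, hF⟩ := h.exists_extension (u p)
  have h1 : ContMDiffAt J 𝓘(ℝ, E) ∞ (fun q => F (ι (u q))) p :=
    (hF _ (h.mem_source (u p))).1.comp p hιu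
  have hmem := hu.eventually ((c (u p)).open_source.mem_nhds (h.mem_source (u p)))
  have h2 : ContMDiffAt J 𝓘(ℝ, E) ∞ (fun q => c (u p) (u q)) p := by
    refine h1.congr_of_eventuallyEq ?_
    filter_upwards [hmem] with q hq using (hF _ hq).2
  have h3 : ContMDiffAt 𝓘(ℝ, E) 𝓘(ℝ, E) ∞ (c (u p)).symm (c (u p) (u p)) :=
    (contMDiffOn_chart_symm (x := u p)).contMDiffAt
      ((c (u p)).open_target.mem_nhds ((c (u p)).map_source (h.mem_source (u p))))
  refine (h3.comp p h2).congr_of_eventuallyEq ?_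
  filter_upwards [hmem] with q hq
  exact ((c (u p)).left_inv hq).symm

end SmoothChartsAlong

end EmbeddedCharts

/-! ### Spherical maps with a unit normal field, and their rotations. -/

section GaussPairs

variable {E F : Type*} [NormedAddCommGroup E] [NormedSpace ℝ E] [FiniteDimensional ℝ E]
  [NormedAddCommGroup F] [InnerProductSpace ℝ F] [FiniteDimensional ℝ F]
  {N : Type*} [TopologicalSpace N] [ChartedSpace E N]

/-- A smooth map into the unit sphere together with a smooth unit normal field. -/
structure GaussPair (E : Type*) [NormedAddCommGroup E] [NormedSpace ℝ E] {N : Type*}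
    [TopologicalSpace N] [ChartedSpace E N] (f η : N → F) : Prop where
  contMDiff_left : ContMDiff 𝓘(ℝ, E) 𝓘(ℝ, F) ∞ f
  contMDiff_right : ContMDiff 𝓘(ℝ, E) 𝓘(ℝ, F) ∞ η
  inner_left_left : ∀ x, inner ℝ (f x) (f x) = 1
  inner_right_right : ∀ x, inner ℝ (η x) (η x) = 1
  inner_right_left : ∀ x, inner ℝ (η x) (f x) = 0
  inner_right_vd : ∀ x X, inner ℝ (η x) (vd E f x X) = 0

/-- Two smooth fields with constant inner product. -/
theorem inner_vd_add_of_inner_const {a b : N → F} {t : ℝ}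
    (ha : ContMDiff 𝓘(ℝ, E) 𝓘(ℝ, F) ∞ a) (hb : ContMDiff 𝓘(ℝ, E) 𝓘(ℝ, F) ∞ b)
    (hab : ∀ x, inner ℝ (a x) (b x) = t) (x : N) (X : E) :
    inner ℝ (a x) (vd E b x X) + inner ℝ (vd E a x X) (b x) = 0 := by
  rw [← vd_inner (mdifferentiableAt_of_contMDiffAt (ha x)) (mdifferentiableAt_of_contMDiffAt (hb x)),
    funext hab, vd_const]
  rfl

theorem inner_vd_self {a : N → F} {t : ℝ} (ha : ContMDiff 𝓘(ℝ, E) 𝓘(ℝ, F) ∞ a)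
    (haa : ∀ x, inner ℝ (a x) (a x) = t) (x : N) (X : E) : inner ℝ (a x) (vd E a x X) = 0 := by
  have h := inner_vd_add_of_inner_const ha ha haa x X
  rw [real_inner_comm (a x) (vd E a x X)] at h
  linarith

namespace GaussPair

variable {f η : N → F} (h : GaussPair E f η)
include h

theorem inner_left_vd_left (x : N) (X : E) : inner ℝ (f x) (vd E f x X) = 0 :=
  inner_vd_self h.contMDiff_left h.inner_left_left x X

theorem inner_right_vd_right (x : N) (X : E) : inner ℝ (η x) (vd E η x X) = 0 :=
  inner_vd_self h.contMDiff_right h.inner_right_right x X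

theorem inner_left_vd_right (x : N) (X : E) : inner ℝ (f x) (vd E η x X) = 0 := by
  have := inner_vd_add_of_inner_const h.contMDiff_right h.contMDiff_left h.inner_right_left x X
  rw [h.inner_right_vd, zero_add] at this
  rw [real_inner_comm, this]

theorem inner_left_right (x : N) : inner ℝ (f x) (η x) = 0 := by
  rw [real_inner_comm, h.inner_right_left]

/-- The derivative of the Gauss map of a hypersurface takes tangent values. -/
theorem exists_vd_eq (hd : Module.finrank ℝ F = Module.finrank ℝ E + 2) (x : N)
    (hinj : Function.Injective (vd E f x)) (X : E) : ∃ Y, vd E f x Y = vd E η x X := by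
  -- The tangent space, `f` and `η` fill `F` by a dimension count, and η_* X has no component along
  -- `f` or `η`.
  let S : E × ℝ × ℝ →ₗ[ℝ] F := (vd E f x : E →ₗ[ℝ] F).coprod
    ((LinearMap.toSpanSingleton ℝ F (f x)).coprod (LinearMap.toSpanSingleton ℝ F (η x)))
  have hS : ∀ Y a b, S (Y, a, b) = vd E f x Y + (a • f x + b • η x) := fun _ _ _ => rfl
  have hf : ∀ Y a b, inner ℝ (f x) (S (Y, a, b)) = a := by
    intro Y a b
    rw [hS, inner_add_right, inner_add_right, inner_smul_right, inner_smul_right,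
      h.inner_left_vd_left, h.inner_left_left, h.inner_left_right]
    ring
  have hη : ∀ Y a b, inner ℝ (η x) (S (Y, a, b)) = b := by
    intro Y a b
    rw [hS, inner_add_right, inner_add_right, inner_smul_right, inner_smul_right,
      h.inner_right_vd, h.inner_right_right, h.inner_right_left]
    ring
  have hSinj : Function.Injective S := by
    rw [injective_iff_map_eq_zero]
    rintro ⟨Y, a, b⟩ hY
    have ha := hf Y a b
    have hb := hη Y a b
    rw [hY, inner_zero_right] at ha hb
    rw [hS, ← ha, ← hb] at hY
    have : Y = 0 := hinj (by simpa using hY)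
    simp [this, ← ha, ← hb]
  have hdim : Module.finrank ℝ (E × ℝ × ℝ) = Module.finrank ℝ F := by
    rw [hd, Module.finrank_prod, Module.finrank_prod, Module.finrank_self]
  obtain ⟨⟨Y, a, b⟩, hY⟩ := (LinearMap.injective_iff_surjective_of_finrank_eq_finrank hdim).1 hSinj
    (vd E η x X)
  have ha := hf Y a b
  have hb := hη Y a b
  rw [hY, h.inner_left_vd_right] at ha
  rw [hY, h.inner_right_vd_right] at hb
  refine ⟨Y, ?_⟩
  rw [← hY, hS, ← ha, ← hb]
  simp

end GaussPair

/-- The combination `cos σ a + sin σ b` of two fields. -/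
def rot (σ : N → ℝ) (a b : N → F) (x : N) : F := Real.cos (σ x) • a x + Real.sin (σ x) • b x

theorem contMDiff_rot {σ : N → ℝ} {a b : N → F} (hσ : ContMDiff 𝓘(ℝ, E) 𝓘(ℝ, ℝ) ∞ σ)
    (ha : ContMDiff 𝓘(ℝ, E) 𝓘(ℝ, F) ∞ a) (hb : ContMDiff 𝓘(ℝ, E) 𝓘(ℝ, F) ∞ b) :
    ContMDiff 𝓘(ℝ, E) 𝓘(ℝ, F) ∞ (rot σ a b) :=
  ((Real.contDiff_cos.contMDiff.comp hσ).smul ha).add ((Real.contDiff_sin.contMDiff.comp hσ).smul hb)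

theorem vd_rot {σ : N → ℝ} {a b : N → F} (hσ : ContMDiff 𝓘(ℝ, E) 𝓘(ℝ, ℝ) ∞ σ)
    (ha : ContMDiff 𝓘(ℝ, E) 𝓘(ℝ, F) ∞ a) (hb : ContMDiff 𝓘(ℝ, E) 𝓘(ℝ, F) ∞ b) (x : N) (X : E) :
    vd E (rot σ a b) x X = (Real.cos (σ x) • vd E a x X + Real.sin (σ x) • vd E b x X) +
      vd E σ x X • (Real.cos (σ x) • b x - Real.sin (σ x) • a x) := by
  have hc : ContMDiff 𝓘(ℝ, E) 𝓘(ℝ, ℝ) ∞ (fun x => Real.cos (σ x)) :=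
    Real.contDiff_cos.contMDiff.comp hσ
  have hs : ContMDiff 𝓘(ℝ, E) 𝓘(ℝ, ℝ) ∞ (fun x => Real.sin (σ x)) :=
    Real.contDiff_sin.contMDiff.comp hσ
  have h1 := vd_add (mdifferentiableAt_of_contMDiffAt ((hc.smul ha) x))
    (mdifferentiableAt_of_contMDiffAt ((hs.smul hb) x)) X
  have h2 := vd_smul (mdifferentiableAt_of_contMDiffAt (hc x)) (mdifferentiableAt_of_contMDiffAt (ha x)) X
  have h3 := vd_smul (mdifferentiableAt_of_contMDiffAt (hs x)) (mdifferentiableAt_of_contMDiffAt (hb x)) X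
  rw [vd_comp_real (Real.hasDerivAt_cos _) (mdifferentiableAt_of_contMDiffAt (hσ x))] at h2
  rw [vd_comp_real (Real.hasDerivAt_sin _) (mdifferentiableAt_of_contMDiffAt (hσ x))] at h3
  refine h1.trans ?_
  refine (congrArg₂ (· + ·) h2 h3).trans ?_
  module

end GaussPairs

/-! ### Smoothness of σ and its constancy along the principal distribution. -/

section FocalMap

variable {E F : Type*} [NormedAddCommGroup E] [NormedSpace ℝ E] [FiniteDimensional ℝ E]
  [NormedAddCommGroup F] [InnerProductSpace ℝ F] [FiniteDimensional ℝ F]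
  {N : Type*} [TopologicalSpace N] [ChartedSpace E N]

theorem finrank_ker_comp_bijective {G : Type*} [AddCommGroup G] [Module ℝ G] (T : E →ₗ[ℝ] G)
    (A : E →ₗ[ℝ] E) (hA : Function.Bijective A) :
    Module.finrank ℝ (T ∘ₗ A).ker = Module.finrank ℝ T.ker := by
  rw [LinearMap.ker_comp]
  exact (LinearEquiv.ofSubmodule' (LinearEquiv.ofBijective A hA) T.ker).finrank_eq

variable [IsManifold 𝓘(ℝ, E) ∞ N] {f η : N → F} (h : GaussPair E f η)
  (hinj : ∀ x, Function.Injective (vd E f x)) {lam : N → ℝ} (hlam : Continuous lam) {l : ℕ}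
  (hfin : ∀ x, Module.finrank ℝ (vd E η x + lam x • vd E f x).ker = l)

-- Both chart results transfer because kernels of η_* + λ f_* in the chart and on `N` differ by the
-- bijective `chartSymmDeriv`; at the centre of the chart no correction is needed.
include h hinj hlam hfin in
theorem principalCurvature_chart (hl : 2 ≤ l) (x : N) :
    ContMDiffAt 𝓘(ℝ, E) 𝓘(ℝ, ℝ) ∞ lam x ∧
      ∀ X, vd E η x X + lam x • vd E f x X = 0 → vd E lam x X = 0 := by
  set φ := chartAt E x with hφ
  have hU : IsOpen φ.target := φ.open_target
  have hx : φ x ∈ φ.target := φ.map_source (mem_chart_source E x)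
  have hmd : ∀ {a : N → F}, ContMDiff 𝓘(ℝ, E) 𝓘(ℝ, F) ∞ a → ∀ y,
    MDifferentiableAt 𝓘(ℝ, E) 𝓘(ℝ, F) a y := fun ha y => mdifferentiableAt_of_contMDiffAt (ha y)
  have hsm : ∀ {a : N → F}, ContMDiff 𝓘(ℝ, E) 𝓘(ℝ, F) ∞ a →
      ContDiffOn ℝ ∞ (a ∘ φ.symm) φ.target := by
    intro a ha
    simpa using contDiffOn_comp_chart_symm (ha.contMDiffOn (s := univ)) x
  have hf' := fun z (hz : z ∈ φ.target) X => fderiv_chart hz (hmd h.contMDiff_left (φ.symm z)) X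
  have hη' := fun z (hz : z ∈ φ.target) X => fderiv_chart hz (hmd h.contMDiff_right (φ.symm z)) X
  have hinj' : ∀ z ∈ φ.target, Function.Injective (fderiv ℝ (f ∘ φ.symm) z) := by
    intro z hz a b hab
    rw [hf' z hz, hf' z hz] at hab
    exact (chartSymmDeriv_bijective hz).1 (hinj _ hab)
  have horth' : ∀ z ∈ φ.target, ∀ X, inner ℝ ((η ∘ φ.symm) z) (fderiv ℝ (f ∘ φ.symm) z X) = 0 := by
    intro z hz X
    rw [hf' z hz]
    exact h.inner_right_vd _ _
  have hlam' : ContinuousOn (lam ∘ φ.symm) φ.target :=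
    hlam.comp_continuousOn φ.continuousOn_symm
  have hfin' : ∀ z ∈ φ.target, Module.finrank ℝ
      (fderiv ℝ (η ∘ φ.symm) z + (lam ∘ φ.symm) z • fderiv ℝ (f ∘ φ.symm) z).ker = l := by
    intro z hz
    have : (fderiv ℝ (η ∘ φ.symm) z + (lam ∘ φ.symm) z • fderiv ℝ (f ∘ φ.symm) z).toLinearMap =
      (vd E η (φ.symm z) + lam (φ.symm z) • vd E f (φ.symm z)).toLinearMap ∘ₗ
        (chartSymmDeriv x z).toLinearMap := by
      refine LinearMap.ext fun X => ?_
      exact congrArg₂ (fun a b => a + lam (φ.symm z) • b) (hη' z hz X) (hf' z hz X)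
    refine (congrArg (fun T : E →ₗ[ℝ] F => Module.finrank ℝ T.ker) this).trans ?_
    exact (finrank_ker_comp_bijective _ _ (chartSymmDeriv_bijective hz)).trans (hfin (φ.symm z))
  have hsmooth := contDiffOn_principalCurvature hU (hsm h.contMDiff_left) (hsm h.contMDiff_right)
    hinj' horth' hfin' hlam' (by omega)
  have hlx : ContMDiffAt 𝓘(ℝ, E) 𝓘(ℝ, ℝ) ∞ lam x :=
    contMDiffAt_of_comp_chart_symm (hsmooth.contDiffAt (hU.mem_nhds hx))
  refine ⟨hlx, fun X hX => ?_⟩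
  rw [← (hasFDerivAt_vd (mdifferentiableAt_of_contMDiffAt hlx)).fderiv]
  refine fderiv_principalCurvature_eq_zero hU (hsm h.contMDiff_left) (hsm h.contMDiff_right)
    hinj' horth' hfin' hsmooth hl hx ?_
  rw [(hasFDerivAt_vd (hmd h.contMDiff_left x)).fderiv,
    (hasFDerivAt_vd (hmd h.contMDiff_right x)).fderiv]
  simpa [φ] using hX

variable {σ : N → ℝ} (hσ0 : ∀ x, 0 < σ x) (hσ1 : ∀ x, σ x < Real.pi / 2)
  (hσ : ∀ x, lam x = Real.cot (σ x))

include hσ0 hσ1 in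
theorem sin_sigma_pos (x : N) : 0 < Real.sin (σ x) :=
  Real.sin_pos_of_pos_of_lt_pi (hσ0 x) (by linarith [hσ1 x, Real.pi_pos])

include hσ0 hσ1 in
theorem cos_sigma_pos (x : N) : 0 < Real.cos (σ x) :=
  Real.cos_pos_of_mem_Ioo ⟨by linarith [hσ0 x, Real.pi_pos], hσ1 x⟩

-- Multiplication by sin σ ≠ 0. The homogeneous form on the right is the bracket that appears in the
-- differential of the focal map.
include hσ0 hσ1 hσ in
theorem principal_iff_cos_sin (x : N) (a b : F) :
    b + lam x • a = 0 ↔ Real.cos (σ x) • a + Real.sin (σ x) • b = 0 := by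
  have hs := (sin_sigma_pos hσ0 hσ1 x).ne'
  have : Real.cos (σ x) • a + Real.sin (σ x) • b = Real.sin (σ x) • (b + lam x • a) := by
    rw [hσ, Real.cot_eq_cos_div_sin, smul_add, smul_smul, mul_div_cancel₀ _ hs, add_comm]
  rw [this, smul_eq_zero]
  simp [hs]

-- Presents `σ` as a function of `lam` that is smooth for positive `lam`, so regularity and
-- vanishing derivatives pass from `lam` to `σ`.
include hσ0 hσ1 hσ in
theorem sigma_eq_arctan (x : N) : σ x = Real.arctan (lam x)⁻¹ := by
  rw [hσ, Real.cot_eq_cos_div_sin, inv_div, ← Real.tan_eq_sin_div_cos, Real.arctan_tan _ (hσ1 x)]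
  linarith [hσ0 x, Real.pi_pos]

include hσ0 hσ1 hσ in
theorem lam_pos (x : N) : 0 < lam x := by
  rw [hσ, Real.cot_eq_cos_div_sin]
  exact div_pos (cos_sigma_pos hσ0 hσ1 x) (sin_sigma_pos hσ0 hσ1 x)

include h hinj hlam hfin hσ0 hσ1 hσ in
theorem contMDiff_sigma (hl : 2 ≤ l) : ContMDiff 𝓘(ℝ, E) 𝓘(ℝ, ℝ) ∞ σ := by
  intro x
  have h1 := (principalCurvature_chart h hinj hlam hfin hl x).1
  have h2 : ContDiffAt ℝ ∞ (fun t : ℝ => Real.arctan t⁻¹) (lam x) :=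
    Real.contDiff_arctan.contDiffAt.comp _ (contDiffAt_inv ℝ (lam_pos hσ0 hσ1 hσ x).ne')
  rw [funext (sigma_eq_arctan hσ0 hσ1 hσ)]
  exact h2.contMDiffAt.comp x h1

include h hinj hlam hfin hσ0 hσ1 hσ in
theorem vd_sigma_eq_zero (hl : 2 ≤ l) {x : N} {X : E}
    (hX : Real.cos (σ x) • vd E f x X + Real.sin (σ x) • vd E η x X = 0) : vd E σ x X = 0 := by
  obtain ⟨h1, h1'⟩ := principalCurvature_chart h hinj hlam hfin hl x
  have h2 : ContDiffAt ℝ ∞ (fun t : ℝ => Real.arctan t⁻¹) (lam x) :=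
    Real.contDiff_arctan.contDiffAt.comp _ (contDiffAt_inv ℝ (lam_pos hσ0 hσ1 hσ x).ne')
  rw [funext (sigma_eq_arctan hσ0 hσ1 hσ),
    vd_comp_real (c := fun t : ℝ => Real.arctan t⁻¹) (h2.differentiableAt (by simp)).hasDerivAt
      (mdifferentiableAt_of_contMDiffAt h1),
    h1' X ((principal_iff_cos_sin hσ0 hσ1 hσ x _ _).2 hX), mul_zero]

end FocalMap

/-! ### Principal spaces as kernels. -/

section Principal

variable {n : ℕ} {N : Type*} [TopologicalSpace N] [ChartedSpace (Euc n) N] {f η : N → Euc (n + 2)}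

theorem gaussPair_of_hypersurface (hf : IsSphereImmersionOn n f univ)
    (hη : IsGaussMapOn n f η univ) : GaussPair (Euc n) f η where
  contMDiff_left := contMDiffOn_univ.1 hf.contMDiffOn
  contMDiff_right := contMDiffOn_univ.1 hη.contMDiffOn
  inner_left_left x := by rw [real_inner_self_eq_norm_sq, hf.norm_eq_one x (mem_univ x), one_pow]
  inner_right_right x := by rw [real_inner_self_eq_norm_sq, hη.norm_eq_one x (mem_univ x), one_pow]
  inner_right_left x := hη.inner_position x (mem_univ x)
  inner_right_vd x X := hη.inner_tangent x (mem_univ x) X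

/-- A left inverse of f_*, applied to the tangential vectors −η_* X, produces a shape operator. So
`shapeOperator` takes its meaningful branch, and f_*(A X − λX) = −(η_* + λ f_*) X with f_*
injective. -/
theorem principalSpace_eq_ker (h : GaussPair (Euc n) f η) (lam : N → ℝ) {x : N}
    (hinj : Function.Injective (vd (Euc n) f x)) :
    principalSpace n f η lam x = (vd (Euc n) η x + lam x • vd (Euc n) f x).ker := by
  have hex : ∃ A : Module.End ℝ (TangentSpace (𝓡 n) x),
      ∀ X, differential n f x (A X) = - differential n η x X := by
    obtain ⟨p, hp⟩ := LinearMap.exists_leftInverse_of_injective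
      (vd (Euc n) f x : Euc n →ₗ[ℝ] Euc (n + 2)) (LinearMap.ker_eq_bot.2 hinj)
    refine ⟨-(p ∘ₗ (vd (Euc n) η x : Euc n →ₗ[ℝ] Euc (n + 2))), fun X => ?_⟩
    obtain ⟨Y, hY⟩ := h.exists_vd_eq (by simp) x hinj X
    have h1 : p (vd (Euc n) η x X) = Y := by
      rw [← hY]
      exact LinearMap.congr_fun hp Y
    show vd (Euc n) f x (-(p (vd (Euc n) η x X))) = - vd (Euc n) η x X
    rw [h1, map_neg, hY]
  have hA : ∀ X, vd (Euc n) f x (shapeOperator n f η x X) = - vd (Euc n) η x X := by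
    rw [shapeOperator, dif_pos hex]
    exact hex.choose_spec
  ext X
  refine Module.End.mem_eigenspace_iff.trans ?_
  constructor
  · intro hX
    have h1 := hA X
    rw [hX] at h1
    have h2 : lam x • vd (Euc n) f x X = - vd (Euc n) η x X := ((map_smul (vd (Euc n) f x) (lam x) X).symm.trans h1)
    show vd (Euc n) η x X + lam x • vd (Euc n) f x X = 0
    rw [h2, add_neg_cancel]
  · intro hX
    have hX' : vd (Euc n) η x X + lam x • vd (Euc n) f x X = 0 := hX
    refine hinj ((hA X).trans ?_)
    refine (neg_eq_of_add_eq_zero_right hX').trans ?_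
    exact (map_smul (vd (Euc n) f x) (lam x) X).symm

end Principal

/-! ### The gradient as an ambient vector, and its smoothness. -/

section Gradient

variable {E F : Type*} [NormedAddCommGroup E] [NormedSpace ℝ E] [FiniteDimensional ℝ E]
  [NormedAddCommGroup F] [InnerProductSpace ℝ F] [FiniteDimensional ℝ F]

/-- The transpose of a linear map, with an inner product space identified with its dual. -/
def dualPull (D : E →L[ℝ] F) : F →L[ℝ] E →L[ℝ] ℝ :=
  LinearMap.toContinuousLinearMap
    { toFun := fun w => (innerSL ℝ w) ∘L D
      map_add' := fun v w => by ext; simp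
      map_smul' := fun c w => by ext; simp }

@[simp]
theorem dualPull_apply (D : E →L[ℝ] F) (w : F) (v : E) : dualPull D w v = inner ℝ w (D v) := rfl

theorem contDiffOn_dualPull {X : Type*} [NormedAddCommGroup X] [NormedSpace ℝ X]
    {D : X → E →L[ℝ] F} {U : Set X} (hD : ContDiffOn ℝ ∞ D U) :
    ContDiffOn ℝ ∞ (fun x => dualPull (D x)) U := by
  rw [contDiffOn_clm_apply]
  intro w
  rw [contDiffOn_clm_apply]
  intro v
  exact contDiffOn_const.inner ℝ (hD.clm_apply contDiffOn_const)

theorem finrank_dual_eq : Module.finrank ℝ (E →L[ℝ] ℝ) = Module.finrank ℝ E :=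
  (LinearMap.toContinuousLinearMap (𝕜 := ℝ) (E := E) (F' := ℝ)).finrank_eq.symm.trans
    Subspace.dual_finrank_eq

/-- The Gram form of an injective linear map is invertible. -/
theorem gram_invertible {D : E →L[ℝ] F} (hD : Function.Injective D) :
    ∃ e : E ≃L[ℝ] (E →L[ℝ] ℝ), (e : E →L[ℝ] (E →L[ℝ] ℝ)) = dualPull D ∘L D := by
  refine exists_equiv_of_injective _ ?_ finrank_dual_eq.symm
  rw [injective_iff_map_eq_zero]
  intro v hv
  have h1 : inner ℝ (D v) (D v) = (0 : ℝ) := DFunLike.congr_fun hv v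
  exact hD ((inner_self_eq_zero.1 h1).trans (map_zero D).symm)

/-- The vector in the range of `D` which represents the functional `d`. -/
def gradVec (D : E →L[ℝ] F) (d : E →L[ℝ] ℝ) : F := D ((dualPull D ∘L D).inverse d)

theorem inner_gradVec {D : E →L[ℝ] F} (hD : Function.Injective D) (d : E →L[ℝ] ℝ) (v : E) :
    inner ℝ (gradVec D d) (D v) = d v :=
  DFunLike.congr_fun (apply_inverse_apply (gram_invertible hD) d) v

theorem eq_gradVec {D : E →L[ℝ] F} (hD : Function.Injective D) {d : E →L[ℝ] ℝ} (u : E)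
    (hu : ∀ v, inner ℝ (D u) (D v) = d v) : D u = gradVec D d := by
  have h1 : (dualPull D ∘L D) u = d := by
    ext v
    exact hu v
  rw [gradVec, ← h1, inverse_apply_apply (gram_invertible hD)]

/-- The ambient gradient vector does not depend on the frame, so it may be computed in one fixed
chart although differentials at different points use different charts. -/
theorem gradVec_comp {D : E →L[ℝ] F} (hD : Function.Injective D) (d : E →L[ℝ] ℝ) {A : E →L[ℝ] E}
    (hA : Function.Bijective A) : gradVec (D ∘L A) (d ∘L A) = gradVec D d := by
  refine eq_gradVec hD _ fun v => ?_
  obtain ⟨w, rfl⟩ := hA.2 v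
  exact inner_gradVec (D := D ∘L A) (hD.comp hA.1) (d ∘L A) w

theorem contDiffOn_gradVec {X : Type*} [NormedAddCommGroup X] [NormedSpace ℝ X]
    {D : X → E →L[ℝ] F} {d : X → E →L[ℝ] ℝ} {U : Set X} (hD : ContDiffOn ℝ ∞ D U)
    (hd : ContDiffOn ℝ ∞ d U) (hinj : ∀ x ∈ U, Function.Injective (D x)) :
    ContDiffOn ℝ ∞ (fun x => gradVec (D x) (d x)) U :=
  hD.clm_apply ((contDiffOn_inverse ((contDiffOn_dualPull hD).clm_comp hD)
    fun x hx => gram_invertible (hinj x hx)).clm_apply hd)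

variable {m k : ℕ} {L : Type*} [TopologicalSpace L] [ChartedSpace (Euc m) L]
  {g : L → Euc k} {τ : L → ℝ}

/-- Replaces the chosen gradient by the inverse of the Gram form, an expression visibly smooth in
its data. -/
theorem pushGradient_eq_gradVec {p : L} (hg : Function.Injective (vd (Euc m) g p)) :
    pushGradient m g τ p = gradVec (vd (Euc m) g p) (vd (Euc m) τ p) := by
  have hex : ∃ G : TangentSpace (𝓡 m) p, ∀ Y : TangentSpace (𝓡 m) p,
      inner ℝ (differential m g p G) (differential m g p Y) = mfderiv (𝓡 m) 𝓘(ℝ, ℝ) τ p Y :=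
    ⟨(dualPull (vd (Euc m) g p) ∘L vd (Euc m) g p).inverse (vd (Euc m) τ p),
      fun Y => inner_gradVec hg (vd (Euc m) τ p) Y⟩
  have h1 : ∀ v, inner ℝ (vd (Euc m) g p (inducedGradient m g τ p)) (vd (Euc m) g p v) =
      vd (Euc m) τ p v := by
    rw [inducedGradient, dif_pos hex]
    exact hex.choose_spec
  exact eq_gradVec hg _ h1

theorem pushGradient_mem_range (p : L) : ∃ G, vd (Euc m) g p G = pushGradient m g τ p :=
  ⟨inducedGradient m g τ p, rfl⟩

theorem inner_pushGradient {p : L} (hg : Function.Injective (vd (Euc m) g p)) (Y : Euc m) :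
    inner ℝ (pushGradient m g τ p) (vd (Euc m) g p Y) = vd (Euc m) τ p Y := by
  rw [pushGradient_eq_gradVec hg, inner_gradVec hg]

theorem contMDiff_pushGradient [IsManifold (𝓡 m) ∞ L]
    (hg : ContMDiff 𝓘(ℝ, Euc m) 𝓘(ℝ, Euc k) ∞ g) (hinj : ∀ p, Function.Injective (vd (Euc m) g p))
    (hτ : ContMDiff 𝓘(ℝ, Euc m) 𝓘(ℝ, ℝ) ∞ τ) :
    ContMDiff 𝓘(ℝ, Euc m) 𝓘(ℝ, Euc k) ∞ (pushGradient m g τ) := by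
  intro p
  set φ := chartAt (Euc m) p with hφ
  have hg1 : ContDiffOn ℝ ∞ (g ∘ φ.symm) φ.target := by
    simpa using contDiffOn_comp_chart_symm (hg.contMDiffOn (s := univ)) p
  have hτ1 : ContDiffOn ℝ ∞ (τ ∘ φ.symm) φ.target := by
    simpa using contDiffOn_comp_chart_symm (hτ.contMDiffOn (s := univ)) p
  have hD : ∀ z ∈ φ.target, fderiv ℝ (g ∘ φ.symm) z =
      vd (Euc m) g (φ.symm z) ∘L chartSymmDeriv p z := fun z hz => ContinuousLinearMap.ext fun X =>
    fderiv_chart hz (mdifferentiableAt_of_contMDiffAt (hg _)) X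
  have hd : ∀ z ∈ φ.target, fderiv ℝ (τ ∘ φ.symm) z =
      vd (Euc m) τ (φ.symm z) ∘L chartSymmDeriv p z := fun z hz => ContinuousLinearMap.ext fun X =>
    fderiv_chart hz (mdifferentiableAt_of_contMDiffAt (hτ _)) X
  have h1 : ContDiffOn ℝ ∞
      (fun z => gradVec (fderiv ℝ (g ∘ φ.symm) z) (fderiv ℝ (τ ∘ φ.symm) z)) φ.target := by
    refine contDiffOn_gradVec (hg1.fderiv_of_isOpen φ.open_target (by simp))
      (hτ1.fderiv_of_isOpen φ.open_target (by simp)) fun z hz => ?_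
    rw [hD z hz]
    exact (hinj _).comp (chartSymmDeriv_bijective hz).1
  refine contMDiffAt_of_comp_chart_symm ?_
  have hp : φ p ∈ φ.target := φ.map_source (mem_chart_source _ p)
  refine ((h1.contDiffAt (φ.open_target.mem_nhds hp))).congr_of_eventuallyEq ?_
  filter_upwards [φ.open_target.mem_nhds hp] with z hz
  rw [hD z hz, hd z hz, gradVec_comp (hinj _) _ (chartSymmDeriv_bijective hz)]
  exact pushGradient_eq_gradVec (hinj _)

end Gradient

/-! ### A linear system describing the normal space. -/

section NormalFrame

variable {E F Z : Type*} [NormedAddCommGroup E] [NormedSpace ℝ E] [FiniteDimensional ℝ E]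
  [NormedAddCommGroup F] [InnerProductSpace ℝ F] [FiniteDimensional ℝ F]
  [NormedAddCommGroup Z] [NormedSpace ℝ Z] [FiniteDimensional ℝ Z]

/-- The linear system whose first half cuts out the normal space and whose second half gives
coordinates on it. -/
def normalSystem (D : E →L[ℝ] F) (g₀ w₀ : F) (T : F →L[ℝ] Z) :
    F →L[ℝ] ((E →L[ℝ] ℝ) × ℝ) × (ℝ × Z) :=
  ((dualPull D).prod (innerSL ℝ g₀)).prod ((innerSL ℝ w₀).prod T)

theorem normalSystem_apply (D : E →L[ℝ] F) (g₀ w₀ : F) (T : F →L[ℝ] Z) (w : F) :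
    normalSystem D g₀ w₀ T w = ((dualPull D w, inner ℝ g₀ w), (inner ℝ w₀ w, T w)) := rfl

theorem finrank_normalSystem
    (hd : Module.finrank ℝ F = Module.finrank ℝ E + 2 + Module.finrank ℝ Z) :
    Module.finrank ℝ F = Module.finrank ℝ (((E →L[ℝ] ℝ) × ℝ) × (ℝ × Z)) := by
  rw [Module.finrank_prod, Module.finrank_prod, Module.finrank_prod, finrank_dual_eq,
    Module.finrank_self, hd]
  ring

/-- Take `T` to be coordinates on the orthogonal complement of the span of `D`, `g₀` and `w₀`,
extended by a projection. A vector killed by the other three components lies in that complement,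
where `T` is injective. -/
theorem exists_normalSystem_injective {D : E →L[ℝ] F} (hD : Function.Injective D) {g₀ w₀ : F}
    (hg : inner ℝ g₀ g₀ = (1 : ℝ)) (hw : inner ℝ w₀ w₀ = (1 : ℝ)) (hwg : inner ℝ w₀ g₀ = (0 : ℝ))
    (hgD : ∀ v, inner ℝ g₀ (D v) = (0 : ℝ)) (hwD : ∀ v, inner ℝ w₀ (D v) = (0 : ℝ))
    (hd : Module.finrank ℝ F = Module.finrank ℝ E + 2 + Module.finrank ℝ Z) :
    ∃ T : F →L[ℝ] Z, Function.Injective (normalSystem D g₀ w₀ T) := by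
  let S : E × ℝ × ℝ →ₗ[ℝ] F := (D : E →ₗ[ℝ] F).coprod
    ((LinearMap.toSpanSingleton ℝ F g₀).coprod (LinearMap.toSpanSingleton ℝ F w₀))
  have hS : ∀ Y a b, S (Y, a, b) = D Y + (a • g₀ + b • w₀) := fun _ _ _ => rfl
  have hgw : inner ℝ g₀ w₀ = (0 : ℝ) := by rw [real_inner_comm, hwg]
  have hSinj : Function.Injective S := by
    rw [injective_iff_map_eq_zero]
    rintro ⟨Y, a, b⟩ hY
    have ha : inner ℝ g₀ (S (Y, a, b)) = a := by
      rw [hS, inner_add_right, inner_add_right, inner_smul_right, inner_smul_right, hgD, hg, hgw]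
      ring
    have hb : inner ℝ w₀ (S (Y, a, b)) = b := by
      rw [hS, inner_add_right, inner_add_right, inner_smul_right, inner_smul_right, hwD, hw, hwg]
      ring
    rw [hY, inner_zero_right] at ha hb
    rw [hS, ← ha, ← hb] at hY
    have : Y = 0 := hD (by simpa using hY)
    simp [this, ← ha, ← hb]
  have hfin : Module.finrank ℝ S.rangeᗮ = Module.finrank ℝ Z := by
    have h1 := S.range.finrank_add_finrank_orthogonal
    rw [LinearMap.finrank_range_of_inj hSinj, hd, Module.finrank_prod, Module.finrank_prod,
      Module.finrank_self] at h1
    omega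
  let κ : S.rangeᗮ ≃ₗ[ℝ] Z := LinearEquiv.ofFinrankEq _ _ hfin
  obtain ⟨p, hp⟩ := LinearMap.exists_leftInverse_of_injective S.rangeᗮ.subtype
    S.rangeᗮ.ker_subtype
  refine ⟨LinearMap.toContinuousLinearMap (κ.toLinearMap ∘ₗ p), ?_⟩
  rw [injective_iff_map_eq_zero]
  intro w hw0
  rw [normalSystem_apply] at hw0
  simp only [Prod.mk_eq_zero] at hw0
  obtain ⟨⟨h1, h2⟩, h3, h4⟩ := hw0
  have hwmem : w ∈ S.rangeᗮ := by
    rw [Submodule.mem_orthogonal]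
    rintro _ ⟨⟨Y, a, b⟩, rfl⟩
    have h5 : inner ℝ w (D Y) = (0 : ℝ) := DFunLike.congr_fun h1 Y
    rw [hS, inner_add_left, inner_add_left, inner_smul_left, inner_smul_left, h2, h3,
      real_inner_comm, h5]
    simp
  have h5 : p w = 0 := by
    have h6 : κ (p w) = 0 := h4
    simpa using h6
  have h6 : p w = ⟨w, hwmem⟩ := LinearMap.congr_fun hp ⟨w, hwmem⟩
  rw [h5] at h6
  exact (congrArg Subtype.val h6).symm

end NormalFrame

/-! ### Charts and local sections of the unit normal bundle. -/

section NormalBundleCharts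

variable {m l k n : ℕ} {L : Type*} [TopologicalSpace L] [ChartedSpace (Euc m) L]
  {g : L → Euc k}

/-- The inclusion of the unit normal bundle. -/
def bundleIncl (q : UnitNormalBundle m g) : L × Euc k := (q.base, q.vec)

theorem isInducing_bundleIncl : IsInducing (bundleIncl (m := m) (g := g)) :=
  IsInducing.subtypeVal

theorem bundleIncl_injective : Function.Injective (bundleIncl (m := m) (g := g)) :=
  Subtype.val_injective

theorem continuous_base : Continuous (UnitNormalBundle.base : UnitNormalBundle m g → L) :=
  continuous_fst.comp isInducing_bundleIncl.continuous

theorem continuous_vec : Continuous (UnitNormalBundle.vec : UnitNormalBundle m g → Euc k) :=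
  continuous_snd.comp isInducing_bundleIncl.continuous

/-- The conditions which define the unit normal bundle. -/
def IsUnitNormal (m : ℕ) {k : ℕ} {L : Type*} [TopologicalSpace L] [ChartedSpace (Euc m) L]
    (g : L → Euc k) (p : L) (w : Euc k) : Prop :=
  ‖w‖ = 1 ∧ inner ℝ w (g p) = 0 ∧ ∀ Y, inner ℝ w (vd (Euc m) g p Y) = 0

theorem isUnitNormal_vec (q : UnitNormalBundle m g) : IsUnitNormal m g q.base q.vec := q.2

/-- The element of the unit normal bundle with given base point and vector. -/
def bundleMk {p : L} {w : Euc k} (h : IsUnitNormal m g p w) : UnitNormalBundle m g := ⟨(p, w), h⟩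

theorem bundleIncl_bundleMk {p : L} {w : Euc k} (h : IsUnitNormal m g p w) :
    bundleIncl (bundleMk h) = (p, w) := rfl

variable [IsManifold (𝓡 m) ∞ L]

/-- The unit normal bundle has smooth charts and smooth local sections over the base. -/
theorem exists_bundle_chart (hg : ContMDiff 𝓘(ℝ, Euc m) 𝓘(ℝ, Euc k) ∞ g)
    (hinj : ∀ p, Function.Injective (vd (Euc m) g p)) (hg1 : ∀ p, inner ℝ (g p) (g p) = (1 : ℝ))
    (hk : k = m + 2 + l) (hn : n = m + l) (q₀ : UnitNormalBundle m g) :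
    ∃ c : OpenPartialHomeomorph (UnitNormalBundle m g) (Euc n), q₀ ∈ c.source ∧
      ContMDiffOn 𝓘(ℝ, Euc n) ((𝓡 m).prod 𝓘(ℝ, Euc k)) ∞ (bundleIncl ∘ c.symm) c.target ∧
      (∃ Φ : L × Euc k → Euc n, ∀ z ∈ c.source,
        ContMDiffAt ((𝓡 m).prod 𝓘(ℝ, Euc k)) 𝓘(ℝ, Euc n) ∞ Φ (bundleIncl z) ∧
          c z = Φ (bundleIncl z)) ∧
      ∃ s : L → UnitNormalBundle m g, ContinuousAt s q₀.base ∧ s q₀.base = q₀ ∧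
        ContMDiffAt (𝓡 m) ((𝓡 m).prod 𝓘(ℝ, Euc k)) ∞ (fun p => bundleIncl (s p)) q₀.base ∧
        ∀ᶠ p in 𝓝 q₀.base, (s p).base = p := by
  classical
  set p₀ := q₀.base with hp₀
  set w₀ := q₀.vec with hw₀
  set φ := chartAt (Euc m) p₀ with hφ
  have hgt : ContDiffOn ℝ ∞ (g ∘ φ.symm) φ.target := by
    simpa using contDiffOn_comp_chart_symm (hg.contMDiffOn (s := univ)) p₀
  set D : Euc m → Euc m →L[ℝ] Euc k := fderiv ℝ (g ∘ φ.symm) with hDdef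
  have hDs : ContDiffOn ℝ ∞ D φ.target := hgt.fderiv_of_isOpen φ.open_target (by simp)
  have hD : ∀ z ∈ φ.target, ∀ X, D z X = vd (Euc m) g (φ.symm z) (chartSymmDeriv p₀ z X) :=
    fun z hz X => fderiv_chart hz (mdifferentiableAt_of_contMDiffAt (hg _)) X
  have hnormal : ∀ z ∈ φ.target, ∀ w, dualPull (D z) w = 0 ↔
      ∀ Y, inner ℝ w (vd (Euc m) g (φ.symm z) Y) = 0 := by
    intro z hz w
    constructor
    · intro h Y
      obtain ⟨X, rfl⟩ := (chartSymmDeriv_bijective hz).2 Y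
      rw [← hD z hz]
      exact DFunLike.congr_fun h X
    · intro h
      ext X
      rw [dualPull_apply, hD z hz, h]
      rfl
  have hz₀ : φ p₀ ∈ φ.target := φ.map_source (mem_chart_source _ p₀)
  have hφp₀ : φ.symm (φ p₀) = p₀ := φ.left_inv (mem_chart_source _ p₀)
  have hq₀ := isUnitNormal_vec q₀
  have hDinj : ∀ z ∈ φ.target, Function.Injective (D z) := by
    intro z hz a b hab
    rw [hD z hz, hD z hz] at hab
    exact (chartSymmDeriv_bijective hz).1 (hinj _ hab)
  have hgvd : ∀ p X, inner ℝ (g p) (vd (Euc m) g p X) = 0 := fun p X => inner_vd_self hg hg1 p X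
  have hfr : Module.finrank ℝ (Euc k) =
      Module.finrank ℝ (Euc m) + 2 + Module.finrank ℝ (Euc l) := by simp [hk]
  obtain ⟨T, hT⟩ := exists_normalSystem_injective (Z := Euc l) (g₀ := g p₀) (w₀ := w₀)
    (hDinj _ hz₀) (hg1 p₀) (by rw [real_inner_self_eq_norm_sq, hq₀.1, one_pow]) hq₀.2.1
    (fun v => by rw [hD _ hz₀, hφp₀, hgvd]) (fun v => by rw [hD _ hz₀, hφp₀]; exact hq₀.2.2 _) hfr
  let C : Euc m → Euc k →L[ℝ] ((Euc m →L[ℝ] ℝ) × ℝ) × (ℝ × Euc l) :=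
    fun z => normalSystem (D z) (g (φ.symm z)) w₀ T
  have hCs : ContDiffOn ℝ ∞ C φ.target := by
    rw [contDiffOn_clm_apply]
    intro w
    exact (((contDiffOn_dualPull hDs).clm_apply contDiffOn_const).prodMk
      (hgt.inner ℝ contDiffOn_const)).prodMk contDiffOn_const
  set B := {z ∈ φ.target | ∃ e : Euc k ≃L[ℝ] ((Euc m →L[ℝ] ℝ) × ℝ) × (ℝ × Euc l),
    (e : Euc k →L[ℝ] ((Euc m →L[ℝ] ℝ) × ℝ) × (ℝ × Euc l)) = C z} with hBdef
  have hB : IsOpen B := isOpen_inter_invertible φ.open_target hCs.continuousOn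
  have hz₀B : φ p₀ ∈ B := by
    refine ⟨hz₀, exists_equiv_of_injective _ ?_ (finrank_normalSystem hfr)⟩
    show Function.Injective (normalSystem _ _ _ _)
    rw [hφp₀]
    exact hT
  -- The point of the normal space with ⟨w₀, ·⟩ = 1 and `T`-coordinate `y.2`. Normalizing it is
  -- central projection of an affine slice onto the open hemisphere around `w₀` of the fibre sphere.
  let ρ : Euc m × Euc l → Euc k := fun y => (C y.1).inverse ((0, 0), (1, y.2))
  have hρ : ∀ y : Euc m × Euc l, y.1 ∈ B → C y.1 (ρ y) = ((0, 0), (1, y.2)) :=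
    fun y hy => apply_inverse_apply hy.2 _
  have hρ0 : ∀ y : Euc m × Euc l, y.1 ∈ B → ρ y ≠ 0 := by
    intro y hy h0
    have h1 := hρ y hy
    rw [h0, map_zero] at h1
    have h2 := congrArg (fun a => a.2.1) h1
    simp at h2
  have hρs : ContDiffOn ℝ ∞ ρ (B ×ˢ univ) := by
    have h1 : ContDiffOn ℝ ∞ (fun y : Euc m × Euc l => (C y.1).inverse) (B ×ˢ univ) :=
      (contDiffOn_inverse (hCs.mono fun z hz => hz.1) fun z hz => hz.2).comp contDiffOn_fst
        fun y hy => hy.1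
    exact h1.clm_apply (contDiffOn_const.prodMk (contDiffOn_const.prodMk contDiffOn_snd))
  let ν : Euc m × Euc l → Euc k := fun y => ‖ρ y‖⁻¹ • ρ y
  have hνs : ContDiffOn ℝ ∞ ν (B ×ˢ univ) :=
    ((hρs.norm ℝ fun y hy => hρ0 y hy.1).inv fun y hy => norm_ne_zero_iff.2 (hρ0 y hy.1)).smul hρs
  have hνN : ∀ y : Euc m × Euc l, y.1 ∈ B → IsUnitNormal m g (φ.symm y.1) (ν y) := by
    intro y hy
    have h1 := hρ y hy
    have h2 : dualPull (D y.1) (ρ y) = 0 := congrArg (fun a => a.1.1) h1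
    have h3 : inner ℝ (g (φ.symm y.1)) (ρ y) = 0 := congrArg (fun a => a.1.2) h1
    refine ⟨?_, ?_, fun Y => ?_⟩
    · rw [norm_smul, norm_inv, norm_norm, inv_mul_cancel₀ (norm_ne_zero_iff.2 (hρ0 y hy))]
    · rw [inner_smul_left, real_inner_comm, h3, mul_zero]
    · rw [inner_smul_left, (hnormal _ hy.1 _).1 h2 Y, mul_zero]
  -- The value `q₀` is used only where the pair fails to be a unit normal, hence never over `B`.
  let inv : Euc m × Euc l → UnitNormalBundle m g := fun y =>
    if h : IsUnitNormal m g (φ.symm y.1) (ν y) then bundleMk h else q₀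
  have hinv : ∀ y : Euc m × Euc l, y.1 ∈ B → bundleIncl (inv y) = (φ.symm y.1, ν y) := by
    intro y hy
    simp only [inv, dif_pos (hνN y hy), bundleIncl_bundleMk]
  -- The chart is central projection back to the slice; the formula makes sense on `L × Euc k` and
  -- is smooth where ⟨w₀, w⟩ ≠ 0.
  let Φ : L × Euc k → Euc m × Euc l := fun a => (φ a.1, (inner ℝ w₀ a.2 : ℝ)⁻¹ • T a.2)
  let src : Set (UnitNormalBundle m g) :=
    {q | q.base ∈ φ.source ∩ φ ⁻¹' B ∧ 0 < (inner ℝ w₀ q.vec : ℝ)}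
  have hwρ : ∀ y : Euc m × Euc l, y.1 ∈ B → inner ℝ w₀ (ρ y) = (1 : ℝ) :=
    fun y hy => congrArg (fun a => a.2.1) (hρ y hy)
  have hTρ : ∀ y : Euc m × Euc l, y.1 ∈ B → T (ρ y) = y.2 :=
    fun y hy => congrArg (fun a => a.2.2) (hρ y hy)
  have hwν : ∀ y : Euc m × Euc l, y.1 ∈ B → inner ℝ w₀ (ν y) = ‖ρ y‖⁻¹ := by
    intro y hy
    rw [inner_smul_right, hwρ y hy, mul_one]
  have hsrc_open : IsOpen src := by
    refine IsOpen.inter ((φ.isOpen_inter_preimage hB).preimage continuous_base) ?_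
    have hc : Continuous fun q : UnitNormalBundle m g => (inner ℝ w₀ q.vec : ℝ) :=
      continuous_const.inner continuous_vec
    exact isOpen_lt continuous_const hc
  have hΦs : ∀ a : L × Euc k, a.1 ∈ φ.source → (inner ℝ w₀ a.2 : ℝ) ≠ 0 →
      ContMDiffAt ((𝓡 m).prod 𝓘(ℝ, Euc k)) 𝓘(ℝ, Euc m × Euc l) ∞ Φ a := by
    intro a ha1 ha2
    have h1 : ContMDiffAt ((𝓡 m).prod 𝓘(ℝ, Euc k)) 𝓘(ℝ, Euc m) ∞ (fun a : L × Euc k => φ a.1) a :=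
      ContMDiffAt.comp a (contMDiffOn_chart.contMDiffAt (φ.open_source.mem_nhds ha1))
        contMDiffAt_fst
    have h2 : ContDiffAt ℝ ∞ (fun w : Euc k => (inner ℝ w₀ w : ℝ)⁻¹ • T w) a.2 :=
      ((contDiffAt_const.inner ℝ contDiffAt_id).inv ha2).smul T.contDiff.contDiffAt
    have h3 : ContMDiffAt ((𝓡 m).prod 𝓘(ℝ, Euc k)) 𝓘(ℝ, Euc l) ∞
        (fun a : L × Euc k => (inner ℝ w₀ a.2 : ℝ)⁻¹ • T a.2) a :=
      ContMDiffAt.comp (I' := 𝓘(ℝ, Euc k)) (g := fun w : Euc k => (inner ℝ w₀ w : ℝ)⁻¹ • T w)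
        a h2.contMDiffAt contMDiffAt_snd
    exact h1.prodMk_space h3
  let c₁ : OpenPartialHomeomorph (UnitNormalBundle m g) (Euc m × Euc l) :=
    { toFun := fun q => Φ (bundleIncl q)
      invFun := inv
      source := src
      target := B ×ˢ univ
      map_source' := fun q hq => ⟨hq.1.2, mem_univ _⟩
      map_target' := by
        intro y hy
        have h1 := hinv y hy.1
        have hb : (inv y).base = φ.symm y.1 := congrArg Prod.fst h1
        have hv : (inv y).vec = ν y := congrArg Prod.snd h1
        show (inv y).base ∈ φ.source ∩ φ ⁻¹' B ∧ 0 < (inner ℝ w₀ (inv y).vec : ℝ)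
        rw [hb, hv, hwν y hy.1]
        refine ⟨⟨φ.map_target hy.1.1, ?_⟩, inv_pos.2 (norm_pos_iff.2 (hρ0 y hy.1))⟩
        rw [mem_preimage, φ.right_inv hy.1.1]
        exact hy.1
      left_inv' := by
        intro q hq
        obtain ⟨⟨hq1, hq2⟩, hq3⟩ := hq
        have hq2' : (Φ (bundleIncl q)).1 ∈ B := hq2
        refine bundleIncl_injective ?_
        rw [hinv _ hq2']
        have hqN := isUnitNormal_vec q
        have hbase : φ.symm (φ q.base) = q.base := φ.left_inv hq1
        have hρ' : ρ (Φ (bundleIncl q)) = (inner ℝ w₀ q.vec : ℝ)⁻¹ • q.vec := by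
          obtain ⟨e, he⟩ := hq2'.2
          have h1 : C (φ q.base) ((inner ℝ w₀ q.vec : ℝ)⁻¹ • q.vec) =
              ((0, 0), (1, (inner ℝ w₀ q.vec : ℝ)⁻¹ • T q.vec)) := by
            have h2 : dualPull (D (φ q.base)) q.vec = 0 := by
              rw [hnormal _ hq2.1, hbase]
              exact hqN.2.2
            have h3 : inner ℝ (g q.base) q.vec = 0 := by
              rw [real_inner_comm]
              exact hqN.2.1
            show normalSystem _ _ _ _ _ = _
            rw [map_smul, normalSystem_apply, h2, hbase, h3]
            simp [inv_mul_cancel₀ hq3.ne']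
          show (C (φ q.base)).inverse _ = _
          rw [← inverse_apply_apply hq2.2 ((inner ℝ w₀ q.vec : ℝ)⁻¹ • q.vec), h1]
          rfl
        refine Prod.ext hbase ?_
        show ‖ρ (Φ (bundleIncl q))‖⁻¹ • ρ (Φ (bundleIncl q)) = q.vec
        rw [hρ', norm_smul, hqN.1, mul_one, norm_inv, inv_inv, Real.norm_of_nonneg hq3.le,
          smul_smul, mul_inv_cancel₀ hq3.ne', one_smul]
      right_inv' := by
        intro y hy
        show Φ (bundleIncl (inv y)) = y
        rw [hinv y hy.1]
        refine Prod.ext (φ.right_inv hy.1.1) ?_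
        show (inner ℝ w₀ (ν y) : ℝ)⁻¹ • T (ν y) = y.2
        rw [hwν y hy.1, inv_inv, map_smul, hTρ y hy.1, smul_smul,
          mul_inv_cancel₀ (norm_ne_zero_iff.2 (hρ0 y hy.1)), one_smul]
      open_source := hsrc_open
      open_target := hB.prod isOpen_univ
      continuousOn_toFun := fun q hq =>
        ((hΦs (bundleIncl q) hq.1.1 hq.2.ne').continuousAt.comp
          isInducing_bundleIncl.continuous.continuousAt).continuousWithinAt
      continuousOn_invFun := by
        rw [isInducing_bundleIncl.continuousOn_iff]
        refine ContinuousOn.congr ?_ fun y hy => hinv y hy.1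
        exact (φ.continuousOn_symm.comp continuousOn_fst fun y hy => hy.1.1).prodMk
          hνs.continuousOn }
  let κ : (Euc m × Euc l) ≃L[ℝ] Euc n := ContinuousLinearEquiv.ofFinrankEq (by simp [hn])
  let c := c₁.transHomeomorph κ.toHomeomorph
  have hincl : ContMDiffOn 𝓘(ℝ, Euc m × Euc l) ((𝓡 m).prod 𝓘(ℝ, Euc k)) ∞
      (fun y => bundleIncl (inv y)) (B ×ˢ univ) := by
    refine ContMDiffOn.congr ?_ fun y hy => hinv y hy.1
    have h1 : ContMDiffOn 𝓘(ℝ, Euc m × Euc l) (𝓡 m) ∞ (fun y : Euc m × Euc l => φ.symm y.1)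
        (B ×ˢ univ) :=
      (contMDiffOn_chart_symm (x := p₀)).comp contDiff_fst.contMDiff.contMDiffOn fun y hy => hy.1.1
    exact h1.prodMk hνs.contMDiffOn
  have hq₀s : q₀ ∈ src := by
    refine ⟨⟨mem_chart_source _ p₀, hz₀B⟩, ?_⟩
    show (0 : ℝ) < inner ℝ w₀ w₀
    rw [real_inner_self_eq_norm_sq, hq₀.1]
    norm_num
  refine ⟨c, hq₀s, ?_, ⟨fun a => κ (Φ a), fun z hz => ⟨?_, rfl⟩⟩, ?_⟩
  · exact hincl.comp (κ.symm.contDiff.contMDiff.contMDiffOn (s := c.target)) fun y hy => hy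
  · exact ContMDiffAt.comp _ κ.contDiff.contMDiff.contMDiffAt (hΦs _ hz.1.1 hz.2.ne')
  · set v₀ := (Φ (bundleIncl q₀)).2 with hv₀
    have hinv0 : inv (φ p₀, v₀) = q₀ := c₁.left_inv hq₀s
    have hmem : ((φ p₀, v₀) : Euc m × Euc l) ∈ B ×ˢ (univ : Set (Euc l)) := ⟨hz₀B, mem_univ _⟩
    have hφc : ContMDiffAt (𝓡 m) 𝓘(ℝ, Euc m × Euc l) ∞ (fun p => (φ p, v₀)) p₀ :=
      (contMDiffOn_chart.contMDiffAt (chart_source_mem_nhds _ p₀)).prodMk_space contMDiffAt_const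
    have hev : ∀ᶠ p in 𝓝 p₀, φ p ∈ B :=
      (φ.continuousAt (mem_chart_source _ p₀)).eventually (hB.mem_nhds hz₀B)
    -- The local section keeps the fibre coordinate of `q₀` fixed.
    refine ⟨fun p => inv (φ p, v₀), ?_, hinv0, ?_, ?_⟩
    · exact ContinuousAt.comp (f := fun p => (φ p, v₀)) (g := inv)
        (c₁.continuousOn_symm.continuousAt (c₁.open_target.mem_nhds hmem)) hφc.continuousAt
    · exact ContMDiffAt.comp p₀
        (hincl.contMDiffAt ((hB.prod isOpen_univ).mem_nhds hmem)) hφc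
    · filter_upwards [hev, chart_source_mem_nhds (Euc m) p₀] with p hp1 hp2
      exact (congrArg Prod.fst (hinv (φ p, v₀) hp1)).trans (φ.left_inv hp2)

end NormalBundleCharts

/-! ### Passing between a hypersurface and its focal map. -/

section FocalPairs

variable {E F : Type*} [NormedAddCommGroup E] [NormedSpace ℝ E] [FiniteDimensional ℝ E]
  [NormedAddCommGroup F] [InnerProductSpace ℝ F] [FiniteDimensional ℝ F]
  {N : Type*} [TopologicalSpace N] [ChartedSpace E N]

theorem vd_neg {a : N → F} (ha : ContMDiff 𝓘(ℝ, E) 𝓘(ℝ, F) ∞ a) (x : N) (X : E) :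
    vd E (fun y => -a y) x X = -vd E a x X := by
  have := vd_sub (mdifferentiableAt_of_contMDiffAt (contMDiffAt_const (I := 𝓘(ℝ, E)) (c := (0 : F))))
    (mdifferentiableAt_of_contMDiffAt (ha x)) X
  rw [vd_const] at this
  simpa using this

/-- A map `G` into the unit sphere with a unit normal field `ξ` along it, tangent to the sphere,
whose tangential part is the gradient of `t`. -/
structure FocalPair (E : Type*) [NormedAddCommGroup E] [NormedSpace ℝ E] {N : Type*}
    [TopologicalSpace N] [ChartedSpace E N] (G ξ : N → F) (t : N → ℝ) : Prop where
  contMDiff_left : ContMDiff 𝓘(ℝ, E) 𝓘(ℝ, F) ∞ G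
  contMDiff_right : ContMDiff 𝓘(ℝ, E) 𝓘(ℝ, F) ∞ ξ
  contMDiff_fun : ContMDiff 𝓘(ℝ, E) 𝓘(ℝ, ℝ) ∞ t
  inner_left_left : ∀ x, inner ℝ (G x) (G x) = 1
  inner_right_right : ∀ x, inner ℝ (ξ x) (ξ x) = 1
  inner_right_left : ∀ x, inner ℝ (ξ x) (G x) = 0
  inner_right_vd : ∀ x X, inner ℝ (ξ x) (vd E G x X) = vd E t x X

theorem inner_rot_rot (c s : ℝ) (hcs : c ^ 2 + s ^ 2 = 1) (a b : F) (ha : inner ℝ a a = (1 : ℝ))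
    (hb : inner ℝ b b = (1 : ℝ)) (hab : inner ℝ a b = (0 : ℝ)) :
    inner ℝ (c • a + s • b) (c • a + s • b) = (1 : ℝ) := by
  have hba : inner ℝ b a = (0 : ℝ) := by rw [real_inner_comm, hab]
  rw [inner_add_left, inner_add_right, inner_add_right, inner_smul_left, inner_smul_left,
    inner_smul_left, inner_smul_left, inner_smul_right, inner_smul_right, inner_smul_right,
    inner_smul_right, ha, hb, hab, hba]
  simp only [conj_trivial]
  linarith

namespace FocalPair

variable {G ξ : N → F} {t : N → ℝ} (h : FocalPair E G ξ t)
include h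

theorem vd_left_rot (x : N) (X : E) : vd E (rot t G (fun y => -ξ y)) x X =
    Real.cos (t x) • vd E G x X - Real.sin (t x) • vd E ξ x X -
      vd E t x X • (Real.cos (t x) • ξ x + Real.sin (t x) • G x) := by
  rw [vd_rot h.contMDiff_fun h.contMDiff_left h.contMDiff_right.neg, vd_neg h.contMDiff_right]
  module

theorem vd_right_rot (x : N) (X : E) : vd E (rot t ξ G) x X =
    Real.cos (t x) • vd E ξ x X + Real.sin (t x) • vd E G x X +
      vd E t x X • (Real.cos (t x) • G x - Real.sin (t x) • ξ x) :=
  vd_rot h.contMDiff_fun h.contMDiff_right h.contMDiff_left x X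

/-- With f = cos t G − sin t ξ and η = cos t ξ + sin t G one has G = cos t f + sin t η and ξ = cos t
η − sin t f; differentiating G and moving the dt term across leaves this bracket. -/
theorem cos_smul_add_sin_smul (x : N) (X : E) :
    Real.cos (t x) • vd E (rot t G (fun y => -ξ y)) x X + Real.sin (t x) • vd E (rot t ξ G) x X =
      vd E G x X - vd E t x X • ξ x := by
  rw [h.vd_left_rot, h.vd_right_rot]
  have h1 := Real.sin_sq_add_cos_sq (t x)
  have h2 : vd E G x X - vd E t x X • ξ x =
      (Real.sin (t x) ^ 2 + Real.cos (t x) ^ 2) • (vd E G x X - vd E t x X • ξ x) := by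
    rw [h1, one_smul]
  rw [h2]
  module

/-- The map at distance `t` from `G` is a hypersurface whose normal field is explicit. -/
theorem gaussPair : GaussPair E (rot t G (fun y => -ξ y)) (rot t ξ G) where
  contMDiff_left := contMDiff_rot h.contMDiff_fun h.contMDiff_left h.contMDiff_right.neg
  contMDiff_right := contMDiff_rot h.contMDiff_fun h.contMDiff_right h.contMDiff_left
  inner_left_left x := by
    refine inner_rot_rot _ _ (Real.cos_sq_add_sin_sq _) _ _ (h.inner_left_left x) ?_ ?_
    · rw [inner_neg_neg, h.inner_right_right]
    · rw [inner_neg_right, real_inner_comm, h.inner_right_left, neg_zero]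
  inner_right_right x := inner_rot_rot _ _ (Real.cos_sq_add_sin_sq _) _ _ (h.inner_right_right x)
    (h.inner_left_left x) (h.inner_right_left x)
  inner_right_left x := by
    have h1 : inner ℝ (G x) (ξ x) = (0 : ℝ) := by rw [real_inner_comm, h.inner_right_left]
    simp only [rot, inner_add_left, inner_add_right, inner_smul_left, inner_smul_right,
      inner_neg_right, h.inner_left_left, h.inner_right_right, h.inner_right_left, h1]
    simp only [conj_trivial]
    ring
  inner_right_vd x X := by
    have h1 : inner ℝ (G x) (ξ x) = (0 : ℝ) := by rw [real_inner_comm, h.inner_right_left]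
    have h2 : inner ℝ (G x) (vd E G x X) = 0 := inner_vd_self h.contMDiff_left h.inner_left_left x X
    have h3 : inner ℝ (ξ x) (vd E ξ x X) = 0 :=
      inner_vd_self h.contMDiff_right h.inner_right_right x X
    -- From ⟨ξ, G⟩ = 0. The normality sum is then (cos² t + sin² t) dt − dt = 0, which is where the
    -- gradient condition on ξ enters.
    have h4 : inner ℝ (G x) (vd E ξ x X) = -vd E t x X := by
      have h5 := inner_vd_add_of_inner_const h.contMDiff_right h.contMDiff_left h.inner_right_left x X
      rw [h.inner_right_vd, real_inner_comm] at h5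
      linarith
    rw [h.vd_left_rot]
    simp only [rot, inner_add_left, inner_add_right, inner_sub_right, inner_smul_left,
      inner_smul_right, h.inner_left_left, h.inner_right_right, h.inner_right_left, h1, h2, h3, h4,
      h.inner_right_vd]
    simp only [conj_trivial]
    ring

end FocalPair

namespace GaussPair

variable {f η : N → F} (h : GaussPair E f η) {σ : N → ℝ} (hσ : ContMDiff 𝓘(ℝ, E) 𝓘(ℝ, ℝ) ∞ σ)
include h

theorem rot_rot (x : N) : rot σ (rot σ f η) (fun y => -rot σ η (fun z => -f z) y) x = f x := by
  have h1 := Real.sin_sq_add_cos_sq (σ x)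
  have h2 : f x = (Real.sin (σ x) ^ 2 + Real.cos (σ x) ^ 2) • f x := by rw [h1, one_smul]
  conv_rhs => rw [h2]
  simp only [rot]
  module

include hσ

theorem vd_focal (x : N) (X : E) : vd E (rot σ f η) x X =
    (Real.cos (σ x) • vd E f x X + Real.sin (σ x) • vd E η x X) +
      vd E σ x X • rot σ η (fun y => -f y) x := by
  rw [vd_rot hσ h.contMDiff_left h.contMDiff_right]
  simp only [rot]
  module

/-- Rotation in the plane of `f` and `η`. The differentials of `f` and `η` are orthogonal to this
plane, so only the dσ term of the focal differential meets ξ, with coefficient dσ. -/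
theorem focalPair : FocalPair E (rot σ f η) (rot σ η (fun y => -f y)) σ where
  contMDiff_left := contMDiff_rot hσ h.contMDiff_left h.contMDiff_right
  contMDiff_right := contMDiff_rot hσ h.contMDiff_right h.contMDiff_left.neg
  contMDiff_fun := hσ
  inner_left_left x := inner_rot_rot _ _ (Real.cos_sq_add_sin_sq _) _ _ (h.inner_left_left x)
    (h.inner_right_right x) (h.inner_left_right x)
  inner_right_right x := by
    refine inner_rot_rot _ _ (Real.cos_sq_add_sin_sq _) _ _ (h.inner_right_right x) ?_ ?_
    · rw [inner_neg_neg, h.inner_left_left]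
    · rw [inner_neg_right, h.inner_right_left, neg_zero]
  inner_right_left x := by
    simp only [rot, inner_add_left, inner_add_right, inner_smul_left, inner_smul_right,
      inner_neg_left, h.inner_left_left, h.inner_right_right, h.inner_right_left,
      h.inner_left_right]
    simp only [conj_trivial]
    ring
  inner_right_vd x X := by
    rw [h.vd_focal hσ]
    simp only [rot, inner_add_left, inner_add_right, inner_smul_left, inner_smul_right,
      inner_neg_left, inner_neg_right, h.inner_left_left, h.inner_right_right, h.inner_right_left,
      h.inner_left_right, h.inner_left_vd_left, h.inner_left_vd_right, h.inner_right_vd,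
      h.inner_right_vd_right]
    simp only [conj_trivial]
    have h6 := Real.sin_sq_add_cos_sq (σ x)
    linear_combination (vd E σ x X) * h6

/-- The kernel of the differential of the focal map is the principal distribution. -/
theorem vd_focal_eq_zero_iff
    (hker : ∀ x X, Real.cos (σ x) • vd E f x X + Real.sin (σ x) • vd E η x X = 0 →
      vd E σ x X = 0) (x : N) (X : E) :
    vd E (rot σ f η) x X = 0 ↔
      Real.cos (σ x) • vd E f x X + Real.sin (σ x) • vd E η x X = 0 := by
  have h1 := h.vd_focal hσ x X
  constructor
  · intro h2
    have h3 := (h.focalPair hσ).inner_right_vd x X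
    rw [h2, inner_zero_right] at h3
    rw [h2, ← h3, zero_smul, add_zero] at h1
    exact h1.symm
  · intro h2
    rw [h1, h2, hker x X h2, zero_smul, add_zero]

/-- Two points of strict inequality: a tangent vector on which `dσ` takes the value
`‖h_* X‖ ^ 2` has `‖h_* X‖ < 1`. -/
theorem norm_vd_focal_lt_one
    (hker : ∀ x X, Real.cos (σ x) • vd E f x X + Real.sin (σ x) • vd E η x X = 0 →
      vd E σ x X = 0) (x : N) (X : E)
    (hX : vd E σ x X = ‖vd E (rot σ f η) x X‖ ^ 2) : ‖vd E (rot σ f η) x X‖ < 1 := by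
  set u := Real.cos (σ x) • vd E f x X + Real.sin (σ x) • vd E η x X with hu
  have h1 : vd E (rot σ f η) x X = u + vd E σ x X • rot σ η (fun y => -f y) x := h.vd_focal hσ x X
  have h2 : inner ℝ (rot σ η (fun y => -f y) x) u = 0 := by
    have h3 := (h.focalPair hσ).inner_right_vd x X
    rw [h1, inner_add_right, inner_smul_right, (h.focalPair hσ).inner_right_right] at h3
    linarith
  clear_value u
  have h2' : inner ℝ u (rot σ η (fun y => -f y) x) = 0 := by rw [real_inner_comm, h2]
  have h3 : ‖vd E (rot σ f η) x X‖ ^ 2 = ‖u‖ ^ 2 + vd E σ x X ^ 2 := by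
    rw [h1, ← real_inner_self_eq_norm_sq, inner_add_left, inner_add_right, inner_add_right,
      inner_smul_left, inner_smul_left, inner_smul_right, inner_smul_right, h2,
      h2', (h.focalPair hσ).inner_right_right, real_inner_self_eq_norm_sq]
    simp only [conj_trivial]
    ring
  by_contra! hge
  set a := ‖vd E (rot σ f η) x X‖ with ha
  rw [hX] at h3
  have ha2 : 1 ≤ a ^ 2 := one_le_pow₀ hge
  -- Here a² = |u|² + a⁴, which for a ≥ 1 leaves no room for `u`. Then `X` is principal and h_* X =
  -- 0, contrary to a ≥ 1.
  have h4 : ‖u‖ ^ 2 ≤ 0 := by nlinarith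
  have h5 : u = 0 := by
    have : ‖u‖ = 0 := by nlinarith [norm_nonneg u]
    exact norm_eq_zero.1 this
  have h6 := (h.vd_focal_eq_zero_iff hσ hker x X).2 (hu.symm.trans h5)
  rw [ha, h6, norm_zero] at hge
  linarith

end GaussPair

end FocalPairs

/-! ### Descent of smoothness along submersions; the inverse function theorem. -/

section Submersions

variable {E E' : Type*} [NormedAddCommGroup E] [NormedSpace ℝ E] [FiniteDimensional ℝ E]
  [NormedAddCommGroup E'] [NormedSpace ℝ E'] [FiniteDimensional ℝ E']
  {N N' : Type*} [TopologicalSpace N] [ChartedSpace E N] [IsManifold 𝓘(ℝ, E) ∞ N]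
  [TopologicalSpace N'] [ChartedSpace E' N'] [IsManifold 𝓘(ℝ, E') ∞ N']
  {π : N → N'} (hπ : ContMDiff 𝓘(ℝ, E) 𝓘(ℝ, E') ∞ π)

theorem contMDiffOn_chart_comp (p : N') (hπ : ContMDiff 𝓘(ℝ, E) 𝓘(ℝ, E') ∞ π) :
    ContMDiffOn 𝓘(ℝ, E) 𝓘(ℝ, E') ∞ (fun y => chartAt E' p (π y)) (π ⁻¹' (chartAt E' p).source) :=
  (contMDiffOn_chart (x := p)).comp hπ.contMDiffOn fun _ hy => hy

theorem surjective_vd_chart_comp (hπ : ContMDiff 𝓘(ℝ, E) 𝓘(ℝ, E') ∞ π) {x : N}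
    (hs : Function.Surjective (mfderiv 𝓘(ℝ, E) 𝓘(ℝ, E') π x)) :
    Function.Surjective (vd E (fun y => chartAt E' (π x) (π y)) x) := by
  have := isManifold_one (E := E') (N := N')
  have h1 := (mdifferentiable_chart (I := 𝓘(ℝ, E')) (π x)).mfderiv_surjective
    (mem_chart_source E' (π x))
  have h2 : ∀ X, vd E (fun y => chartAt E' (π x) (π y)) x X =
      vd E' (chartAt E' (π x)) (π x) (mfderiv 𝓘(ℝ, E) 𝓘(ℝ, E') π x X) := fun X =>
    vd_comp ((mdifferentiable_chart (I := 𝓘(ℝ, E')) (π x)).mdifferentiableAt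
      (mem_chart_source E' (π x))) (mdifferentiableAt_of_contMDiffAt (hπ x)) X
  intro Y
  obtain ⟨Z, hZ⟩ := h1 Y
  obtain ⟨X, hX⟩ := hs Z
  exact ⟨X, (h2 X).trans ((congrArg (vd E' (chartAt E' (π x)) (π x)) hX).trans hZ)⟩

include hπ in
/-- A map whose composition with a surjective submersion is smooth is smooth. -/
theorem contMDiff_of_comp_submersion {d : ℕ}
    (hd : Module.finrank ℝ E = Module.finrank ℝ E' + d) (hsurj : Function.Surjective π)
    (hs : ∀ x, Function.Surjective (mfderiv 𝓘(ℝ, E) 𝓘(ℝ, E') π x))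
    {F : Type*} [NormedAddCommGroup F] [NormedSpace ℝ F] {g : N' → F}
    (hg : ContMDiff 𝓘(ℝ, E) 𝓘(ℝ, F) ∞ (fun x => g (π x))) : ContMDiff 𝓘(ℝ, E') 𝓘(ℝ, F) ∞ g := by
  intro p
  obtain ⟨x, rfl⟩ := hsurj p
  obtain ⟨e, r, hx, heU, heu, -, hes, hr, het⟩ := exists_submersion_box (Euc d) (by simpa using hd)
    ((chartAt E' (π x)).open_source.preimage hπ.continuous) (contMDiffOn_chart_comp (π x) hπ)
    (mem_chart_source E' (π x)) (surjective_vd_chart_comp hπ (hs x))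
  set φ := chartAt E' (π x) with hφ
  have hmem : (φ (π x), (e x).2) ∈ e.target := by
    rw [het]
    exact ⟨Metric.mem_ball_self hr, Metric.mem_ball_self hr⟩
  have hφs : ContMDiffAt 𝓘(ℝ, E') 𝓘(ℝ, E' × Euc d) ∞ (fun p => (φ p, (e x).2)) (π x) :=
    (contMDiffOn_chart.contMDiffAt (chart_source_mem_nhds E' (π x))).prodMk_space contMDiffAt_const
  -- Freezing the second box coordinate gives a smooth local section of `π`; `g` is `g ∘ π` composed
  -- with it.
  have h1 : ContMDiffAt 𝓘(ℝ, E') 𝓘(ℝ, F) ∞ (fun p => g (π (e.symm (φ p, (e x).2)))) (π x) :=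
    ContMDiffAt.comp (f := fun p => e.symm (φ p, (e x).2)) (g := fun y => g (π y)) (π x) (hg _)
      (ContMDiffAt.comp (f := fun p => (φ p, (e x).2)) (g := e.symm) (π x)
      (hes.contMDiffAt (e.open_target.mem_nhds hmem)) hφs)
  refine h1.congr_of_eventuallyEq ?_
  filter_upwards [chart_source_mem_nhds E' (π x),
    hφs.continuousAt.eventually (e.open_target.mem_nhds hmem)] with p hp1 hp2
  have h2 := heu _ (e.map_target hp2)
  rw [e.right_inv hp2] at h2
  have h3 := congrArg φ.symm h2
  have h4 : φ.symm (φ p) = p := φ.left_inv hp1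
  have h5 : φ.symm (φ (π (e.symm (φ p, (e x).2)))) = π (e.symm (φ p, (e x).2)) :=
    φ.left_inv (heU (e.map_target hp2))
  exact congrArg g (h4.symm.trans (h3.trans h5))

include hπ in
/-- The inverse function theorem on manifolds. -/
theorem isLocalDiffeomorph_of_bijective_mfderiv
    (hd : Module.finrank ℝ E = Module.finrank ℝ E')
    (hs : ∀ x, Function.Surjective (mfderiv 𝓘(ℝ, E) 𝓘(ℝ, E') π x)) :
    IsLocalDiffeomorph 𝓘(ℝ, E) 𝓘(ℝ, E') ∞ π := by
  intro x
  -- In equal dimensions the complementary factor is the one-point space `Euc 0`, so the box chart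
  -- is π itself read in a chart.
  obtain ⟨e, r, hx, heU, heu, hec, hes, hr, het⟩ := exists_submersion_box (Euc 0) (by simpa using hd)
    ((chartAt E' (π x)).open_source.preimage hπ.continuous) (contMDiffOn_chart_comp (π x) hπ)
    (mem_chart_source E' (π x)) (surjective_vd_chart_comp hπ (hs x))
  set φ := chartAt E' (π x) with hφ
  let κ : (E' × Euc 0) ≃L[ℝ] E' := ContinuousLinearEquiv.ofFinrankEq (by simp)
  have hmk : ∀ y ∈ e.source, e y = (φ (π y), 0) := fun y hy =>
    Prod.ext (heu y hy) (Subsingleton.elim _ _)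
  let ψ : OpenPartialHomeomorph (E' × Euc 0) E' :=
    { toFun := fun a => a.1
      invFun := fun b => (b, 0)
      source := univ
      target := univ
      map_source' := fun _ _ => mem_univ _
      map_target' := fun _ _ => mem_univ _
      left_inv' := fun a _ => Prod.ext rfl (Subsingleton.elim _ _)
      right_inv' := fun b _ => rfl
      open_source := isOpen_univ
      open_target := isOpen_univ
      continuousOn_toFun := continuous_fst.continuousOn
      continuousOn_invFun := (continuous_id.prodMk continuous_const).continuousOn }
  let c := (e.trans ψ).trans φ.symm
  have hcs : ∀ y, y ∈ c.source ↔ y ∈ e.source ∧ (e y).1 ∈ φ.target := by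
    intro y
    simp [c, ψ]
  have hct : ∀ p, p ∈ c.target ↔ p ∈ φ.source ∧ (φ p, 0) ∈ e.target := by
    intro p
    simp [c, ψ]
  refine ⟨{ toPartialEquiv := c.toPartialEquiv
            open_source := c.open_source
            open_target := c.open_target
            contMDiffOn_toFun := ?_
            contMDiffOn_invFun := ?_ }, ?_, ?_⟩
  · have h1 : ContMDiffOn 𝓘(ℝ, E) 𝓘(ℝ, E') ∞ (fun y => φ.symm ((e y).1)) c.source :=
      (contMDiffOn_chart_symm (x := π x)).comp
        ((contDiff_fst.contMDiff (E := E' × Euc 0)).comp_contMDiffOn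
          (hec.mono fun y hy => ((hcs y).1 hy).1)) fun y hy => ((hcs y).1 hy).2
    exact h1
  · have h1 : ContMDiffOn 𝓘(ℝ, E') 𝓘(ℝ, E) ∞ (fun p => e.symm (φ p, (0 : Euc 0))) c.target :=
      hes.comp (((contMDiffOn_chart (x := π x)).mono fun p hp => ((hct p).1 hp).1).prodMk_space
        contMDiffOn_const) fun p hp => ((hct p).1 hp).2
    exact h1
  · refine (hcs x).2 ⟨hx, ?_⟩
    rw [heu x hx]
    exact φ.map_source (mem_chart_source _ _)
  · intro y hy
    have h1 := ((hcs y).1 hy).1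
    have h2 : φ.symm (e y).1 = π y := by
      rw [heu y h1]
      exact φ.left_inv (heU h1)
    exact h2.symm

end Submersions

/-! ### The tube map over the unit normal bundle (converse part). -/

section Tube

variable {m l n : ℕ} {L : Type*} [TopologicalSpace L] [ChartedSpace (Euc m) L]
  {g : L → Euc (n + 2)} {τ : L → ℝ}

/-- An immersion into the unit sphere with a radius function of gradient less than one. -/
structure TubeData (m : ℕ) {n : ℕ} {L : Type*} [TopologicalSpace L] [ChartedSpace (Euc m) L]
    (g : L → Euc (n + 2)) (τ : L → ℝ) : Prop where
  contMDiff_map : ContMDiff 𝓘(ℝ, Euc m) 𝓘(ℝ, Euc (n + 2)) ∞ g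
  contMDiff_radius : ContMDiff 𝓘(ℝ, Euc m) 𝓘(ℝ, ℝ) ∞ τ
  injective_vd : ∀ p, Function.Injective (vd (Euc m) g p)
  inner_self : ∀ p, inner ℝ (g p) (g p) = (1 : ℝ)
  radius_pos : ∀ p, 0 < τ p
  radius_lt : ∀ p, τ p < Real.pi / 2
  gradient_lt : ∀ p, ‖pushGradient m g τ p‖ < 1

/-- The unit vector field `g_* ∇τ + √(1 - ‖∇τ‖²) w` along the unit normal bundle. -/
def conormal (g : L → Euc (n + 2)) (τ : L → ℝ) (q : UnitNormalBundle m g) : Euc (n + 2) :=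
  pushGradient m g τ q.base + Real.sqrt (1 - ‖pushGradient m g τ q.base‖ ^ 2) • q.vec

/-- The normal field of the tube map. -/
def tubeNormal (g : L → Euc (n + 2)) (τ : L → ℝ) (q : UnitNormalBundle m g) : Euc (n + 2) :=
  rot (fun q : UnitNormalBundle m g => τ q.base) (conormal g τ) (fun q => g q.base) q

namespace TubeData

variable (h : TubeData m g τ)
include h

theorem one_sub_pos (p : L) : 0 < 1 - ‖pushGradient m g τ p‖ ^ 2 := by
  have h1 := h.gradient_lt p
  have h2 := norm_nonneg (pushGradient m g τ p)
  nlinarith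

theorem inner_position_vd (p : L) (Y : Euc m) : inner ℝ (g p) (vd (Euc m) g p Y) = 0 :=
  inner_vd_self h.contMDiff_map h.inner_self p Y

theorem inner_position_gradient (p : L) : inner ℝ (g p) (pushGradient m g τ p) = 0 := by
  obtain ⟨G, hG⟩ := pushGradient_mem_range (m := m) (g := g) (τ := τ) p
  rw [← hG, h.inner_position_vd]

omit h in
theorem inner_vec_gradient (q : UnitNormalBundle m g) :
    inner ℝ q.vec (pushGradient m g τ q.base) = (0 : ℝ) := by
  obtain ⟨G, hG⟩ := pushGradient_mem_range (m := m) (g := g) (τ := τ) q.base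
  rw [← hG]
  exact (isUnitNormal_vec q).2.2 G

omit h in
theorem inner_gradient_conormal (q : UnitNormalBundle m g) :
    inner ℝ (pushGradient m g τ q.base) (conormal g τ q) =
      ‖pushGradient m g τ q.base‖ ^ 2 := by
  rw [conormal, inner_add_right, inner_smul_right, real_inner_self_eq_norm_sq, real_inner_comm,
    inner_vec_gradient, mul_zero, add_zero]

theorem inner_conormal_self (q : UnitNormalBundle m g) :
    inner ℝ (conormal g τ q) (conormal g τ q) = (1 : ℝ) := by
  have hv : inner ℝ q.vec q.vec = (1 : ℝ) := by
    rw [real_inner_self_eq_norm_sq, (isUnitNormal_vec q).1, one_pow]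
  have h1 := inner_vec_gradient (τ := τ) q
  have h2 : inner ℝ (pushGradient m g τ q.base) q.vec = (0 : ℝ) := by rw [real_inner_comm, h1]
  have h3 := Real.mul_self_sqrt (h.one_sub_pos q.base).le
  rw [conormal, inner_add_left, inner_add_right, inner_add_right, inner_smul_left, inner_smul_left,
    inner_smul_right, inner_smul_right, hv, h1, h2, real_inner_self_eq_norm_sq]
  simp only [conj_trivial]
  linarith

theorem inner_conormal_position (q : UnitNormalBundle m g) :
    inner ℝ (conormal g τ q) (g q.base) = (0 : ℝ) := by
  rw [conormal, inner_add_left, inner_smul_left, (isUnitNormal_vec q).2.1, real_inner_comm,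
    h.inner_position_gradient]
  simp

theorem inner_conormal_vd (q : UnitNormalBundle m g) (Y : Euc m) :
    inner ℝ (conormal g τ q) (vd (Euc m) g q.base Y) = vd (Euc m) τ q.base Y := by
  rw [conormal, inner_add_left, inner_smul_left, (isUnitNormal_vec q).2.2,
    inner_pushGradient (h.injective_vd _)]
  simp

/-- The conormal is a unit vector and τ > 0, so the argument of the exponential has norm τ and the
quotient in `sphereExp` cancels it. -/
theorem tubeMap_eq_rot : tubeMap m g τ = rot (fun q : UnitNormalBundle m g => τ q.base)
    (fun q => g q.base) (fun q => -conormal g τ q) := by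
  funext q
  have hn : ‖conormal g τ q‖ = 1 := by
    have h1 := h.inner_conormal_self q
    rw [real_inner_self_eq_norm_sq] at h1
    nlinarith [norm_nonneg (conormal g τ q)]
  have hτ := h.radius_pos q.base
  show sphereExp (g q.base) (-(τ q.base) • conormal g τ q) = _
  rw [sphereExp, norm_smul, hn, mul_one, norm_neg, Real.norm_of_nonneg hτ.le, smul_smul, rot,
    mul_neg, div_mul_cancel₀ _ hτ.ne', smul_neg, neg_smul]

variable [ChartedSpace (Euc n) (UnitNormalBundle m g)] (hΛ : IsNormalBundleManifold m g n)

omit h in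
include hΛ in
theorem contMDiff_base : ContMDiff 𝓘(ℝ, Euc n) 𝓘(ℝ, Euc m) ∞
    (UnitNormalBundle.base : UnitNormalBundle m g → L) :=
  contMDiff_fst.comp hΛ.contMDiff_incl

omit h in
include hΛ in
theorem contMDiff_vec : ContMDiff 𝓘(ℝ, Euc n) 𝓘(ℝ, Euc (n + 2)) ∞
    (UnitNormalBundle.vec : UnitNormalBundle m g → Euc (n + 2)) :=
  contMDiff_snd.comp hΛ.contMDiff_incl

variable [IsManifold (𝓡 m) ∞ L]

omit [ChartedSpace (Euc n) (UnitNormalBundle m g)] in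
theorem contMDiff_pushGradient : ContMDiff 𝓘(ℝ, Euc m) 𝓘(ℝ, Euc (n + 2)) ∞ (pushGradient m g τ) :=
  SphereHyp.contMDiff_pushGradient h.contMDiff_map h.injective_vd h.contMDiff_radius

omit [ChartedSpace (Euc n) (UnitNormalBundle m g)] in
theorem contMDiff_sqrt : ContMDiff 𝓘(ℝ, Euc m) 𝓘(ℝ, ℝ) ∞
    (fun p => Real.sqrt (1 - ‖pushGradient m g τ p‖ ^ 2)) := by
  intro p
  have h1 : ContDiffAt ℝ ∞ (fun v : Euc (n + 2) => Real.sqrt (1 - ‖v‖ ^ 2))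
      (pushGradient m g τ p) :=
    (contDiffAt_const.sub (contDiffAt_id.norm_sq ℝ)).sqrt (h.one_sub_pos p).ne'
  exact ContMDiffAt.comp (g := fun v : Euc (n + 2) => Real.sqrt (1 - ‖v‖ ^ 2)) p h1.contMDiffAt (h.contMDiff_pushGradient p)

-- The summand along `w` is normal to `g`, so ⟨conormal, g_* Y⟩ = ⟨∇τ, Y⟩ = dτ(Y): this choice of
-- conormal is what makes the rotated pair a hypersurface with normal.
include hΛ in
theorem focalPair : FocalPair (Euc n) (fun q : UnitNormalBundle m g => g q.base) (conormal g τ)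
    (fun q => τ q.base) where
  contMDiff_left := h.contMDiff_map.comp (contMDiff_base hΛ)
  contMDiff_right := (h.contMDiff_pushGradient.comp (contMDiff_base hΛ)).add
    ((h.contMDiff_sqrt.comp (contMDiff_base hΛ)).smul (contMDiff_vec hΛ))
  contMDiff_fun := h.contMDiff_radius.comp (contMDiff_base hΛ)
  inner_left_left q := h.inner_self q.base
  inner_right_right := h.inner_conormal_self
  inner_right_left := h.inner_conormal_position
  inner_right_vd q X := by
    rw [vd_comp (mdifferentiableAt_of_contMDiffAt (h.contMDiff_map _))
      (mdifferentiableAt_of_contMDiffAt (contMDiff_base hΛ q)),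
      vd_comp (mdifferentiableAt_of_contMDiffAt (h.contMDiff_radius _))
      (mdifferentiableAt_of_contMDiffAt (contMDiff_base hΛ q))]
    exact h.inner_conormal_vd q _

include hΛ in
theorem gaussPair : GaussPair (Euc n) (tubeMap m g τ) (tubeNormal g τ) := by
  rw [h.tubeMap_eq_rot]
  exact (h.focalPair hΛ).gaussPair

include hΛ in
/-- The principal distribution of the tube for `cot τ` is tangent to the fibres. -/
theorem cos_smul_add_sin_smul_eq_zero_iff (q : UnitNormalBundle m g) (X : Euc n) :
    Real.cos (τ q.base) • vd (Euc n) (tubeMap m g τ) q X +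
      Real.sin (τ q.base) • vd (Euc n) (tubeNormal g τ) q X = 0 ↔
    mfderiv (𝓡 n) (𝓡 m) (UnitNormalBundle.base : UnitNormalBundle m g → L) q X = 0 := by
  have h1 := (h.focalPair hΛ).cos_smul_add_sin_smul q X
  rw [← h.tubeMap_eq_rot] at h1
  have h2 := vd_comp (mdifferentiableAt_of_contMDiffAt (h.contMDiff_map _))
      (mdifferentiableAt_of_contMDiffAt (contMDiff_base hΛ q)) X
  have h3 := vd_comp (mdifferentiableAt_of_contMDiffAt (h.contMDiff_radius _))
      (mdifferentiableAt_of_contMDiffAt (contMDiff_base hΛ q)) X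
  rw [h2, h3] at h1
  set Y : Euc m := mfderiv (𝓡 n) (𝓡 m) (UnitNormalBundle.base : UnitNormalBundle m g → L) q X
    with hY
  rw [show Real.cos (τ q.base) • vd (Euc n) (tubeMap m g τ) q X +
      Real.sin (τ q.base) • vd (Euc n) (tubeNormal g τ) q X =
      vd (Euc m) g q.base Y - vd (Euc m) τ q.base Y • conormal g τ q from h1]
  constructor
  · intro h4
    have h5 := sub_eq_zero.1 h4
    -- From g_* Y = dτ(Y) ξ, pairing with ∇τ gives dτ(Y) = dτ(Y) ‖∇τ‖². Hence dτ(Y) = 0, then g_* Y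
    -- = 0 and Y = 0.
    have h6 := inner_pushGradient (τ := τ) (h.injective_vd q.base) Y
    rw [h5, inner_smul_right, inner_gradient_conormal] at h6
    have h7 : vd (Euc m) τ q.base Y = 0 := by
      have h8 : vd (Euc m) τ q.base Y * (1 - ‖pushGradient m g τ q.base‖ ^ 2) = 0 := by linarith
      exact (mul_eq_zero.1 h8).resolve_right (h.one_sub_pos q.base).ne'
    rw [h7, zero_smul] at h5
    exact h.injective_vd q.base (h5.trans (map_zero _).symm)
  · intro h4
    have h5 : Y = 0 := h4
    rw [h5, map_zero, map_zero, zero_smul, sub_zero]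

end TubeData

variable [IsManifold (𝓡 m) ∞ L]

theorem TubeData.exists_bundle_charts (h : TubeData m g τ) (hn : n = m + l) :
    ∃ c : UnitNormalBundle m g → OpenPartialHomeomorph (UnitNormalBundle m g) (Euc n),
      SmoothChartsAlong ((𝓡 m).prod 𝓘(ℝ, Euc (n + 2))) (bundleIncl (m := m) (g := g)) c ∧
      ∀ q : UnitNormalBundle m g, ∃ s : L → UnitNormalBundle m g, ContinuousAt s q.base ∧
        s q.base = q ∧
        ContMDiffAt (𝓡 m) ((𝓡 m).prod 𝓘(ℝ, Euc (n + 2))) ∞ (fun p => bundleIncl (s p)) q.base ∧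
        ∀ᶠ p in 𝓝 q.base, (s p).base = p := by
  choose c h1 h2 h3 h4 using fun q => exists_bundle_chart (n := n) (l := l) h.contMDiff_map
    h.injective_vd h.inner_self (by omega) hn q
  exact ⟨c, ⟨h1, h2, h3⟩, h4⟩

omit [IsManifold (𝓡 m) ∞ L] in
theorem SmoothChartsAlong.isNormalBundleManifold
    {c : UnitNormalBundle m g → OpenPartialHomeomorph (UnitNormalBundle m g) (Euc n)}
    (hc : SmoothChartsAlong ((𝓡 m).prod 𝓘(ℝ, Euc (n + 2))) (bundleIncl (m := m) (g := g)) c) :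
    letI := chartedSpaceOfCharts c hc.mem_source
    IsNormalBundleManifold m g n :=
  letI := chartedSpaceOfCharts c hc.mem_source
  ⟨hc.isManifold, hc.contMDiff, hc.injective_mfderiv⟩

/-- The set where a smooth map is immersive is open. -/
theorem isOpen_setOf_injective_vd {E F N : Type*} [NormedAddCommGroup E] [NormedSpace ℝ E]
    [FiniteDimensional ℝ E] [NormedAddCommGroup F] [NormedSpace ℝ F] [FiniteDimensional ℝ F]
    [TopologicalSpace N] [ChartedSpace E N] [IsManifold 𝓘(ℝ, E) ∞ N] {f : N → F}
    (hf : ContMDiff 𝓘(ℝ, E) 𝓘(ℝ, F) ∞ f) : IsOpen {x | Function.Injective (vd E f x)} := by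
  rw [isOpen_iff_mem_nhds]
  intro x hx
  set φ := chartAt E x with hφ
  have hfs : ContDiffOn ℝ ∞ (f ∘ φ.symm) φ.target := by
    simpa using contDiffOn_comp_chart_symm (hf.contMDiffOn (s := univ)) x
  have hiff : ∀ y ∈ φ.source,
      (Function.Injective (vd E f y) ↔ Function.Injective (fderiv ℝ (f ∘ φ.symm) (φ y))) := by
    intro y hy
    have hz := φ.map_source hy
    have hb := chartSymmDeriv_bijective hz
    have h1 : ⇑(fderiv ℝ (f ∘ φ.symm) (φ y)) = vd E f y ∘ chartSymmDeriv x (φ y) := by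
      funext X
      rw [fderiv_chart hz (mdifferentiableAt_of_contMDiffAt (hf _)), φ.left_inv hy]
      rfl
    rw [h1, Function.Injective.of_comp_iff' _ hb]
  have hopen := isOpen_inter_injective φ.open_target
    (hfs.continuousOn_fderiv_of_isOpen φ.open_target (by exact_mod_cast le_top))
  have hxs := mem_chart_source E x
  filter_upwards [φ.open_source.mem_nhds hxs,
    (φ.continuousAt hxs).eventually (hopen.mem_nhds ⟨φ.map_source hxs, (hiff x hxs).1 hx⟩)]
    with y hy1 hy2
  exact (hiff y hy1).2 hy2.2

/-- The tube around an immersed submanifold has a principal curvature of constant multiplicity. -/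
theorem TubeData.exists_tube_hypersurface (h : TubeData m g τ) (hn : n = m + l) :
    ∃ _ : ChartedSpace (Euc n) (UnitNormalBundle m g),
      IsNormalBundleManifold m g n ∧ IsOpen (regularSet m g τ n) ∧
      IsSphereImmersionOn n (tubeMap m g τ) (regularSet m g τ n) ∧
      ∃ η : UnitNormalBundle m g → Euc (n + 2),
        IsGaussMapOn n (tubeMap m g τ) η (regularSet m g τ n) ∧
        IsPrincipalCurvatureOn n (tubeMap m g τ) η (fun q => Real.cot (τ q.base)) l
          (regularSet m g τ n) := by
  obtain ⟨c, hc, hsec⟩ := h.exists_bundle_charts hn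
  let inst := chartedSpaceOfCharts c hc.mem_source
  have hΛ : IsNormalBundleManifold m g n := hc.isNormalBundleManifold
  have := hΛ.isManifold
  have hG := h.gaussPair hΛ
  refine ⟨inst, hΛ, isOpen_setOf_injective_vd hG.contMDiff_left,
    ⟨hG.contMDiff_left.contMDiffOn, fun q _ => ?_, fun q hq => hq⟩, tubeNormal g τ,
    ⟨hG.contMDiff_right.contMDiffOn, fun q _ => ?_, fun q _ => hG.inner_right_left q,
      fun q _ X => hG.inner_right_vd q X⟩, ⟨?_, fun q hq => ?_⟩⟩
  · have h1 := hG.inner_left_left q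
    rw [real_inner_self_eq_norm_sq] at h1
    nlinarith [norm_nonneg (tubeMap m g τ q)]
  · have h1 := hG.inner_right_right q
    rw [real_inner_self_eq_norm_sq] at h1
    nlinarith [norm_nonneg (tubeNormal g τ q)]
  · have h1 : Continuous fun q : UnitNormalBundle m g => τ q.base :=
      h.contMDiff_radius.continuous.comp continuous_base
    have h2 : Continuous fun q : UnitNormalBundle m g =>
        Real.cos (τ q.base) / Real.sin (τ q.base) :=
      (Real.continuous_cos.comp h1).div (Real.continuous_sin.comp h1) fun q =>
        (Real.sin_pos_of_pos_of_lt_pi (h.radius_pos _)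
          (by linarith [h.radius_lt q.base, Real.pi_pos])).ne'
    simp only [Real.cot_eq_cos_div_sin]
    exact h2.continuousOn
  · rw [principalSpace_eq_ker hG _ hq]
    let B' : Euc n →L[ℝ] Euc m :=
      mfderiv (𝓡 n) (𝓡 m) (UnitNormalBundle.base : UnitNormalBundle m g → L) q
    set B : Euc n →ₗ[ℝ] Euc m := B'.toLinearMap with hB
    have hker : (vd (Euc n) (tubeNormal g τ) q +
        (fun q : UnitNormalBundle m g => Real.cot (τ q.base)) q •
          vd (Euc n) (tubeMap m g τ) q).ker = B.ker := by
      ext X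
      refine Iff.trans ?_ (h.cos_smul_add_sin_smul_eq_zero_iff hΛ q X)
      exact principal_iff_cos_sin (σ := fun q : UnitNormalBundle m g => τ q.base)
        (lam := fun q : UnitNormalBundle m g => Real.cot (τ q.base)) (fun q => h.radius_pos q.base)
        (fun q => h.radius_lt q.base) (fun q => rfl) q _ _
    -- A smooth local section through `q` is a right inverse of the base projection, so its
    -- differential is onto and the vertical space has dimension n − m = l.
    have hBs : Function.Surjective B := by
      obtain ⟨s, hs1, hs2, hs3, hs4⟩ := hsec q
      have hs5 : ContMDiffAt (𝓡 m) 𝓘(ℝ, Euc n) ∞ s q.base :=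
        hc.contMDiffAt_lift hs1 hs3
      have h1 : MDifferentiableAt (𝓡 n) (𝓡 m) (UnitNormalBundle.base : UnitNormalBundle m g → L)
          (s q.base) := mdifferentiableAt_of_contMDiffAt (TubeData.contMDiff_base hΛ _)
      have h2 := mfderiv_comp q.base h1 (mdifferentiableAt_of_contMDiffAt hs5)
      have h3 : (UnitNormalBundle.base : UnitNormalBundle m g → L) ∘ s =ᶠ[𝓝 q.base] id := hs4
      rw [h3.mfderiv_eq, mfderiv_id] at h2
      intro Y
      have h4 := DFunLike.congr_fun h2 Y
      refine ⟨mfderiv (𝓡 m) 𝓘(ℝ, Euc n) s q.base Y, ?_⟩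
      have h5 : (mfderiv (𝓡 n) (𝓡 m) (UnitNormalBundle.base : UnitNormalBundle m g → L) (s q.base) :
        Euc n →L[ℝ] Euc m) = mfderiv (𝓡 n) (𝓡 m)
          (UnitNormalBundle.base : UnitNormalBundle m g → L) q := by rw [hs2]
      exact (DFunLike.congr_fun h5 _).symm.trans h4.symm
    have hfin := B.finrank_range_add_finrank_ker
    rw [LinearMap.range_eq_top.2 hBs, finrank_top] at hfin
    simp only [finrank_euclideanSpace, Fintype.card_fin] at hfin
    refine (congrArg (fun S : Submodule ℝ (Euc n) => Module.finrank ℝ S) hker).trans ?_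
    show Module.finrank ℝ B.ker = l
    omega

end Tube

/-! ### The focal submanifold and the lift to its normal bundle. -/

section FocalSubmanifold

variable {m l n : ℕ} {N : Type*} [TopologicalSpace N] [ChartedSpace (Euc n) N]
  {L : Type*} [TopologicalSpace L] [ChartedSpace (Euc m) L]
  {f η : N → Euc (n + 2)} {σ : N → ℝ} {π : N → L} {g : L → Euc (n + 2)} {τ : L → ℝ}

/-- A hypersurface with radius function `σ` whose focal map has rank `m` and factors, together with
`σ`, through a submersion `π` onto an `m`-manifold. -/
structure FocalFactorization (m : ℕ) {n : ℕ} {N : Type*} [TopologicalSpace N]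
    [ChartedSpace (Euc n) N] {L : Type*} [TopologicalSpace L] [ChartedSpace (Euc m) L]
    (f η : N → Euc (n + 2)) (σ : N → ℝ) (π : N → L) (g : L → Euc (n + 2)) (τ : L → ℝ) :
    Prop where
  gaussPair : GaussPair (Euc n) f η
  injective_vd : ∀ x, Function.Injective (vd (Euc n) f x)
  contMDiff_sigma : ContMDiff 𝓘(ℝ, Euc n) 𝓘(ℝ, ℝ) ∞ σ
  sigma_pos : ∀ x, 0 < σ x
  sigma_lt : ∀ x, σ x < Real.pi / 2
  vd_sigma : ∀ x X, Real.cos (σ x) • vd (Euc n) f x X + Real.sin (σ x) • vd (Euc n) η x X = 0 →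
    vd (Euc n) σ x X = 0
  finrank_ker : ∀ x, Module.finrank ℝ (vd (Euc n) (rot σ f η) x).ker + m = n
  contMDiff_proj : ContMDiff 𝓘(ℝ, Euc n) 𝓘(ℝ, Euc m) ∞ π
  surjective_proj : Function.Surjective π
  surjective_mfderiv : ∀ x, Function.Surjective (mfderiv 𝓘(ℝ, Euc n) 𝓘(ℝ, Euc m) π x)
  focal_eq : ∀ x, rot σ f η x = g (π x)
  sigma_eq : ∀ x, σ x = τ (π x)

namespace FocalFactorization

variable [IsManifold 𝓘(ℝ, Euc n) ∞ N] [IsManifold 𝓘(ℝ, Euc m) ∞ L]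
  (h : FocalFactorization m f η σ π g τ) (hn : n = m + l)
include h hn

theorem contMDiff_map : ContMDiff 𝓘(ℝ, Euc m) 𝓘(ℝ, Euc (n + 2)) ∞ g := by
  refine contMDiff_of_comp_submersion h.contMDiff_proj (d := l) (by simpa using hn)
    h.surjective_proj h.surjective_mfderiv ?_
  rw [← funext h.focal_eq]
  exact (h.gaussPair.focalPair h.contMDiff_sigma).contMDiff_left

theorem contMDiff_radius : ContMDiff 𝓘(ℝ, Euc m) 𝓘(ℝ, ℝ) ∞ τ := by
  refine contMDiff_of_comp_submersion h.contMDiff_proj (d := l) (by simpa using hn)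
    h.surjective_proj h.surjective_mfderiv ?_
  rw [← funext h.sigma_eq]
  exact h.contMDiff_sigma

theorem vd_focal (x : N) (X : Euc n) : vd (Euc n) (rot σ f η) x X =
    vd (Euc m) g (π x) (mfderiv 𝓘(ℝ, Euc n) 𝓘(ℝ, Euc m) π x X) := by
  rw [funext h.focal_eq]
  exact vd_comp (mdifferentiableAt_of_contMDiffAt (h.contMDiff_map hn _))
    (mdifferentiableAt_of_contMDiffAt (h.contMDiff_proj x)) X

theorem vd_sigma_eq (x : N) (X : Euc n) : vd (Euc n) σ x X =
    vd (Euc m) τ (π x) (mfderiv 𝓘(ℝ, Euc n) 𝓘(ℝ, Euc m) π x X) := by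
  rw [funext h.sigma_eq]
  exact vd_comp (mdifferentiableAt_of_contMDiffAt (h.contMDiff_radius hn _))
    (mdifferentiableAt_of_contMDiffAt (h.contMDiff_proj x)) X

/-- The inclusion of ker π_* in ker h_* is an equality: the first has dimension at least n − m, the
second exactly that. So g_* Y = 0 forces any lift of `Y` into ker π_*. -/
theorem injective_vd_map (p : L) : Function.Injective (vd (Euc m) g p) := by
  obtain ⟨x, rfl⟩ := h.surjective_proj p
  let B : Euc n →L[ℝ] Euc m := mfderiv 𝓘(ℝ, Euc n) 𝓘(ℝ, Euc m) π x
  have hle : B.ker ≤ (vd (Euc n) (rot σ f η) x).ker := by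
    intro X hX
    have hX' : mfderiv 𝓘(ℝ, Euc n) 𝓘(ℝ, Euc m) π x X = 0 := hX
    show vd (Euc n) (rot σ f η) x X = 0
    rw [h.vd_focal hn, hX']
    exact map_zero (vd (Euc m) g (π x))
  have hfin : Module.finrank ℝ (vd (Euc n) (rot σ f η) x).ker ≤ Module.finrank ℝ B.ker := by
    have h1 := (B : Euc n →ₗ[ℝ] Euc m).finrank_range_add_finrank_ker
    have h2 := (B : Euc n →ₗ[ℝ] Euc m).finrank_range_le
    have h3 := h.finrank_ker x
    have h4 : Module.finrank ℝ (B : Euc n →ₗ[ℝ] Euc m).range ≤ m := by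
      simpa using Submodule.finrank_le (B : Euc n →ₗ[ℝ] Euc m).range
    simp only [finrank_euclideanSpace, Fintype.card_fin] at h1
    omega
  have heq := Submodule.eq_of_le_of_finrank_le hle hfin
  rw [injective_iff_map_eq_zero]
  intro Y hY
  obtain ⟨X, hX⟩ : ∃ X : Euc n, B X = Y := h.surjective_mfderiv x Y
  have h1 : X ∈ (vd (Euc n) (rot σ f η) x).ker :=
    ((h.vd_focal hn x X).trans (congrArg (vd (Euc m) g (π x)) hX)).trans hY
  rw [← heq] at h1
  exact hX.symm.trans h1

theorem tubeData : TubeData m g τ where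
  contMDiff_map := h.contMDiff_map hn
  contMDiff_radius := h.contMDiff_radius hn
  injective_vd := h.injective_vd_map hn
  inner_self p := by
    obtain ⟨x, rfl⟩ := h.surjective_proj p
    rw [← h.focal_eq]
    exact (h.gaussPair.focalPair h.contMDiff_sigma).inner_left_left x
  radius_pos p := by
    obtain ⟨x, rfl⟩ := h.surjective_proj p
    exact h.sigma_eq x ▸ h.sigma_pos x
  radius_lt p := by
    obtain ⟨x, rfl⟩ := h.surjective_proj p
    exact h.sigma_eq x ▸ h.sigma_lt x
  gradient_lt p := by
    obtain ⟨x, rfl⟩ := h.surjective_proj p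
    obtain ⟨G, hG⟩ := pushGradient_mem_range (m := m) (g := g) (τ := τ) (π x)
    -- Lift ∇τ to `X` on the hypersurface. Then h_* X = g_*∇τ and dσ(X) = dτ(∇τ) = ‖h_* X‖², the
    -- situation of `norm_vd_focal_lt_one`.
    obtain ⟨X, hX⟩ := h.surjective_mfderiv x G
    have h1 := h.vd_focal hn x X
    have h2 := h.vd_sigma_eq hn x X
    rw [hX] at h1 h2
    have h3 : vd (Euc n) (rot σ f η) x X = pushGradient m g τ (π x) := h1.trans hG
    rw [← h3]
    refine h.gaussPair.norm_vd_focal_lt_one h.contMDiff_sigma h.vd_sigma x X ?_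
    rw [h2, h3, ← inner_pushGradient (h.injective_vd_map hn (π x)), hG, real_inner_self_eq_norm_sq]

/-- The unit normal vector of the focal submanifold which corresponds to a point. -/
theorem exists_isUnitNormal (x : N) : IsUnitNormal m g (π x)
    ((Real.sqrt (1 - ‖pushGradient m g τ (π x)‖ ^ 2))⁻¹ •
      (rot σ η (fun y => -f y) x - pushGradient m g τ (π x))) := by
  have hT := h.tubeData hn
  have hF := h.gaussPair.focalPair h.contMDiff_sigma
  set P := pushGradient m g τ (π x) with hP
  set ξ := rot σ η (fun y => -f y) x with hξ
  have hpos := hT.one_sub_pos (π x)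
  have hξvd : ∀ Y, inner ℝ ξ (vd (Euc m) g (π x) Y) = vd (Euc m) τ (π x) Y := by
    intro Y
    obtain ⟨X, hX⟩ := h.surjective_mfderiv x Y
    have h1 := h.vd_focal hn x X
    have h2 := h.vd_sigma_eq hn x X
    rw [hX] at h1 h2
    exact (congrArg (inner ℝ ξ) h1).symm.trans ((hF.inner_right_vd x X).trans h2)
  have hξP : inner ℝ ξ P = ‖P‖ ^ 2 := by
    obtain ⟨G, hG⟩ := pushGradient_mem_range (m := m) (g := g) (τ := τ) (π x)
    rw [hP, ← hG, hξvd, ← inner_pushGradient (hT.injective_vd (π x)), hG,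
      real_inner_self_eq_norm_sq]
  have hξξ : inner ℝ ξ ξ = (1 : ℝ) := hF.inner_right_right x
  -- P is the orthogonal projection of the unit vector ξ to the tangent space of `g`; the residue
  -- has exactly the length by which it is divided.
  have hn2 : ‖ξ - P‖ ^ 2 = 1 - ‖P‖ ^ 2 := by
    rw [norm_sub_sq_real, hξP, ← real_inner_self_eq_norm_sq ξ, hξξ]
    ring
  have hns : ‖ξ - P‖ = Real.sqrt (1 - ‖P‖ ^ 2) := by
    rw [← hn2, Real.sqrt_sq (norm_nonneg _)]
  refine ⟨?_, ?_, fun Y => ?_⟩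
  · rw [norm_smul, norm_inv, hns, Real.norm_of_nonneg (Real.sqrt_nonneg _),
      inv_mul_cancel₀ (Real.sqrt_pos.2 hpos).ne']
  · have h1 : inner ℝ ξ (g (π x)) = (0 : ℝ) := by
      rw [← h.focal_eq]
      exact hF.inner_right_left x
    have h2 : inner ℝ P (g (π x)) = (0 : ℝ) := by
      rw [real_inner_comm]
      exact hT.inner_position_gradient (π x)
    rw [inner_smul_left, inner_sub_left, h1, h2, sub_zero, mul_zero]
  · rw [inner_smul_left, inner_sub_left, hξvd, inner_pushGradient (hT.injective_vd (π x)),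
      sub_self, mul_zero]

/-- The hypersurface is locally parametrized by the tube over its focal submanifold. -/
theorem exists_lift {c : UnitNormalBundle m g → OpenPartialHomeomorph (UnitNormalBundle m g) (Euc n)}
    (hc : SmoothChartsAlong ((𝓡 m).prod 𝓘(ℝ, Euc (n + 2))) (bundleIncl (m := m) (g := g)) c) :
    letI := chartedSpaceOfCharts c hc.mem_source
    ∃ j : N → UnitNormalBundle m g, IsLocalDiffeomorph (𝓡 n) (𝓡 n) ∞ j ∧
      (∀ x, f x = tubeMap m g τ (j x)) ∧ ∀ x, (j x).base = π x := by
  let inst := chartedSpaceOfCharts c hc.mem_source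
  have hΛ : IsNormalBundleManifold m g n := hc.isNormalBundleManifold
  have := hΛ.isManifold
  have hT := h.tubeData hn
  have hF := h.gaussPair.focalPair h.contMDiff_sigma
  let w : N → Euc (n + 2) := fun x => (Real.sqrt (1 - ‖pushGradient m g τ (π x)‖ ^ 2))⁻¹ •
      (rot σ η (fun y => -f y) x - pushGradient m g τ (π x))
  have hpos : ∀ x, Real.sqrt (1 - ‖pushGradient m g τ (π x)‖ ^ 2) ≠ 0 := fun x =>
    (Real.sqrt_pos.2 (hT.one_sub_pos (π x))).ne'
  have hws : ContMDiff 𝓘(ℝ, Euc n) 𝓘(ℝ, Euc (n + 2)) ∞ w :=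
    ((hT.contMDiff_sqrt.comp h.contMDiff_proj).inv₀ hpos).smul
      (hF.contMDiff_right.sub (hT.contMDiff_pushGradient.comp h.contMDiff_proj))
  let j : N → UnitNormalBundle m g := fun x => bundleMk (h.exists_isUnitNormal hn x)
  have hjι : ContMDiff 𝓘(ℝ, Euc n) ((𝓡 m).prod 𝓘(ℝ, Euc (n + 2))) ∞ (fun x => bundleIncl (j x)) :=
    h.contMDiff_proj.prodMk hws
  have hjc : Continuous j := isInducing_bundleIncl.continuous_iff.2 hjι.continuous
  have hjs : ContMDiff 𝓘(ℝ, Euc n) 𝓘(ℝ, Euc n) ∞ j := fun x =>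
    hc.contMDiffAt_lift hjc.continuousAt (hjι x)
  have hfj : ∀ x, f x = tubeMap m g τ (j x) := by
    intro x
    have hcon : conormal g τ (j x) = rot σ η (fun y => -f y) x := by
      show pushGradient m g τ (π x) + Real.sqrt (1 - ‖pushGradient m g τ (π x)‖ ^ 2) • w x = _
      rw [smul_smul, mul_inv_cancel₀ (hpos x), one_smul, add_sub_cancel]
    rw [hT.tubeMap_eq_rot, ← h.gaussPair.rot_rot (σ := σ) x]
    show Real.cos (σ x) • rot σ f η x + Real.sin (σ x) • -rot σ η (fun y => -f y) x =
      Real.cos (τ (π x)) • g (π x) + Real.sin (τ (π x)) • -conormal g τ (j x)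
    rw [hcon, h.focal_eq, h.sigma_eq]
  refine ⟨j, ?_, hfj, fun x => rfl⟩
  refine isLocalDiffeomorph_of_bijective_mfderiv hjs rfl fun x => ?_
  let J : Euc n →L[ℝ] Euc n := mfderiv 𝓘(ℝ, Euc n) 𝓘(ℝ, Euc n) j x
  -- f_* = Ψ_* ∘ j_* is injective, hence so is j_*, and the dimensions agree.
  have hJ : Function.Injective J := by
    have h1 : ∀ X, vd (Euc n) f x X = vd (Euc n) (tubeMap m g τ) (j x) (J X) := by
      intro X
      rw [funext hfj]
      exact vd_comp (mdifferentiableAt_of_contMDiffAt ((hT.gaussPair hΛ).contMDiff_left _))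
        (mdifferentiableAt_of_contMDiffAt (hjs x)) X
    intro a b hab
    apply h.injective_vd x
    rw [h1, h1, hab]
  exact (LinearMap.injective_iff_surjective (f := (J : Euc n →ₗ[ℝ] Euc n))).1 hJ

end FocalFactorization

/-- A clopen set of the unit normal bundle which meets every fibre is the whole bundle. -/
theorem eq_univ_of_isClopen_bundle {m l n : ℕ} {L : Type*} [TopologicalSpace L]
    [ChartedSpace (Euc m) L] {g : L → Euc (n + 2)} (hn : n = m + l) (hl : 1 ≤ l)
    {S : Set (UnitNormalBundle m g)} (hS : IsClopen S)
    (hfib : ∀ q : UnitNormalBundle m g, ∃ q' ∈ S, q'.base = q.base) : S = univ := by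
  rw [eq_univ_iff_forall]
  intro q
  obtain ⟨q', hq'S, hq'⟩ := hfib q
  set p := q.base with hp
  let A : Euc (n + 2) →L[ℝ] (Euc m →L[ℝ] ℝ) × ℝ :=
    (dualPull (vd (Euc m) g p)).prod (innerSL ℝ (g p))
  have hA : ∀ w, w ∈ A.ker ↔ inner ℝ w (g p) = (0 : ℝ) ∧ ∀ Y, inner ℝ w (vd (Euc m) g p Y) = 0 := by
    intro w
    have h1 : A w = (dualPull (vd (Euc m) g p) w, inner ℝ (g p) w) := rfl
    rw [LinearMap.mem_ker]
    show A w = 0 ↔ _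
    rw [h1, Prod.mk_eq_zero, real_inner_comm, and_comm]
    refine and_congr_right fun _ => ?_
    exact ⟨fun h Y => DFunLike.congr_fun h Y, fun h => ContinuousLinearMap.ext h⟩
  -- The normal space has dimension at least n + 2 − (m + 1) = l + 1 ≥ 2, so its unit sphere, the
  -- fibre, is connected.
  have hrank : 1 < Module.rank ℝ A.ker := by
    have h1 := (A : Euc (n + 2) →ₗ[ℝ] (Euc m →L[ℝ] ℝ) × ℝ).finrank_range_add_finrank_ker
    have h2 : Module.finrank ℝ (A : Euc (n + 2) →ₗ[ℝ] (Euc m →L[ℝ] ℝ) × ℝ).range ≤ m + 1 := by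
      have h3 := Submodule.finrank_le (A : Euc (n + 2) →ₗ[ℝ] (Euc m →L[ℝ] ℝ) × ℝ).range
      rw [Module.finrank_prod, finrank_dual_eq, Module.finrank_self, finrank_euclideanSpace,
        Fintype.card_fin] at h3
      exact h3
    rw [finrank_euclideanSpace, Fintype.card_fin] at h1
    have h4 : 1 < Module.finrank ℝ A.ker := by omega
    rw [← Module.finrank_eq_rank]
    exact_mod_cast h4
  have hN : ∀ w : Metric.sphere (0 : A.ker) 1, IsUnitNormal m g p w := by
    intro w
    exact ⟨mem_sphere_zero_iff_norm.1 w.2, (hA _).1 w.1.2⟩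
  let Φ : Metric.sphere (0 : A.ker) 1 → UnitNormalBundle m g := fun w => bundleMk (hN w)
  have hΦ : Continuous Φ := by
    rw [isInducing_bundleIncl.continuous_iff]
    exact continuous_const.prodMk (continuous_subtype_val.comp continuous_subtype_val)
  have hpre : PreconnectedSpace (Metric.sphere (0 : A.ker) 1) :=
    isPreconnected_iff_preconnectedSpace.1 (isPreconnected_sphere hrank 0 1)
  have hlift : ∀ r : UnitNormalBundle m g, r.base = p → ∃ w, Φ w = r := by
    intro r hr
    have h1 := isUnitNormal_vec r
    rw [hr] at h1
    refine ⟨⟨⟨r.vec, (hA _).2 h1.2⟩, by simpa using h1.1⟩, bundleIncl_injective ?_⟩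
    exact Prod.ext hr.symm rfl
  obtain ⟨w, hw⟩ := hlift q rfl
  obtain ⟨w', hw'⟩ := hlift q' hq'
  have h1 : (univ : Set (Metric.sphere (0 : A.ker) 1)) ⊆ Φ ⁻¹' S :=
    isPreconnected_univ.subset_isClopen (hS.preimage hΦ) ⟨w', mem_univ _, by
      rw [mem_preimage, hw']; exact hq'S⟩
  have h2 := h1 (mem_univ w)
  rwa [mem_preimage, hw] at h2

end FocalSubmanifold

/-! ### Leaves, flow boxes and the topology of the leaf space. -/

section LeafSpaces

variable {m l n k : ℕ} {N : Type*} [TopologicalSpace N] [ChartedSpace (Euc n) N]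
  {f η : N → Euc k} {lam : N → ℝ} {H : N → Euc k}

/-- A smooth map whose differential has the principal distribution as its kernel. -/
structure LeafMap (n : ℕ) {k : ℕ} {N : Type*} [TopologicalSpace N] [ChartedSpace (Euc n) N]
    (f η : N → Euc k) (lam : N → ℝ) (H : N → Euc k) (l : ℕ) :
    Prop where
  contMDiff : ContMDiff 𝓘(ℝ, Euc n) 𝓘(ℝ, Euc k) ∞ H
  mem_principalSpace_iff : ∀ (x : N) (X : Euc n),
    X ∈ principalSpace n f η lam x ↔ vd (Euc n) H x X = 0
  finrank_ker : ∀ x, Module.finrank ℝ (vd (Euc n) H x).ker = l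

/-- A set whose preimages under leaf curves are clopen is saturated. -/
theorem leafSetoid_mem_iff {A : Set N}
    (hA : ∀ γ : ℝ → N, ContMDiff 𝓘(ℝ, ℝ) (𝓡 n) ∞ γ →
      (∀ t : ℝ, mfderiv 𝓘(ℝ, ℝ) (𝓡 n) γ t (1 : ℝ) ∈ principalSpace n f η lam (γ t)) →
      IsClopen (γ ⁻¹' A)) {x y : N} (hxy : leafSetoid n f η lam x y) : x ∈ A ↔ y ∈ A := by
  induction hxy with
  | rel x y h =>
    obtain ⟨γ, hγ, hγ', rfl, rfl⟩ := h
    -- The real line is connected, so the preimage is empty or everything.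
    rcases isClopen_iff.1 (hA γ hγ hγ') with h | h
    · exact iff_of_false (fun h0 => (h ▸ h0 : (0 : ℝ) ∈ (∅ : Set ℝ)))
        (fun h0 => (h ▸ h0 : (1 : ℝ) ∈ (∅ : Set ℝ)))
    · exact iff_of_true (h ▸ mem_univ (0 : ℝ) : (0 : ℝ) ∈ γ ⁻¹' A)
        (h ▸ mem_univ (1 : ℝ) : (1 : ℝ) ∈ γ ⁻¹' A)
  | refl x => exact Iff.rfl
  | symm x y _ ih => exact ih.symm
  | trans x y z _ _ ih1 ih2 => exact ih1.trans ih2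

/-- A function whose differential vanishes on the principal distribution is constant along leaf
curves. -/
theorem eq_of_leafCurve_tangent {F : Type*} [NormedAddCommGroup F] [NormedSpace ℝ F] {u : N → F}
    (hu : ContMDiff 𝓘(ℝ, Euc n) 𝓘(ℝ, F) ∞ u)
    (hu' : ∀ (x : N) (X : Euc n), X ∈ principalSpace n f η lam x → vd (Euc n) u x X = 0)
    {γ : ℝ → N} (hγ : ContMDiff 𝓘(ℝ, ℝ) (𝓡 n) ∞ γ)
    (hγ' : ∀ t : ℝ, mfderiv 𝓘(ℝ, ℝ) (𝓡 n) γ t (1 : ℝ) ∈ principalSpace n f η lam (γ t))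
    (s t : ℝ) : u (γ s) = u (γ t) := by
  have h1 : Differentiable ℝ (fun t => u (γ t)) :=
    (contMDiff_iff_contDiff.1 (hu.comp hγ)).differentiable (by simp)
  refine is_const_of_deriv_eq_zero h1 (fun t => ?_) s t
  have h2 := vd_comp (mdifferentiableAt_of_contMDiffAt (hu (γ t)))
    (mdifferentiableAt_of_contMDiffAt (hγ t)) (1 : ℝ)
  rw [vd_eq_fderiv] at h2
  exact h2.trans (hu' _ _ (hγ' t))

theorem eq_of_leafSetoid {F : Type*} [NormedAddCommGroup F] [NormedSpace ℝ F] {u : N → F}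
    (hu : ContMDiff 𝓘(ℝ, Euc n) 𝓘(ℝ, F) ∞ u)
    (hu' : ∀ (x : N) (X : Euc n), X ∈ principalSpace n f η lam x → vd (Euc n) u x X = 0)
    {x y : N} (hxy : leafSetoid n f η lam x y) : u x = u y := by
  induction hxy with
  | rel x y h =>
    obtain ⟨γ, hγ, hγ', rfl, rfl⟩ := h
    exact eq_of_leafCurve_tangent hu hu' hγ hγ' 0 1
  | refl x => rfl
  | symm x y _ ih => exact ih.symm
  | trans x y z _ _ ih1 ih2 => exact ih1.trans ih2

/-- The projection of the whole manifold onto its space of leaves. -/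
def leafMk (f η : N → Euc k) (lam : N → ℝ) (x : N) : LeafSpace n f η lam ⊤ :=
  leafProj n f η lam ⊤ ⟨x, trivial⟩

theorem leafMk_eq_iff {x y : N} : leafMk (n := n) f η lam x = leafMk f η lam y ↔
    leafSetoid n f η lam x y := Quotient.eq

theorem leafMk_surjective : Function.Surjective (leafMk (n := n) f η lam) := by
  intro p
  obtain ⟨⟨x, hx⟩, rfl⟩ := Quotient.exists_rep p
  exact ⟨x, rfl⟩

theorem continuous_leafProj (V : TopologicalSpace.Opens N) : Continuous (leafProj n f η lam V) :=
  continuous_quotient_mk'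

theorem continuous_leafMk : Continuous (leafMk (n := n) f η lam) :=
  (continuous_leafProj ⊤).comp (continuous_id.subtype_mk _)

/-- A box adapted to the fibres of a leaf map. -/
structure FlowBox (n : ℕ) {k : ℕ} {N : Type*} [TopologicalSpace N] [ChartedSpace (Euc n) N]
    (f η : N → Euc k) (lam : N → ℝ) (H : N → Euc k) (m l : ℕ)
    (P : Euc k →L[ℝ] Euc m) (e : OpenPartialHomeomorph N (Euc m × Euc l)) (b₀ : Euc m)
    (z₀ : Euc l) (r : ℝ) : Prop where
  pos : 0 < r
  target_eq : e.target = Metric.ball b₀ r ×ˢ Metric.ball z₀ r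
  fst_eq : ∀ x ∈ e.source, (e x).1 = P (H x)
  contMDiffOn_symm : ContMDiffOn 𝓘(ℝ, Euc m × Euc l) 𝓘(ℝ, Euc n) ∞ e.symm e.target
  leafSetoid_symm : ∀ b ∈ Metric.ball b₀ r, ∀ z ∈ Metric.ball z₀ r, ∀ z' ∈ Metric.ball z₀ r,
    leafSetoid n f η lam (e.symm (b, z)) (e.symm (b, z'))

namespace FlowBox

variable {P : Euc k →L[ℝ] Euc m} {e : OpenPartialHomeomorph N (Euc m × Euc l)} {b₀ : Euc m}
  {z₀ : Euc l} {r : ℝ} (h : FlowBox n f η lam H m l P e b₀ z₀ r)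
include h

theorem mem_target {b : Euc m} {z : Euc l} (hb : b ∈ Metric.ball b₀ r) (hz : z ∈ Metric.ball z₀ r) :
    (b, z) ∈ e.target := by
  rw [h.target_eq]
  exact ⟨hb, hz⟩

theorem fst_mem {x : N} (hx : x ∈ e.source) : (e x).1 ∈ Metric.ball b₀ r := by
  have h1 := e.map_source hx
  rw [h.target_eq] at h1
  exact h1.1

theorem snd_mem {x : N} (hx : x ∈ e.source) : (e x).2 ∈ Metric.ball z₀ r := by
  have h1 := e.map_source hx
  rw [h.target_eq] at h1
  exact h1.2

theorem leafSetoid_plaque {x : N} (hx : x ∈ e.source) {z : Euc l} (hz : z ∈ Metric.ball z₀ r) :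
    leafSetoid n f η lam (e.symm ((e x).1, z)) x := by
  have h1 := h.leafSetoid_symm _ (h.fst_mem hx) z hz _ (h.snd_mem hx)
  rwa [Prod.mk.eta, e.left_inv hx] at h1

theorem leafSetoid_of_eq {x y : N} (hx : x ∈ e.source) (hy : y ∈ e.source) (hxy : H x = H y) :
    leafSetoid n f η lam x y := by
  have h1 := h.leafSetoid_plaque hx (h.snd_mem hy)
  rw [h.fst_eq x hx, hxy, ← h.fst_eq y hy, Prod.mk.eta, e.left_inv hy] at h1
  exact Setoid.symm' _ h1

/-- Slide each point near `y` along its plaque to the transverse coordinate of `x`. The slide is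
continuous and takes `y` to `x`, so nearby points land in `A`, and saturation brings them back. -/
theorem mem_interior {A : Set N} (hA : IsSaturated n f η lam A) {x y : N} (hx : x ∈ e.source)
    (hy : y ∈ e.source) (hxy : H x = H y) (hxA : x ∈ interior A) : y ∈ interior A := by
  have hcont : ContinuousAt (fun y' => e.symm ((e y').1, (e x).2)) y := by
    have h1 : ContinuousAt (fun y' => ((e y').1, (e x).2)) y :=
      (continuousAt_fst.comp (e.continuousAt hy)).prodMk continuousAt_const
    exact ContinuousAt.comp (g := e.symm)
      (e.continuousAt_symm (h.mem_target (h.fst_mem hy) (h.snd_mem hx))) h1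
  have hval : e.symm ((e y).1, (e x).2) = x := by
    rw [h.fst_eq y hy, ← hxy, ← h.fst_eq x hx, Prod.mk.eta, e.left_inv hx]
  rw [mem_interior_iff_mem_nhds]
  have h2 : interior A ∈ 𝓝 (e.symm ((e y).1, (e x).2)) := by
    rw [hval]
    exact isOpen_interior.mem_nhds hxA
  filter_upwards [e.open_source.mem_nhds hy, hcont h2] with y' hy' hy'A
  exact hA _ _ (h.leafSetoid_plaque hy' (h.snd_mem hx)) (interior_subset hy'A)

end FlowBox

namespace LeafMap

variable [IsManifold 𝓘(ℝ, Euc n) ∞ N] (h : LeafMap n f η lam H l)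
include h

theorem eq_of_leafSetoid {x y : N} (hxy : leafSetoid n f η lam x y) : H x = H y :=
  SphereHyp.eq_of_leafSetoid h.contMDiff (fun x X => (h.mem_principalSpace_iff x X).1) hxy

/-- Constant rank: a linear projection `P` makes `P ∘ H` a submersion at `x₀`, and the rank m of `H`
leaves no further variation along the fibres of `P ∘ H`. Plaques are therefore tangent to the
principal distribution. -/
theorem exists_flowBox (hn : n = m + l) (x₀ : N) :
    ∃ (P : Euc k →L[ℝ] Euc m) (e : OpenPartialHomeomorph N (Euc m × Euc l)) (b₀ : Euc m)
      (z₀ : Euc l) (r : ℝ), x₀ ∈ e.source ∧ FlowBox n f η lam H m l P e b₀ z₀ r := by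
  have hrange : ∀ x, Module.finrank ℝ (vd (Euc n) H x : Euc n →ₗ[ℝ] Euc k).range = m := by
    intro x
    have h1 := (vd (Euc n) H x : Euc n →ₗ[ℝ] Euc k).finrank_range_add_finrank_ker
    have h2 : Module.finrank ℝ (vd (Euc n) H x : Euc n →ₗ[ℝ] Euc k).ker = l := h.finrank_ker x
    rw [h2, finrank_euclideanSpace, Fintype.card_fin] at h1
    omega
  obtain ⟨P, hP⟩ : ∃ P : Euc k →L[ℝ] Euc m, Function.Surjective (fun X => P (vd (Euc n) H x₀ X)) := by
    let R := (vd (Euc n) H x₀ : Euc n →ₗ[ℝ] Euc k).range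
    obtain ⟨p, hp⟩ := LinearMap.exists_leftInverse_of_injective R.subtype R.ker_subtype
    let ψ : R ≃ₗ[ℝ] Euc m := LinearEquiv.ofFinrankEq _ _ (by simp [R, hrange])
    refine ⟨LinearMap.toContinuousLinearMap (ψ.toLinearMap ∘ₗ p), fun b => ?_⟩
    obtain ⟨X, hX⟩ := (ψ.symm b).2
    refine ⟨X, ?_⟩
    have h1 : p (vd (Euc n) H x₀ X) = ψ.symm b := by
      have h2 := LinearMap.congr_fun hp (ψ.symm b)
      have h3 : vd (Euc n) H x₀ X = R.subtype (ψ.symm b) := hX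
      rw [h3]
      exact h2
    show ψ (p (vd (Euc n) H x₀ X)) = b
    rw [h1, ψ.apply_symm_apply]
  have hPH : ContMDiff 𝓘(ℝ, Euc n) 𝓘(ℝ, Euc m) ∞ (fun x => P (H x)) :=
    P.contDiff.contMDiff.comp h.contMDiff
  have hsurj : Function.Surjective (vd (Euc n) (fun x => P (H x)) x₀) := by
    intro b
    obtain ⟨X, hX⟩ := hP b
    refine ⟨X, ?_⟩
    rw [vd_clm P (mdifferentiableAt_of_contMDiffAt (h.contMDiff x₀))]
    exact hX
  obtain ⟨e, r, hx₀, -, hfst, -, hes, hr, het⟩ := exists_submersion_box (Euc l) (by simpa using hn)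
    isOpen_univ hPH.contMDiffOn (mem_univ x₀) hsurj
  refine ⟨P, e, _, _, r, hx₀, hr, het, hfst, hes, ?_⟩
  set K : Euc m × Euc l → Euc k := fun y => H (e.symm y) with hK
  have hes' : ∀ y ∈ e.target, ContMDiffAt 𝓘(ℝ, Euc m × Euc l) 𝓘(ℝ, Euc n) ∞ e.symm y := fun y hy =>
    hes.contMDiffAt (e.open_target.mem_nhds hy)
  have hKd : ∀ y ∈ e.target, DifferentiableAt ℝ K y := fun y hy =>
    (mdifferentiableAt_of_contMDiffAt ((h.contMDiff _).comp y (hes' y hy))).differentiableAt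
  have hzero : ∀ y ∈ e.target, ∀ ζ : Euc l, fderiv ℝ K y (0, ζ) = 0 := by
    intro y hy ζ
    let D : Euc m × Euc l →ₗ[ℝ] Euc k := (fderiv ℝ K y : Euc m × Euc l →L[ℝ] Euc k)
    have hDr : Module.finrank ℝ D.range ≤ m := by
      refine (Submodule.finrank_mono ?_).trans_eq (hrange (e.symm y))
      rintro _ ⟨v, rfl⟩
      have h1 := vd_comp (mdifferentiableAt_of_contMDiffAt (h.contMDiff (e.symm y)))
        (mdifferentiableAt_of_contMDiffAt (hes' y hy)) v
      rw [vd_eq_fderiv] at h1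
      exact ⟨_, h1.symm⟩
    -- This puts ker D inside the vertical space. Rank at most m makes ker D at least l-dimensional,
    -- so the two are equal.
    have hPD : ∀ v, P (D v) = v.1 := by
      intro v
      have h1 : HasFDerivAt (fun y => P (K y)) (P ∘L fderiv ℝ K y) y :=
        P.hasFDerivAt.comp y (hKd y hy).hasFDerivAt
      have h2 : (fun y => P (K y)) =ᶠ[𝓝 y] Prod.fst := by
        filter_upwards [e.open_target.mem_nhds hy] with y' hy'
        rw [hK, ← hfst _ (e.map_target hy'), e.right_inv hy']
      exact DFunLike.congr_fun (h1.unique (hasFDerivAt_fst.congr_of_eventuallyEq h2)) v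
    have hle : D.ker ≤ (LinearMap.fst ℝ (Euc m) (Euc l)).ker := by
      intro v hv
      have h1 := hPD v
      rw [LinearMap.mem_ker.1 hv, map_zero] at h1
      exact h1.symm
    have hfin : Module.finrank ℝ (LinearMap.fst ℝ (Euc m) (Euc l)).ker ≤
        Module.finrank ℝ D.ker := by
      have h1 := D.finrank_range_add_finrank_ker
      have h2 := (LinearMap.fst ℝ (Euc m) (Euc l)).finrank_range_add_finrank_ker
      rw [LinearMap.range_eq_top.2 LinearMap.fst_surjective, finrank_top] at h2
      simp only [Module.finrank_prod, finrank_euclideanSpace, Fintype.card_fin] at h1 h2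
      omega
    have h3 : ((0, ζ) : Euc m × Euc l) ∈ (LinearMap.fst ℝ (Euc m) (Euc l)).ker := rfl
    rw [← Submodule.eq_of_le_of_finrank_le hle hfin] at h3
    exact h3
  intro b hb z hz z' hz'
  -- Leaf curves are defined on all of ℝ; the smooth step keeps the segment parameter in [0, 1] and
  -- so the curve in the box.
  let c : ℝ → Euc m × Euc l := fun t => (b, z + Real.smoothTransition t • (z' - z))
  have hst : ContDiff ℝ ∞ Real.smoothTransition := Real.smoothTransition.contDiff
  have hc : ContDiff ℝ ∞ c := contDiff_const.prodMk (contDiff_const.add (hst.smul contDiff_const))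
  have hct : ∀ t, c t ∈ e.target := by
    intro t
    rw [het]
    exact ⟨hb, (convex_ball _ _).add_smul_sub_mem hz hz'
      ⟨Real.smoothTransition.nonneg t, Real.smoothTransition.le_one t⟩⟩
  have hγ : ContMDiff 𝓘(ℝ, ℝ) 𝓘(ℝ, Euc n) ∞ (fun t => e.symm (c t)) := fun t =>
    (hes' _ (hct t)).comp t (hc.contMDiff t)
  refine Relation.EqvGen.rel _ _ ⟨fun t => e.symm (c t), hγ, fun t => ?_, ?_, ?_⟩
  · refine (h.mem_principalSpace_iff _ _).2 ?_
    have h1 := vd_comp (π := fun t => e.symm (c t))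
      (mdifferentiableAt_of_contMDiffAt (h.contMDiff (e.symm (c t))))
      (mdifferentiableAt_of_contMDiffAt (hγ t)) (1 : ℝ)
    rw [vd_eq_fderiv] at h1
    refine h1.symm.trans ?_
    have h2 : HasDerivAt c ((0, deriv Real.smoothTransition t • (z' - z)) : Euc m × Euc l) t := by
      have h3 : HasDerivAt Real.smoothTransition (deriv Real.smoothTransition t) t :=
        (hst.differentiable (by simp) t).hasDerivAt
      exact (hasDerivAt_const t b).prodMk ((h3.smul_const (z' - z)).const_add z)
    have h4 : HasDerivAt (fun t => K (c t)) _ t :=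
      (hKd _ (hct t)).hasFDerivAt.comp_hasDerivAt t h2
    exact h4.deriv.trans (hzero _ (hct t) _)
  · simp [c]
  · simp [c]

/-- `H` is constant along a leaf curve, so `mem_interior` applies between nearby points of it; hence
the times spent in the interior form a clopen set. -/
theorem isSaturated_interior (hn : n = m + l) {A : Set N} (hA : IsSaturated n f η lam A) :
    IsSaturated n f η lam (interior A) := by
  intro x y hxy
  refine (leafSetoid_mem_iff (fun γ hγ hγ' => ?_) hxy).1
  refine ⟨⟨?_⟩, isOpen_interior.preimage hγ.continuous⟩
  rw [isOpen_iff_mem_nhds]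
  intro t ht
  obtain ⟨P, e, b₀, z₀, r, hmem, hbox⟩ := h.exists_flowBox hn (γ t)
  filter_upwards [hγ.continuous.continuousAt (e.open_source.mem_nhds hmem)] with s hs hsA
  exact ht (hbox.mem_interior hA hs hmem (eq_of_leafCurve_tangent h.contMDiff
    (fun x X => (h.mem_principalSpace_iff x X).1) hγ hγ' s t) hsA)

/-- The saturation of an open set is open, because its interior is saturated and already contains
that open set. -/
theorem isOpenMap_leafMk (hn : n = m + l) : IsOpenMap (leafMk (n := n) f η lam) := by
  intro U hU
  let A : Set N := {y | ∃ x ∈ U, leafSetoid n f η lam x y}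
  have hA : IsSaturated n f η lam A := by
    rintro y z hyz ⟨x, hx, hxy⟩
    exact ⟨x, hx, Setoid.trans' _ hxy hyz⟩
  have hUA : U ⊆ interior A :=
    interior_maximal (fun x hx => ⟨x, hx, Setoid.refl' _ x⟩) hU
  have hAo : IsOpen A := by
    refine interior_eq_iff_isOpen.1 (interior_subset.antisymm ?_)
    rintro y ⟨x, hx, hxy⟩
    exact h.isSaturated_interior hn hA x y hxy (hUA hx)
  show IsOpen ((leafProj n f η lam ⊤) ⁻¹' (leafMk (n := n) f η lam '' U))
  have h1 : (leafProj n f η lam ⊤) ⁻¹' (leafMk (n := n) f η lam '' U) = Subtype.val ⁻¹' A := by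
    ext ⟨y, hy⟩
    constructor
    · rintro ⟨x, hx, hxy⟩
      exact ⟨x, hx, leafMk_eq_iff.1 hxy⟩
    · rintro ⟨x, hx, hxy⟩
      exact ⟨x, hx, leafMk_eq_iff.2 hxy⟩
  rw [h1]
  exact hAo.preimage continuous_subtype_val

/-- The map induced on the space of leaves. -/
def descend (p : LeafSpace n f η lam ⊤) : Euc k :=
  Quotient.lift (fun x : (⊤ : TopologicalSpace.Opens N) => H x)
    (fun _ _ hxy => h.eq_of_leafSetoid hxy) p

theorem descend_leafMk (x : N) : h.descend (leafMk f η lam x) = H x := rfl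

theorem continuous_descend : Continuous h.descend :=
  Continuous.quotient_lift (h.contMDiff.continuous.comp continuous_subtype_val) _

/-- The slice z = z₀ of a flow box meets every leaf through the box, and `P ∘ H` is a coordinate on
it. The same `P` is the ambient extension that yields smooth transitions. -/
theorem exists_leaf_chart (hn : n = m + l) (p : LeafSpace n f η lam ⊤) :
    ∃ c : OpenPartialHomeomorph (LeafSpace n f η lam ⊤) (Euc m), p ∈ c.source ∧
      ContMDiffOn 𝓘(ℝ, Euc m) 𝓘(ℝ, Euc k) ∞ (h.descend ∘ c.symm) c.target ∧
      ∃ P : Euc k →L[ℝ] Euc m, ∀ q ∈ c.source, c q = P (h.descend q) := by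
  obtain ⟨x₀, rfl⟩ := leafMk_surjective p
  obtain ⟨P, e, b₀, z₀, r, hmem, hbox⟩ := h.exists_flowBox hn x₀
  have hz₀ : z₀ ∈ Metric.ball z₀ r := Metric.mem_ball_self hbox.pos
  let c : OpenPartialHomeomorph (LeafSpace n f η lam ⊤) (Euc m) :=
    { toFun := fun q => P (h.descend q)
      invFun := fun b => leafMk f η lam (e.symm (b, z₀))
      source := leafMk f η lam '' e.source
      target := Metric.ball b₀ r
      map_source' := by
        rintro _ ⟨x, hx, rfl⟩
        rw [h.descend_leafMk, ← hbox.fst_eq x hx]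
        exact hbox.fst_mem hx
      map_target' := fun b hb => ⟨_, e.map_target (hbox.mem_target hb hz₀), rfl⟩
      left_inv' := by
        rintro _ ⟨x, hx, rfl⟩
        rw [h.descend_leafMk, ← hbox.fst_eq x hx]
        exact leafMk_eq_iff.2 (hbox.leafSetoid_plaque hx hz₀)
      right_inv' := fun b hb => by
        rw [h.descend_leafMk, ← hbox.fst_eq _ (e.map_target (hbox.mem_target hb hz₀)),
          e.right_inv (hbox.mem_target hb hz₀)]
      open_source := h.isOpenMap_leafMk hn _ e.open_source
      open_target := Metric.isOpen_ball
      continuousOn_toFun := (P.continuous.comp h.continuous_descend).continuousOn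
      continuousOn_invFun := continuous_leafMk.comp_continuousOn
        (e.continuousOn_symm.comp (by fun_prop) fun b hb => hbox.mem_target hb hz₀) }
  refine ⟨c, ⟨x₀, hmem, rfl⟩, ?_, P, fun q _ => rfl⟩
  have h1 : ContMDiffOn 𝓘(ℝ, Euc m) 𝓘(ℝ, Euc m × Euc l) ∞ (fun b => (b, z₀)) (Metric.ball b₀ r) :=
    (contDiff_id.prodMk contDiff_const).contMDiff.contMDiffOn
  exact h.contMDiff.comp_contMDiffOn
    (hbox.contMDiffOn_symm.comp h1 fun b hb => hbox.mem_target hb hz₀)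

/-- Within a level set of `H`, points of one flow box share a leaf. So a leaf is open and closed in
its level set. -/
theorem isClosed_of_leaf [T2Space N] (hn : n = m + l) (x : N) :
    IsClosed {z | leafSetoid n f η lam x z} ∧
      IsClosed {z | H z = H x ∧ ¬ leafSetoid n f η lam x z} := by
  have key : ∀ z, H z = H x → ∀ᶠ y in 𝓝 z, H y = H x → leafSetoid n f η lam z y := by
    intro z hz
    obtain ⟨P, e, b₀, z₀, r, hmem, hbox⟩ := h.exists_flowBox hn z
    filter_upwards [e.open_source.mem_nhds hmem] with y hy hyx
    exact hbox.leafSetoid_of_eq hmem hy (hz.trans hyx.symm)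
  have hne : ∀ z, H z ≠ H x → ∀ᶠ y in 𝓝 z, H y ≠ H x := fun z hz =>
    h.contMDiff.continuous.continuousAt.eventually_ne hz
  constructor
  · refine ⟨isOpen_iff_mem_nhds.2 fun z hz => ?_⟩
    by_cases hzx : H z = H x
    · filter_upwards [key z hzx] with y hy hxy
      exact hz (Setoid.trans' _ hxy (Setoid.symm' _ (hy (h.eq_of_leafSetoid hxy).symm)))
    · filter_upwards [hne z hzx] with y hy hxy
      exact hy (h.eq_of_leafSetoid hxy).symm
  · refine ⟨isOpen_iff_mem_nhds.2 fun z hz => ?_⟩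
    by_cases hzx : H z = H x
    · filter_upwards [key z hzx] with y hy hxy
      refine hz ⟨hzx, fun hxz => hxy.2 (Setoid.trans' _ hxz (hy hxy.1))⟩
    · filter_upwards [hne z hzx] with y hy hxy
      exact hy hxy.1

/-- The space of leaves of a compact manifold is Hausdorff. -/
theorem t2Space_leafSpace [T2Space N] [CompactSpace N] (hn : n = m + l) :
    T2Space (LeafSpace n f η lam ⊤) := by
  refine ⟨fun p p' hpp' => ?_⟩
  by_cases hgp : h.descend p = h.descend p'
  · obtain ⟨x, rfl⟩ := leafMk_surjective p
    obtain ⟨y, rfl⟩ := leafMk_surjective p'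
    have hxy : ¬ leafSetoid n f η lam x y := fun hh => hpp' (leafMk_eq_iff.2 hh)
    obtain ⟨hc1, hc2⟩ := h.isClosed_of_leaf hn x
    obtain ⟨W₁, W₂, hW₁, hW₂, hs1, hs2, hdis⟩ := SeparatedNhds.of_isCompact_isCompact hc1.isCompact
      hc2.isCompact (Set.disjoint_left.2 fun z hz hz' => hz'.2 hz)
    -- `H '' C` is compact and misses `H x`, so every level of `H` outside it lies in `W₁ ∪ W₂`.
    -- Levels near that of `x` thus split into two open pieces.
    let C : Set N := (W₁ ∪ W₂)ᶜ
    have hC : IsClosed (H '' C) :=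
      ((hW₁.union hW₂).isClosed_compl.isCompact.image h.contMDiff.continuous).isClosed
    have hcov : ∀ z, H z ∉ H '' C → z ∈ W₁ ∪ W₂ := fun z hz => by
      by_contra hzW
      exact hz ⟨z, hzW, rfl⟩
    have hx : H x ∉ H '' C := by
      rintro ⟨z, hzC, hzx⟩
      by_cases hz : leafSetoid n f η lam x z
      · exact hzC (Or.inl (hs1 hz))
      · exact hzC (Or.inr (hs2 ⟨hzx, hz⟩))
    have hHxy : H x = H y := hgp
    have hy : H y ∉ H '' C := hHxy ▸ hx
    have hopen : ∀ W : Set N, IsOpen W → IsOpen (W ∩ H ⁻¹' (H '' C)ᶜ) := fun W hW =>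
      hW.inter (hC.isOpen_compl.preimage h.contMDiff.continuous)
    -- A leaf curve stays in one level, hence in one of the disjoint pieces, so the piece in `W₁` is
    -- saturated and the open images are disjoint.
    have hsat : ∀ z z', leafSetoid n f η lam z z' →
        (z ∈ W₁ ∩ H ⁻¹' (H '' C)ᶜ ↔ z' ∈ W₁ ∩ H ⁻¹' (H '' C)ᶜ) := by
      intro z z' hzz'
      refine leafSetoid_mem_iff (fun γ hγ hγ' => ⟨⟨?_⟩, (hopen W₁ hW₁).preimage hγ.continuous⟩) hzz'
      have hconst := eq_of_leafCurve_tangent h.contMDiff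
        (fun x X => (h.mem_principalSpace_iff x X).1) hγ hγ'
      rw [isOpen_iff_mem_nhds]
      intro t ht
      by_cases htC : H (γ t) ∈ H '' C
      · refine Filter.univ_mem' fun s hs => hs.2 ?_
        rwa [hconst s t]
      · have htW : γ t ∈ W₂ := (hcov _ htC).resolve_left fun h1 => ht ⟨h1, htC⟩
        filter_upwards [hγ.continuous.continuousAt (hW₂.mem_nhds htW)] with s hs hs'
        exact Set.disjoint_left.1 hdis hs'.1 hs
    refine ⟨_, _, h.isOpenMap_leafMk hn _ (hopen W₁ hW₁), h.isOpenMap_leafMk hn _ (hopen W₂ hW₂),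
      ⟨x, ⟨hs1 (show leafSetoid n f η lam x x from Setoid.refl' _ x), hx⟩, rfl⟩, ⟨y, ⟨hs2 ⟨hHxy.symm, hxy⟩, hy⟩, rfl⟩, ?_⟩
    rw [Set.disjoint_left]
    rintro _ ⟨z, hz, rfl⟩ ⟨z', hz', hzz'⟩
    exact Set.disjoint_left.1 hdis ((hsat z z' (Setoid.symm' _ (leafMk_eq_iff.1 hzz'))).1 hz).1 hz'.1
  · exact separated_by_continuous h.continuous_descend hgp

end LeafMap

end LeafSpaces

/-! ### The direct part: factorization over leaves and the compact case. -/

section DirectPart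

variable {m l n : ℕ} {N : Type*} [TopologicalSpace N] [ChartedSpace (Euc n) N]
  {f η : N → Euc (n + 2)} {lam σ : N → ℝ}

/-- A hypersurface of the sphere with a principal curvature `lam = cot σ` of multiplicity `l`, on
whose leaves `σ` is constant. -/
structure PrincipalHypersurface (l : ℕ) {n : ℕ} {N : Type*} [TopologicalSpace N]
    [ChartedSpace (Euc n) N] (f η : N → Euc (n + 2)) (lam σ : N → ℝ) : Prop where
  gaussPair : GaussPair (Euc n) f η
  injective_vd : ∀ x, Function.Injective (vd (Euc n) f x)
  contMDiff_sigma : ContMDiff 𝓘(ℝ, Euc n) 𝓘(ℝ, ℝ) ∞ σ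
  sigma_pos : ∀ x, 0 < σ x
  sigma_lt : ∀ x, σ x < Real.pi / 2
  vd_sigma : ∀ x X, Real.cos (σ x) • vd (Euc n) f x X + Real.sin (σ x) • vd (Euc n) η x X = 0 →
    vd (Euc n) σ x X = 0
  mem_principalSpace_iff : ∀ (x : N) (X : Euc n), X ∈ principalSpace n f η lam x ↔
    Real.cos (σ x) • vd (Euc n) f x X + Real.sin (σ x) • vd (Euc n) η x X = 0
  finrank_eq : ∀ x, Module.finrank ℝ (principalSpace n f η lam x) = l

theorem principalHypersurface_of_isPrincipalCurvatureOn [IsManifold 𝓘(ℝ, Euc n) ∞ N] (hl : 2 ≤ l)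
    (hf : IsSphereImmersionOn n f univ) (hη : IsGaussMapOn n f η univ)
    (hlam : IsPrincipalCurvatureOn n f η lam l univ)
    (hσ : ∀ x, 0 < σ x ∧ σ x < Real.pi / 2 ∧ lam x = Real.cot (σ x)) :
    PrincipalHypersurface l f η lam σ := by
  have hG := gaussPair_of_hypersurface hf hη
  have hinj : ∀ x, Function.Injective (vd (Euc n) f x) := fun x =>
    hf.injective_differential x (mem_univ x)
  have hcont : Continuous lam := continuousOn_univ.1 hlam.continuousOn
  have h0 : ∀ x, 0 < σ x := fun x => (hσ x).1
  have h1 : ∀ x, σ x < Real.pi / 2 := fun x => (hσ x).2.1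
  have h2 : ∀ x, lam x = Real.cot (σ x) := fun x => (hσ x).2.2
  have hps := fun x => principalSpace_eq_ker hG lam (hinj x)
  have hfin : ∀ x, Module.finrank ℝ (vd (Euc n) η x + lam x • vd (Euc n) f x).ker = l := by
    intro x
    rw [← hlam.finrank_eq x (mem_univ x), hps x]
    rfl
  refine ⟨hG, hinj, contMDiff_sigma hG hinj hcont hfin h0 h1 h2 hl, h0, h1,
    fun x X hX => vd_sigma_eq_zero hG hinj hcont hfin h0 h1 h2 hl hX, fun x X => ?_,
    fun x => hlam.finrank_eq x (mem_univ x)⟩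
  rw [← principal_iff_cos_sin h0 h1 h2, hps x]
  rfl

/-- Differentials on an open subset are restrictions. -/
theorem vd_restrict {E F N : Type*} [NormedAddCommGroup E] [NormedSpace ℝ E]
    [NormedAddCommGroup F] [NormedSpace ℝ F] [TopologicalSpace N] [ChartedSpace E N] {u : N → F}
    (V : TopologicalSpace.Opens N) (x : V) (hu : ContMDiffAt 𝓘(ℝ, E) 𝓘(ℝ, F) ∞ u x) :
    vd E (fun y : V => u y) x = vd E u x := by
  refine vd_eq_of_hasFDerivAt (hu.continuousAt.comp continuous_subtype_val.continuousAt) ?_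
  refine (hasFDerivAt_vd (mdifferentiableAt_of_contMDiffAt hu)).congr_of_eventuallyEq ?_
  filter_upwards [V.chartAt_subtype_val_symm_eventuallyEq (H := E) (x := x)] with y hy
  show u ((chartAt E x).symm y) = u ((chartAt E x.1).symm y)
  rw [hy]
  rfl

theorem norm_eq_one_of_inner_self {F : Type*} [NormedAddCommGroup F] [InnerProductSpace ℝ F] {v : F}
    (hv : inner ℝ v v = (1 : ℝ)) : ‖v‖ = 1 := by
  rw [real_inner_self_eq_norm_sq] at hv
  nlinarith [norm_nonneg v]

theorem TubeData.isSphereImmersionOn {L : Type*} [TopologicalSpace L] [ChartedSpace (Euc m) L]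
    {g : L → Euc (n + 2)} {τ : L → ℝ} (h : TubeData m g τ) : IsSphereImmersionOn m g univ :=
  ⟨h.contMDiff_map.contMDiffOn, fun p _ => norm_eq_one_of_inner_self (h.inner_self p),
    fun p _ => h.injective_vd p⟩

namespace PrincipalHypersurface

variable (h : PrincipalHypersurface l f η lam σ)
include h

theorem mem_principalSpace_iff_vd_focal (x : N) (X : Euc n) :
    X ∈ principalSpace n f η lam x ↔ vd (Euc n) (rot σ f η) x X = 0 := by
  rw [h.mem_principalSpace_iff, h.gaussPair.vd_focal_eq_zero_iff h.contMDiff_sigma h.vd_sigma]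

theorem leafMap : LeafMap n f η lam (rot σ f η) l where
  contMDiff := (h.gaussPair.focalPair h.contMDiff_sigma).contMDiff_left
  mem_principalSpace_iff := h.mem_principalSpace_iff_vd_focal
  finrank_ker x := by
    have h1 : principalSpace n f η lam x = (vd (Euc n) (rot σ f η) x).ker :=
      SetLike.ext fun X => h.mem_principalSpace_iff_vd_focal x X
    rw [← h.finrank_eq x, h1]
    rfl

theorem sigma_eq_of_leafSetoid {x y : N} (hxy : leafSetoid n f η lam x y) : σ x = σ y :=
  eq_of_leafSetoid h.contMDiff_sigma
    (fun x X hX => h.vd_sigma x X ((h.mem_principalSpace_iff x X).1 hX)) hxy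

variable [IsManifold 𝓘(ℝ, Euc n) ∞ N]

/-- The focal map descends to the space of leaves of a saturated open set. -/
theorem exists_focalFactorization (hn : n = m + l) (V : TopologicalSpace.Opens N)
    [ChartedSpace (Euc m) (LeafSpace n f η lam V)] (hL : IsLeafManifold n f η lam V m) :
    ∃ (g : LeafSpace n f η lam V → Euc (n + 2)) (τ : LeafSpace n f η lam V → ℝ),
      FocalFactorization m (fun x : V => f x) (fun x : V => η x) (fun x : V => σ x)
        (leafProj n f η lam V) g τ := by
  have hval : ContMDiff 𝓘(ℝ, Euc n) 𝓘(ℝ, Euc n) ∞ (Subtype.val : V → N) := contMDiff_subtype_val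
  have hf := h.gaussPair.contMDiff_left
  have hη := h.gaussPair.contMDiff_right
  have hrf := fun x : V => vd_restrict V x (hf x)
  have hrη := fun x : V => vd_restrict V x (hη x)
  have hrσ := fun x : V => vd_restrict V x (h.contMDiff_sigma x)
  have hrh : ∀ x : V, vd (Euc n) (rot (fun x : V => σ x) (fun x : V => f x) fun x : V => η x) x =
      vd (Euc n) (rot σ f η) x := fun x => vd_restrict V x (h.leafMap.contMDiff x)
  refine ⟨Quotient.lift (fun x : V => rot σ f η x)
    (fun _ _ hxy => eq_of_leafSetoid h.leafMap.contMDiff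
      (fun x X => (h.mem_principalSpace_iff_vd_focal x X).1) hxy),
    Quotient.lift (fun x : V => σ x) (fun _ _ hxy => h.sigma_eq_of_leafSetoid hxy), ?_⟩
  exact
    { gaussPair :=
        { contMDiff_left := hf.comp hval
          contMDiff_right := hη.comp hval
          inner_left_left := fun x => h.gaussPair.inner_left_left x
          inner_right_right := fun x => h.gaussPair.inner_right_right x
          inner_right_left := fun x => h.gaussPair.inner_right_left x
          inner_right_vd := fun x X => by
            rw [hrf]
            exact h.gaussPair.inner_right_vd x X }
      injective_vd := fun x => by
        rw [hrf]
        exact h.injective_vd x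
      contMDiff_sigma := h.contMDiff_sigma.comp hval
      sigma_pos := fun x => h.sigma_pos x
      sigma_lt := fun x => h.sigma_lt x
      vd_sigma := fun x X => by
        rw [hrf, hrη, hrσ]
        exact h.vd_sigma x X
      finrank_ker := fun x => by
        rw [hrh, h.leafMap.finrank_ker x, hn, add_comm]
      contMDiff_proj := hL.contMDiff_proj
      surjective_proj := Quotient.mk_surjective
      surjective_mfderiv := hL.surjective_mfderiv
      focal_eq := fun x => rfl
      sigma_eq := fun x => rfl }

theorem compactSpace_leafSpace [CompactSpace N] : CompactSpace (LeafSpace n f η lam ⊤) :=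
  ⟨by
    rw [← leafMk_surjective.range_eq]
    exact isCompact_range continuous_leafMk⟩

/-- The space of leaves of a compact hypersurface is a manifold. -/
theorem exists_isLeafManifold [T2Space N] [CompactSpace N] (hn : n = m + l) :
    ∃ _ : ChartedSpace (Euc m) (LeafSpace n f η lam ⊤), IsLeafManifold n f η lam ⊤ m := by
  have hH := h.leafMap
  choose c hmem hsymm P hP using hH.exists_leaf_chart hn
  -- The descended focal map plays the role of the inclusion. It need not be injective: the chart
  -- formalism uses only its local behaviour.
  have hc : SmoothChartsAlong 𝓘(ℝ, Euc (n + 2)) hH.descend c :=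
    ⟨hmem, hsymm, fun p => ⟨P p, fun q hq => ⟨(P p).contDiff.contMDiff.contMDiffAt, hP p q hq⟩⟩⟩
  let inst := chartedSpaceOfCharts c hc.mem_source
  have hman : IsManifold (𝓡 m) ∞ (LeafSpace n f η lam ⊤) := hc.isManifold
  have hval : ContMDiff 𝓘(ℝ, Euc n) 𝓘(ℝ, Euc n) ∞
    (Subtype.val : (⊤ : TopologicalSpace.Opens N) → N) := contMDiff_subtype_val
  have hproj : ContMDiff (𝓡 n) (𝓡 m) ∞ (leafProj n f η lam ⊤) := fun x =>
    hc.contMDiffAt_lift (continuous_leafProj ⊤).continuousAt ((hH.contMDiff.comp hval) x)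
  refine ⟨inst, hH.t2Space_leafSpace hn, hman, hproj, fun x => ?_⟩
  let B : Euc n →L[ℝ] Euc m := mfderiv (𝓡 n) (𝓡 m) (leafProj n f η lam ⊤) x
  -- The focal map factors through the projection, so ker π_* has dimension at most l and π_* has
  -- rank at least n − l = m.
  have hle : B.ker ≤ (vd (Euc n) (rot σ f η) x).ker := by
    intro X hX
    have h1 := vd_comp (f := hH.descend) (π := leafProj n f η lam ⊤) (x := x)
      (mdifferentiableAt_of_contMDiffAt (hc.contMDiff _))
      (mdifferentiableAt_of_contMDiffAt (hproj x)) X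
    have h2 : vd (Euc n) (rot σ f η) x X = vd (Euc m) hH.descend (leafProj n f η lam ⊤ x) (B X) :=
      (DFunLike.congr_fun (vd_restrict ⊤ x (hH.contMDiff x)) X).symm.trans h1
    have hX' : B X = 0 := hX
    rw [hX', map_zero] at h2
    exact h2
  have h1 := (B : Euc n →ₗ[ℝ] Euc m).finrank_range_add_finrank_ker
  have h2 := Submodule.finrank_mono hle
  have h3 : Module.finrank ℝ (B : Euc n →ₗ[ℝ] Euc m).ker ≤ l := h2.trans_eq (hH.finrank_ker x)
  have h4 : Module.finrank ℝ (B : Euc n →ₗ[ℝ] Euc m).range ≤ Module.finrank ℝ (Euc m) :=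
    Submodule.finrank_le _
  rw [finrank_euclideanSpace, Fintype.card_fin] at h1 h4
  refine (LinearMap.range_eq_top (f := (B : Euc n →ₗ[ℝ] Euc m))).1
    (Submodule.eq_top_of_finrank_eq ?_)
  rw [finrank_euclideanSpace, Fintype.card_fin]
  omega

end PrincipalHypersurface

/-- A lift of a compact hypersurface to the unit normal bundle of its focal submanifold is a
covering of the whole bundle. -/
theorem FocalFactorization.covering {L : Type*} [TopologicalSpace L] [ChartedSpace (Euc m) L]
    [IsManifold 𝓘(ℝ, Euc n) ∞ N] [IsManifold 𝓘(ℝ, Euc m) ∞ L] [T2Space N] [T2Space L]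
    [CompactSpace N]
    {π : N → L} {g : L → Euc (n + 2)} {τ : L → ℝ} (h : FocalFactorization m f η σ π g τ)
    (hn : n = m + l) (hl : 1 ≤ l) [ChartedSpace (Euc n) (UnitNormalBundle m g)]
    (hΛ : IsNormalBundleManifold m g n) {j : N → UnitNormalBundle m g}
    (hj : IsLocalDiffeomorph (𝓡 n) (𝓡 n) ∞ j) (hfj : ∀ x, f x = tubeMap m g τ (j x))
    (hbase : ∀ x, (j x).base = π x) :
    IsCoveringMap j ∧ Function.Surjective j ∧ IsSphereImmersionOn n (tubeMap m g τ) univ ∧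
      range (tubeMap m g τ) = range f := by
  have hT := h.tubeData hn
  have hG := hT.gaussPair hΛ
  have : T2Space (UnitNormalBundle m g) :=
    T2Space.of_injective_continuous bundleIncl_injective isInducing_bundleIncl.continuous
  -- Compact, hence closed, and open because `j` is a local diffeomorphism.
  have hclopen : IsClopen (range j) :=
    ⟨(isCompact_range hj.contMDiff.continuous).isClosed, hj.isOpen_range⟩
  have hsurj : Function.Surjective j := by
    rw [← range_eq_univ]
    refine eq_univ_of_isClopen_bundle hn hl hclopen fun q => ?_
    obtain ⟨x, hx⟩ := h.surjective_proj q.base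
    exact ⟨j x, mem_range_self x, (hbase x).trans hx⟩
  refine ⟨isLocalHomeomorph_iff_isCoveringMap.1 hj.isLocalHomeomorph, hsurj,
    ⟨hG.contMDiff_left.contMDiffOn, fun q _ => norm_eq_one_of_inner_self (hG.inner_left_left q),
      fun q _ => ?_⟩, ?_⟩
  · obtain ⟨x, rfl⟩ := hsurj q
    -- As Ψ_* ∘ j_* = f_* is injective and j_* is onto, Ψ_* is injective at `j x`; such points
    -- exhaust Λ.
    have hJ : Function.Surjective (mfderiv (𝓡 n) (𝓡 n) j x) :=
      (hj.mfderivToContinuousLinearEquiv (by simp) x).surjective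
    rw [injective_iff_map_eq_zero]
    intro Y hY
    obtain ⟨X, hX⟩ := hJ Y
    have h1 := vd_comp (mdifferentiableAt_of_contMDiffAt (hG.contMDiff_left (j x)))
      (mdifferentiableAt_of_contMDiffAt (hj.contMDiff x)) X
    rw [← funext hfj, hX] at h1
    have h2 : X = 0 := h.injective_vd x ((h1.trans hY).trans (map_zero _).symm)
    rw [← hX, h2]
    exact map_zero _
  · rw [← hsurj.range_comp (tubeMap m g τ)]
    exact congrArg range (funext hfj).symm

end DirectPart

end SphereHyp

end

/-! ### Assembly of the direct and converse parts, with m = n − l. -/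

theorem mainTheorem4 (n l : ℕ) (hn : 4 ≤ n) (hl : 2 ≤ l) (hln : l ≤ n - 2) :
    -- Direct part
    (∀ (M : Type*) [TopologicalSpace M] [T2Space M] [SecondCountableTopology M]
        [ChartedSpace (SphereHyp.Euc n) M] [IsManifold (𝓡 n) ∞ M]
        (f η : M → SphereHyp.Euc (n + 2)) (lam σ : M → ℝ),
        SphereHyp.IsSphereImmersionOn n f univ →
        SphereHyp.IsGaussMapOn n f η univ →
        SphereHyp.IsPrincipalCurvatureOn n f η lam l univ →
        (∀ x, 0 < lam x) →
        (∀ x, 0 < σ x ∧ σ x < Real.pi / 2 ∧ lam x = Real.cot (σ x)) →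
        -- any open saturated set whose leaf space is a manifold
        (∀ (V : TopologicalSpace.Opens M),
          SphereHyp.IsSaturated n f η lam (V : Set M) →
          ∀ [ChartedSpace (SphereHyp.Euc (n - l)) (SphereHyp.LeafSpace n f η lam V)],
          SphereHyp.IsLeafManifold n f η lam V (n - l) →
          ∃ (g : SphereHyp.LeafSpace n f η lam V → SphereHyp.Euc (n + 2))
            (τ : SphereHyp.LeafSpace n f η lam V → ℝ),
            SphereHyp.IsSphereImmersionOn (n - l) g univ ∧
            (∀ x : V, SphereHyp.focalMap f η σ x = g (SphereHyp.leafProj n f η lam V x)) ∧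
            ContMDiff (𝓡 (n - l)) 𝓘(ℝ, ℝ) ∞ τ ∧
            (∀ p, 0 < τ p ∧ τ p < Real.pi / 2) ∧
            (∀ x : V, σ x = τ (SphereHyp.leafProj n f η lam V x)) ∧
            (∀ p, ‖SphereHyp.pushGradient (n - l) g τ p‖ < 1) ∧
            ∃ _ : ChartedSpace (SphereHyp.Euc n) (SphereHyp.UnitNormalBundle (n - l) g),
              SphereHyp.IsNormalBundleManifold (n - l) g n ∧
              ∃ j : V → SphereHyp.UnitNormalBundle (n - l) g,
                IsLocalDiffeomorph (𝓡 n) (𝓡 n) ∞ j ∧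
                (∀ x : V, f x = SphereHyp.tubeMap (n - l) g τ (j x)) ∧
                (CompactSpace M → V = ⊤ →
                  CompactSpace (SphereHyp.LeafSpace n f η lam V) ∧
                  IsCoveringMap j ∧ Function.Surjective j ∧
                  SphereHyp.IsSphereImmersionOn n (SphereHyp.tubeMap (n - l) g τ) univ ∧
                  range (SphereHyp.tubeMap (n - l) g τ) = range f)) ∧
        -- for compact `M` the whole leaf space is a compact manifold
        (CompactSpace M →
          CompactSpace (SphereHyp.LeafSpace n f η lam ⊤) ∧
          ∃ _ : ChartedSpace (SphereHyp.Euc (n - l)) (SphereHyp.LeafSpace n f η lam ⊤),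
            SphereHyp.IsLeafManifold n f η lam ⊤ (n - l))) ∧
    -- Converse part
    (∀ (L : Type*) [TopologicalSpace L] [T2Space L] [SecondCountableTopology L]
        [ConnectedSpace L] [ChartedSpace (SphereHyp.Euc (n - l)) L]
        [IsManifold (𝓡 (n - l)) ∞ L]
        (g : L → SphereHyp.Euc (n + 2)) (τ : L → ℝ),
        SphereHyp.IsSphereImmersionOn (n - l) g univ →
        ContMDiff (𝓡 (n - l)) 𝓘(ℝ, ℝ) ∞ τ →
        (∀ p, 0 < τ p ∧ τ p < Real.pi / 2) →
        (∀ p, ‖SphereHyp.pushGradient (n - l) g τ p‖ < 1) →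
        ∃ _ : ChartedSpace (SphereHyp.Euc n) (SphereHyp.UnitNormalBundle (n - l) g),
          SphereHyp.IsNormalBundleManifold (n - l) g n ∧
          IsOpen (SphereHyp.regularSet (n - l) g τ n) ∧
          SphereHyp.IsSphereImmersionOn n (SphereHyp.tubeMap (n - l) g τ)
            (SphereHyp.regularSet (n - l) g τ n) ∧
          ∃ η : SphereHyp.UnitNormalBundle (n - l) g → SphereHyp.Euc (n + 2),
            SphereHyp.IsGaussMapOn n (SphereHyp.tubeMap (n - l) g τ) η (SphereHyp.regularSet (n - l) g τ n) ∧
            SphereHyp.IsPrincipalCurvatureOn n (SphereHyp.tubeMap (n - l) g τ) η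
              (fun q => Real.cot (τ q.base)) l (SphereHyp.regularSet (n - l) g τ n)) := by

  have hnl : n = (n - l) + l := by omega
  refine ⟨?_, ?_⟩
  · intro M _ _ _ _ _ f η lam σ hf hη hlam hlam0 hσ
    have h := SphereHyp.principalHypersurface_of_isPrincipalCurvatureOn hl hf hη hlam hσ
    refine ⟨fun V hV inst hL => ?_, fun hM => ⟨h.compactSpace_leafSpace,
      h.exists_isLeafManifold hnl⟩⟩
    have := hL.isManifold
    have := hL.t2Space
    obtain ⟨g, τ, hF⟩ := h.exists_focalFactorization hnl V hL
    have hT := hF.tubeData hnl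
    obtain ⟨c, hc, -⟩ := hT.exists_bundle_charts hnl
    let instΛ := SphereHyp.chartedSpaceOfCharts c hc.mem_source
    obtain ⟨j, hj, hfj, hbase⟩ := hF.exists_lift hnl hc
    refine ⟨g, τ, hT.isSphereImmersionOn, hF.focal_eq, hT.contMDiff_radius,
      fun p => ⟨hT.radius_pos p, hT.radius_lt p⟩, hF.sigma_eq, hT.gradient_lt, instΛ,
      hc.isNormalBundleManifold, j, hj, hfj, ?_⟩
    rintro hM rfl
    have : CompactSpace (⊤ : TopologicalSpace.Opens M) :=
      isCompact_iff_compactSpace.1 isCompact_univ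
    obtain ⟨h1, h2, h3, h4⟩ := hF.covering hnl (by omega) hc.isNormalBundleManifold hj hfj hbase
    refine ⟨h.compactSpace_leafSpace, h1, h2, h3, h4.trans ?_⟩
    ext y
    exact ⟨fun ⟨x, hx⟩ => ⟨x, hx⟩, fun ⟨x, hx⟩ => ⟨⟨x, trivial⟩, hx⟩⟩
  · intro L _ _ _ _ _ _ g τ hg hτ hτ0 hgrad
    have hT : SphereHyp.TubeData (n - l) g τ :=
      ⟨contMDiffOn_univ.1 hg.contMDiffOn, hτ, fun p => hg.injective_differential p (mem_univ p),
        fun p => by rw [real_inner_self_eq_norm_sq, hg.norm_eq_one p (mem_univ p), one_pow],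
        fun p => (hτ0 p).1, fun p => (hτ0 p).2, hgrad⟩
    exact hT.exists_tube_hypersurface hnl
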